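/- Let $X$ be a (Hausdorff) complex space and let $E_1,E_2$ be coherent $\mathcal O_X$-modules such that the complex vector space $W:=\mathrm{Ext}^1_{\mathcal O_X}(E_2,E_1)$ is finite dimensional (this is automatic if $X$ is compact). Let $p:X\times W\to X$ be the projection, let $\xi_1,\dots,\xi_n$ be a basis of $W$ with dual coordinate functions $x_1,\dots,x_n$ on $W$, and let $$0\to p^*E_1\xrightarrow{\ \iota\ }\mathcal E\xrightarrow{\ \pi\ }p^*E_2\to 0$$ be the universal extension on $X\times W$, i.e. an extension whose class is the tautological class $\sum_j x_j\,p^*\xi_j\in \mathrm{Ext}^1_{\mathcal O_{X\times W}}(p^*E_2,p^*E_1)$ (the image of $\mathrm{id}_W\in W^*\otimes W$). Then its restriction $E_1\xrightarrow{\alpha}\mathcal E_0\xrightarrow{\beta}E_2$ to the central fibre $X\times\{0\}$ splits: $\beta$ has a section. Let $s:E_2\to\mathcal E_0$ be any section of $\beta$. Then $(\alpha,s):E_1\oplus E_2\to\mathcal E_0$ is an isomorphism; let $\phi:\mathcal E_0\to E_1\oplus E_2$ be its inverse, so that $(\mathcal E,\phi)$ is a family of sheaves over $(W,0)$ with central fibre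 identified with $E_1\oplus E_2$. For $\xi\in W=T_0W$ let $\nearrow\,\hookrightarrow W$ be the morphism from the double point $\nearrow=(\mathrm{point},\mathbb C[t]/(t^2))$ to $(W,0)$ with tangent vector $\xi$, i.e. given by $x_j\mapsto \xi(x_j)\,t$, where $\xi(x_j)$ is the $j$-th coordinate of $\xi$. Then the restriction of $(\mathcal E,\phi)$ to $X\times\nearrow$ is a first-order deformation of $E_1\oplus E_2$ (coherent, flat over $\mathbb C[t]/(t^2)$, with central fibre identified with $E_1\oplus E_2$). Let $\tau(\xi)\in\mathrm{Ext}^1_{\mathcal O_X}(E_1\oplus E_2,E_1\oplus E_2)$ be the class corresponding to it, i.e. the class of the extension $0\to E_1\oplus E_2\to\mathcal E|_{X\times\nearrow}\to E_1\oplus E_2\to0$ of $\mathcal O_X$-modules obtained by tensoring with $0\to\mathcal O_X\xrightarrow{t}\mathcal O_X[t]/(t^2)\to\mathcal O_X\to0$. This tangent map $\tau:\mathrm{Ext}^1(E_2,E_1)\to\mathrm{Ext}^1(E_1\oplus E_2,E_1\oplus E_2)$ is linear and injective, and it is the natural inclusion $$\tau=(\phi\circ\alpha)_*\circ(\beta\circ\phi^{-1})^*=(\beta\circ\phi^{-1})^*\circ(\phi\circ\alpha)_*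 .$$ Moreover $\tau$ is equivariant with respect to the homomorphism $\mathrm{Aut}(E_1)\times\mathrm{Aut}(E_2)\to\mathrm{Aut}(E_1\oplus E_2)$, $(g_1,g_2)\mapsto g_1\oplus g_2$, where $(g_1,g_2)$ acts on $\mathrm{Ext}^1(E_2,E_1)$ by $(g_1)_*\circ(g_2^{-1})^*$ and $g\in\mathrm{Aut}(E_1\oplus E_2)$ acts on $\mathrm{Ext}^1(E_1\oplus E_2,E_1\oplus E_2)$ by $g_*\circ(g^{-1})^*$. -/

import Mathlib

open CategoryTheory Limits TopologicalSpace Opposite AlgebraicGeometry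
open scoped Topology

noncomputable section

namespace Cpx

instance preservesLimits_forget_commRing :
    PreservesLimits (forget₂ (CommAlgCat.{0} ℂ) CommRingCat.{0}) :=
  preservesLimits_of_natIso (Iso.refl _ :
    (commAlgCatEquivUnder (.of ℂ)).functor ⋙ Under.forget _ ≅
      forget₂ (CommAlgCat.{0} ℂ) CommRingCat.{0})

instance preservesLimits_forget_type : PreservesLimits (forget (CommAlgCat.{0} ℂ)) :=
  preservesLimits_of_natIso (Iso.refl _ :
    forget₂ (CommAlgCat.{0} ℂ) CommRingCat.{0} ⋙ forget CommRingCat.{0} ≅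
      forget (CommAlgCat.{0} ℂ))

/-- A `ℂ`-ringed space: a topological space with a sheaf of commutative `ℂ`-algebras. -/
abbrev Space : Type 1 := SheafedSpace (CommAlgCat.{0} ℂ)

/-- Sections of the structure sheaf over an open set. -/
abbrev Sec (X : Space) (U : Opens X) : Type := X.presheaf.obj (op U)

/-- Restriction of sections. -/
def res {X : Space} {U V : Opens X} (h : V ≤ U) : Sec X U →ₐ[ℂ] Sec X V :=
  (X.presheaf.map (homOfLE h).op).hom

/-- Inverse image of an open set. -/
abbrev preim {X Y : Space} (f : X ⟶ Y) (V : Opens Y) : Opens X :=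
  (Opens.map f.hom.base).obj V

/-- Pull-back of sections. -/
def pull {X Y : Space} (f : X ⟶ Y) (V : Opens Y) : Sec Y V →ₐ[ℂ] Sec X (preim f V) :=
  (f.hom.c.app (op V)).hom

section Affine

variable (E : Type) [NormedAddCommGroup E] [NormedSpace ℂ E]

/-- The algebra of holomorphic (i.e. locally given by convergent power series) functions on an
open subset of `E`. -/
def hol (U : Opens E) : Subalgebra ℂ (U → ℂ) where
  carrier := {f | ∀ x : U, ∃ g : E → ℂ, AnalyticAt ℂ g x ∧
    ∀ᶠ z in 𝓝 (x : E), ∀ hz : z ∈ U, g z = f ⟨z, hz⟩}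
  mul_mem' := by
    intro f₁ f₂ h₁ h₂ x
    obtain ⟨g₁, a₁, e₁⟩ := h₁ x
    obtain ⟨g₂, a₂, e₂⟩ := h₂ x
    refine ⟨g₁ * g₂, a₁.mul a₂, ?_⟩
    filter_upwards [e₁, e₂] with z k₁ k₂ hz
    simp [k₁ hz, k₂ hz]
  add_mem' := by
    intro f₁ f₂ h₁ h₂ x
    obtain ⟨g₁, a₁, e₁⟩ := h₁ x
    obtain ⟨g₂, a₂, e₂⟩ := h₂ x
    refine ⟨g₁ + g₂, a₁.add a₂, ?_⟩
    filter_upwards [e₁, e₂] with z k₁ k₂ hz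
    simp [k₁ hz, k₂ hz]
  algebraMap_mem' := fun c x => ⟨fun _ => c, analyticAt_const, by simp⟩

/-- Restriction of holomorphic functions. -/
def holRes {U V : Opens E} (h : V ≤ U) : hol E U →ₐ[ℂ] hol E V where
  toFun f := ⟨fun x => f.1 ⟨x, h x.2⟩, fun x => by
    obtain ⟨g, a, e⟩ := f.2 ⟨x, h x.2⟩
    refine ⟨g, a, ?_⟩
    filter_upwards [e] with z k hz using k (h hz)⟩
  map_one' := rfl
  map_mul' _ _ := rfl
  map_zero' := rfl
  map_add' _ _ := rfl
  commutes' _ := rfl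

/-- The presheaf of holomorphic functions. -/
def holPresheaf : TopCat.Presheaf (CommAlgCat.{0} ℂ) (TopCat.of E) where
  obj U := CommAlgCat.of ℂ (hol E U.unop)
  map i := CommAlgCat.ofHom (holRes E (leOfHom i.unop))
  map_id _ := rfl
  map_comp _ _ := rfl

lemma holPresheaf_isSheaf : (holPresheaf E).IsSheaf := by
  rw [TopCat.Presheaf.isSheaf_iff_isSheafUniqueGluing]
  intro ι U sf hsf
  have key : ∀ (i j : ι) (x : E) (hi : x ∈ U i) (hj : x ∈ U j),
      (sf i : hol E (U i)).1 ⟨x, hi⟩ = (sf j : hol E (U j)).1 ⟨x, hj⟩ := by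
    intro i j x hi hj
    have := congrArg (fun t : hol E (U i ⊓ U j) => t.1 ⟨x, hi, hj⟩) (hsf i j)
    exact this
  have ex : ∀ x : (iSup U : Opens E), ∃ i, (x : E) ∈ U i := fun x =>
    Opens.mem_iSup.mp x.2
  choose k hk using ex
  refine ⟨(⟨fun x => (sf (k x) : hol E (U (k x))).1 ⟨x, hk x⟩, ?_⟩ : hol E (iSup U)), ?_, ?_⟩
  · intro x
    obtain ⟨g, a, e⟩ := (sf (k x) : hol E (U (k x))).2 ⟨x, hk x⟩
    refine ⟨g, a, ?_⟩
    have ho : ∀ᶠ z in 𝓝 (x : E), z ∈ U (k x) := (U (k x)).isOpen.mem_nhds (hk x)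
    filter_upwards [e, ho] with z kz hz hz'
    rw [kz hz]
    exact key _ _ _ _ _
  · intro i
    apply Subtype.ext
    funext x
    exact key _ _ _ _ _
  · intro s hs
    apply Subtype.ext
    funext x
    have := congrArg (fun t : hol E (U (k x)) => t.1 ⟨x, hk x⟩) (hs (k x))
    exact this

/-- The complex manifold underlying a (finite-dimensional) normed complex vector space. -/
def Aff : Space where
  carrier := TopCat.of E
  presheaf := holPresheaf E
  IsSheaf := holPresheaf_isSheaf E

variable {E}
variable {F : Type} [NormedAddCommGroup F] [NormedSpace ℂ F]

/-- The holomorphic map defined by a continuous linear map. -/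
def linMap (L : E →L[ℂ] F) : Aff E ⟶ Aff F :=
  InducedCategory.homMk (X := Aff E) (Y := Aff F)
  { base := TopCat.ofHom ⟨L, L.continuous⟩
    c :=
      { app := fun U => CommAlgCat.ofHom (X := hol F U.unop)
          (Y := hol E ((Opens.map (TopCat.ofHom ⟨L, L.continuous⟩)).obj U.unop))
          { toFun := fun f => ⟨fun x => f.1 ⟨L x, x.2⟩, fun x => by
              obtain ⟨g, a, e⟩ := f.2 ⟨L x, x.2⟩
              refine ⟨g ∘ L, AnalyticAt.comp a (L.analyticAt x), ?_⟩
              filter_upwards [L.continuous.continuousAt.eventually e] with z kz hz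
              exact kz hz⟩
            map_one' := rfl
            map_mul' := fun _ _ => rfl
            map_zero' := rfl
            map_add' := fun _ _ => rfl
            commutes' := fun _ => rfl }
        naturality := fun _ _ _ => rfl } }

/-- A continuous linear form, as a global holomorphic function. -/
def linFun (l : E →L[ℂ] ℂ) : Sec (Aff E) ⊤ :=
  (⟨fun x => l x, fun x => ⟨l, l.analyticAt x, by simp⟩⟩ : hol E ⊤)

end Affine

section Dual

/-- `A ↦ A[t]/(t²)` on morphisms. -/
def dualMap {A B : Type} [CommRing A] [CommRing B] [Algebra ℂ A] [Algebra ℂ B] (f : A →ₐ[ℂ] B) :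
    DualNumber A →ₐ[ℂ] DualNumber B where
  toFun x := (f x.fst, f x.snd)
  map_one' := by
    apply TrivSqZeroExt.ext
    · exact map_one f
    · exact map_zero f
  map_mul' x y := by
    apply TrivSqZeroExt.ext
    · exact map_mul f _ _
    · change f (x.fst • y.snd + MulOpposite.op y.fst • x.snd) =
        f x.fst • f y.snd + MulOpposite.op (f y.fst) • f x.snd
      simp [mul_comm]
  map_zero' := by
    apply TrivSqZeroExt.ext
    · exact map_zero f
    · exact map_zero f
  map_add' x y := by
    apply TrivSqZeroExt.ext
    · exact map_add f _ _
    · exact map_add f _ _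
  commutes' r := by
    apply TrivSqZeroExt.ext
    · exact f.commutes r
    · exact map_zero f

/-- `A ↦ A[t]/(t²)` as a functor. -/
def dualFunctor : CommAlgCat.{0} ℂ ⥤ CommAlgCat.{0} ℂ where
  obj A := CommAlgCat.of ℂ (DualNumber A)
  map f := CommAlgCat.ofHom (dualMap f.hom)
  map_id _ := rfl
  map_comp _ _ := rfl

lemma dual_isSheaf (X : Space) :
    TopCat.Presheaf.IsSheaf (X := (X : TopCat)) (X.presheaf ⋙ dualFunctor) := by
  rw [TopCat.Presheaf.isSheaf_iff_isSheafUniqueGluing]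
  intro ι U sf hsf
  have hX := (TopCat.Presheaf.isSheaf_iff_isSheafUniqueGluing X.presheaf).mp X.IsSheaf
  obtain ⟨a, ha, ha'⟩ := hX U (fun i => TrivSqZeroExt.fst (sf i : DualNumber (Sec X (U i))))
    (fun i j => congrArg (fun t : DualNumber (Sec X (U i ⊓ U j)) => t.fst) (hsf i j))
  obtain ⟨b, hb, hb'⟩ := hX U (fun i => TrivSqZeroExt.snd (sf i : DualNumber (Sec X (U i))))
    (fun i j => congrArg (fun t : DualNumber (Sec X (U i ⊓ U j)) => t.snd) (hsf i j))
  refine ⟨((a, b) : DualNumber (Sec X (iSup U))), ?_, ?_⟩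
  · intro i
    apply TrivSqZeroExt.ext
    · exact ha i
    · exact hb i
  · intro s hs
    apply TrivSqZeroExt.ext
    · exact ha' (TrivSqZeroExt.fst (s : DualNumber (Sec X (iSup U))))
        (fun i => congrArg (fun t : DualNumber (Sec X (U i)) => t.fst) (hs i))
    · exact hb' (TrivSqZeroExt.snd (s : DualNumber (Sec X (iSup U))))
        (fun i => congrArg (fun t : DualNumber (Sec X (U i)) => t.snd) (hs i))

/-- The product of `X` with the double point: the space `X` with the structure sheaf
`𝒪_X[t]`, `t² = 0`. -/
def double (X : Space) : Space where
  carrier := X.carrier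
  presheaf := X.presheaf ⋙ dualFunctor
  IsSheaf := dual_isSheaf X

/-- The global function `t` on `double X`. -/
def tee (X : Space) : Sec (double X) ⊤ := (DualNumber.eps : DualNumber (Sec X ⊤))

/-- The inclusion of `X` into `double X`, given by `t ↦ 0`. -/
def dualIncl (X : Space) : X ⟶ double X :=
  InducedCategory.homMk (X := X) (Y := double X)
  { base := 𝟙 X.carrier
    c :=
      { app := fun U => CommAlgCat.ofHom (X := DualNumber (Sec X U.unop)) (Y := Sec X U.unop)
          (TrivSqZeroExt.fstHom ℂ (Sec X U.unop) (Sec X U.unop))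
        naturality := fun _ _ _ => rfl } }

/-- The projection `double X ⟶ X`, given by the inclusion of `𝒪_X` into `𝒪_X[t]`. -/
def dualProj (X : Space) : double X ⟶ X :=
  InducedCategory.homMk (X := double X) (Y := X)
  { base := 𝟙 X.carrier
    c :=
      { app := fun U => CommAlgCat.ofHom (X := Sec X U.unop) (Y := DualNumber (Sec X U.unop))
          (TrivSqZeroExt.inlAlgHom ℂ (Sec X U.unop) (Sec X U.unop))
        naturality := fun U V i => by
          ext x
          apply TrivSqZeroExt.ext
          · rfl
          · exact (map_zero (X.presheaf.map i).hom).symm } }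

lemma dualIncl_dualProj (X : Space) : dualIncl X ≫ dualProj X = 𝟙 X := by
  refine SheafedSpace.ext _ _ rfl ?_
  ext U x
  exact congrArg (fun g => g x) (congrArg CommAlgCat.Hom.hom (X.presheaf.map_id (op U)))

end Dual


section Modules

/-- The structure sheaf as a sheaf of rings. -/
abbrev ringSheaf (X : Space) : TopCat.Sheaf RingCat.{0} (X : TopCat) :=
  (sheafCompose _ (forget₂ (CommAlgCat.{0} ℂ) CommRingCat.{0} ⋙
    forget₂ CommRingCat.{0} RingCat.{0})).obj X.sheaf

/-- Sheaves of `𝒪_X`-modules. -/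
abbrev Mod (X : Space) : Type 1 := SheafOfModules.{0} (ringSheaf X)

/-- The morphism of sheaves of rings underlying a morphism of spaces. -/
def ringHom {X Y : Space} (f : X ⟶ Y) :
    ringSheaf Y ⟶ ((Opens.map f.hom.base).sheafPushforwardContinuous
      RingCat.{0} (Opens.grothendieckTopology _) (Opens.grothendieckTopology _)).obj (ringSheaf X) where
  hom := Functor.whiskerRight f.hom.c _

/-- Direct image of modules. -/
abbrev pushf {X Y : Space} (f : X ⟶ Y) : Mod X ⥤ Mod Y := SheafOfModules.pushforward (ringHom f)

instance pushf_isRightAdjoint {X Y : Space} (f : X ⟶ Y) : (pushf f).IsRightAdjoint :=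
  haveI : (PresheafOfModules.pushforward.{0} (F := Opens.map f.hom.base)
      (R := (ringSheaf X).obj) (S := (ringSheaf Y).obj) (ringHom f).hom).IsRightAdjoint :=
    PresheafOfModules.instIsRightAdjointPushforward (F := Opens.map f.hom.base) (ringHom f).hom
  SheafOfModules.instIsRightAdjointPushforward (ringHom f)

/-- Inverse image `f^*` of modules. -/
abbrev pullb {X Y : Space} (f : X ⟶ Y) : Mod Y ⥤ Mod X := SheafOfModules.pullback (ringHom f)

/-- `f^*` is left adjoint to `f_*`. -/
abbrev adj {X Y : Space} (f : X ⟶ Y) : pullb f ⊣ pushf f :=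
  SheafOfModules.pullbackPushforwardAdjunction (ringHom f)

/-- `(𝟙 X)_* M ≅ M`. -/
def pushfId (X : Space) : pushf (𝟙 X) ≅ 𝟭 (Mod X) := SheafOfModules.pushforwardId (ringSheaf X)

/-- `g_* f_* M ≅ (f ≫ g)_* M`. -/
def pushfComp {X Y Z : Space} (f : X ⟶ Y) (g : Y ⟶ Z) :
    pushf f ⋙ pushf g ≅ pushf (f ≫ g) := SheafOfModules.pushforwardComp _ _
/-- `(𝟙 X)^* M ≅ M`. -/
def pullbId (X : Space) : pullb (𝟙 X) ≅ 𝟭 (Mod X) := (adj (𝟙 X)).leftAdjointIdIso (pushfId X)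
/-- `f^* g^* M ≅ (f ≫ g)^* M`. -/
def pullbComp {X Y Z : Space} (f : X ⟶ Y) (g : Y ⟶ Z) :
    pullb g ⋙ pullb f ≅ pullb (f ≫ g) :=
  Adjunction.leftAdjointCompIso (adj g) (adj f) (adj (f ≫ g)) (pushfComp f g)


variable {X : Space}

/-- Sections of a module over an open set. -/
abbrev MSec (M : Mod X) (U : Opens X) : Type := M.val.obj (op U)

instance modSec (M : Mod X) (U : Opens X) : Module (Sec X U) (MSec M U) :=
  (M.val.obj (op U)).isModule

/-- Restriction of sections of a module. -/
def mres (M : Mod X) {U V : Opens X} (h : V ≤ U) (m : MSec M U) : MSec M V :=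
  M.val.map (homOfLE h).op m

lemma mres_smul (M : Mod X) {U V : Opens X} (h : V ≤ U) (a : Sec X U) (m : MSec M U) :
    mres M h (a • m) = res h a • mres M h m :=
  M.val.map_smul (homOfLE h).op a m

/-- Restriction of a global function to an open set. -/
def glob (U : Opens X) : Sec X ⊤ →ₐ[ℂ] Sec X U := res le_top

/-- Multiplication by a global function, on sections over `U`. -/
def mulSec (a : Sec X ⊤) (M : Mod X) (U : Opens X) : MSec M U →ₗ[Sec X U] MSec M U :=
  LinearMap.lsmul (Sec X U) (MSec M U) (glob U a)

/-- Multiplication by a global function, as an endomorphism of an `𝒪_X`-module. -/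
def mulEnd (a : Sec X ⊤) (M : Mod X) : M ⟶ M where
  val :=
    { app := fun U => ModuleCat.ofHom (mulSec a M U.unop)
      naturality := fun {U V} i => by
        ext m
        change glob V.unop a • (show MSec M V.unop from M.val.map i m) = M.val.map i (glob U.unop a • (show MSec M U.unop from m))
        refine Eq.trans ?_ (M.val.map_smul i (glob U.unop a) m).symm
        congr 1
        have : X.presheaf.map (homOfLE (le_top : V.unop ≤ ⊤)).op =
          X.presheaf.map (homOfLE (le_top : U.unop ≤ ⊤)).op ≫ X.presheaf.map i := by
          rw [← X.presheaf.map_comp]; rfl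
        exact congrArg (fun t => t.hom a) this }

lemma hom_ext' {M N : Mod X} (f g : M ⟶ N)
    (h : ∀ (U : Opens X) (m : MSec M U), f.val.app (op U) m = g.val.app (op U) m) : f = g := by
  apply SheafOfModules.hom_ext
  ext U m
  exact h U.unop m

lemma mulEnd_app (a : Sec X ⊤) (M : Mod X) (U : Opens X) (m : MSec M U) :
    (mulEnd a M).val.app (op U) m = glob U a • m := rfl

lemma mulEnd_add (a b : Sec X ⊤) (M : Mod X) : mulEnd (a + b) M = mulEnd a M + mulEnd b M := by
  refine hom_ext' _ _ fun U m => ?_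
  change glob U (a + b) • m = glob U a • m + glob U b • m
  rw [map_add, add_smul]

lemma mulEnd_zero (M : Mod X) : mulEnd 0 M = 0 := by
  refine hom_ext' _ _ fun U m => ?_
  change glob U (0 : Sec X ⊤) • m = 0
  rw [map_zero, zero_smul]

lemma mulEnd_one (M : Mod X) : mulEnd 1 M = 𝟙 M := by
  refine hom_ext' _ _ fun U m => ?_
  change glob U (1 : Sec X ⊤) • m = m
  rw [map_one, one_smul]

lemma mulEnd_mul (a b : Sec X ⊤) (M : Mod X) : mulEnd (a * b) M = mulEnd a M ≫ mulEnd b M := by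
  refine hom_ext' _ _ fun U m => ?_
  change glob U (a * b) • m = glob U b • glob U a • m
  rw [map_mul, mul_comm, mul_smul]

lemma mulEnd_comp (a : Sec X ⊤) {M N : Mod X} (f : M ⟶ N) : mulEnd a M ≫ f = f ≫ mulEnd a N := by
  refine hom_ext' _ _ fun U m => ?_
  exact (f.val.app (op U)).hom.map_smul (glob U a) m

/-- The `ℂ`-linear structure on the category of modules. -/
instance linearMod (X : Space) : Linear ℂ (Mod X) where
  homModule M N :=
    { smul := fun c f => mulEnd (algebraMap ℂ _ c) M ≫ f
      one_smul := fun f => by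
        change mulEnd (algebraMap ℂ _ 1) M ≫ f = f
        rw [map_one, mulEnd_one, Category.id_comp]
      mul_smul := fun c d f => by
        change mulEnd (algebraMap ℂ _ (c * d)) M ≫ f =
          mulEnd (algebraMap ℂ _ c) M ≫ mulEnd (algebraMap ℂ _ d) M ≫ f
        rw [map_mul, mulEnd_mul, Category.assoc]
      smul_zero := fun c => Limits.comp_zero
      smul_add := fun c f g => Preadditive.comp_add _ _ _ _ _ _
      add_smul := fun c d f => by
        change mulEnd (algebraMap ℂ _ (c + d)) M ≫ f =
          mulEnd (algebraMap ℂ _ c) M ≫ f + mulEnd (algebraMap ℂ _ d) M ≫ f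
        rw [map_add, mulEnd_add, Preadditive.add_comp]
      zero_smul := fun f => by
        change mulEnd (algebraMap ℂ _ 0) M ≫ f = 0
        rw [map_zero, mulEnd_zero, Limits.zero_comp] }
  smul_comp := fun M N P c f g => Category.assoc _ _ _
  comp_smul := fun M N P f c g => by
    change f ≫ mulEnd (algebraMap ℂ _ c) N ≫ g = mulEnd (algebraMap ℂ _ c) M ≫ f ≫ g
    rw [← Category.assoc, ← mulEnd_comp, Category.assoc]

instance hasExtMod (X : Space) : HasExt.{1} (Mod X) := HasExt.standard _

/-- The complex vector space of classes of extensions of `E₂` by `E₁`. -/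
abbrev ExtCls (E₂ E₁ : Mod X) : Type 1 := Abelian.Ext.{1} E₂ E₁ 1

/-- Coherent sheaves: `M` is of finite type (first part) and, for every open `U`, the sheaf of
relations between finitely many sections over `U` is of finite type (second part). -/
def IsCoherent (M : Mod X) : Prop :=
  (∀ x : X, ∃ (U : Opens X) (_ : x ∈ U) (n : ℕ) (s : Fin n → MSec M U),
    ∀ (V : Opens X) (hV : V ≤ U) (m : MSec M V), ∀ y ∈ V,
      ∃ (V' : Opens X) (h : V' ≤ V) (_ : y ∈ V') (a : Fin n → Sec X V'),
        mres M h m = ∑ i, a i • mres M (h.trans hV) (s i)) ∧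
  (∀ (U : Opens X) (n : ℕ) (s : Fin n → MSec M U), ∀ x ∈ U,
    ∃ (V : Opens X) (hV : V ≤ U) (_ : x ∈ V) (k : ℕ) (r : Fin k → Fin n → Sec X V),
      (∀ j, ∑ i, r j i • mres M hV (s i) = 0) ∧
      ∀ (V' : Opens X) (h : V' ≤ V) (a : Fin n → Sec X V'),
        ∑ i, a i • mres M (h.trans hV) (s i) = 0 → ∀ y ∈ V',
          ∃ (V'' : Opens X) (h' : V'' ≤ V') (_ : y ∈ V'') (b : Fin k → Sec X V''),
            ∀ i, res h' (a i) = ∑ j, b j * res (h'.trans h) (r j i))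


/-- The structure map `ℂ[t] ⟶ 𝒪_X[t](U)`. -/
def dualStr (X : Space) (U : Opens (double X)) : DualNumber ℂ →ₐ[ℂ] Sec (double X) U :=
  dualMap (Algebra.ofId ℂ (Sec X U))

/-- The structure map from `ℂ[t]` to the stalk of `𝒪_X[t]` at `x`. -/
def dualStalk (X : Space) (x : double X) :
    DualNumber ℂ →+* TopCat.Presheaf.stalk (C := RingCat.{0}) (X := (double X : TopCat))
      (ringSheaf (double X)).obj x :=
  (TopCat.Presheaf.germ (C := RingCat.{0}) (X := (double X : TopCat))
    (ringSheaf (double X)).obj ⊤ x trivial).hom.comp (dualStr X ⊤).toRingHom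

/-- A module on `double X` is flat over the double point: its stalks are flat `ℂ[t]`-modules. -/
def IsFlatDual {X : Space} (M : Mod (double X)) : Prop :=
  ∀ x : double X,
    letI := Module.compHom (TopCat.Presheaf.stalk (C := Ab.{0}) (X := (double X : TopCat)) M.val.presheaf x)
      (dualStalk X x)
    Module.Flat (DualNumber ℂ)
      (TopCat.Presheaf.stalk (C := Ab.{0}) (X := (double X : TopCat)) M.val.presheaf x)

end Modules

section ComplexSpaces

/-- The open subspace of `X` on an open set. -/
def sub (X : Space) (U : Opens X) : Space := SheafedSpace.restrict X U.isOpenEmbedding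

/-- The inclusion of an open subspace. -/
def subIncl (X : Space) (U : Opens X) : sub X U ⟶ X := SheafedSpace.ofRestrict X U.isOpenEmbedding

/-- `κ` is an isomorphism of `Y` onto the local model given by the holomorphic equations
`f₁ = ⋯ = f_k = 0` in the open set `D` of `E`: it is a topological embedding whose image is the
zero set of the `f_j`, and on stalks `𝒪_{E,κ(y)} ⟶ 𝒪_{Y,y}` is surjective with kernel
generated by the germs of the `f_j`. (Surjectivity and kernel of the maps of stalks are spelled out
with sections on small open sets.) -/
structure IsLocalModel {E : Type} [NormedAddCommGroup E] [NormedSpace ℂ E] {Y : Space}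
    (κ : Y ⟶ Aff E) (D : Opens (Aff E)) {k : ℕ} (f : Fin k → Sec (Aff E) D) : Prop where
  isEmbedding : Topology.IsEmbedding κ.hom.base
  range : ∀ z : E, z ∈ Set.range κ.hom.base ↔ ∃ hz : z ∈ D, ∀ j, (f j : hol E D).1 ⟨z, hz⟩ = 0
  surj : ∀ (V : Opens Y) (s : Sec Y V), ∀ y ∈ V, ∃ (D' : Opens (Aff E)) (g : Sec (Aff E) D')
    (V' : Opens Y) (h : V' ≤ V) (h' : V' ≤ preim κ D'), y ∈ V' ∧ res h s = res h' (pull κ D' g)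
  ker : ∀ (D' : Opens (Aff E)) (g : Sec (Aff E) D') (y : Y), y ∈ preim κ D' →
    ((∃ (V' : Opens Y) (h : V' ≤ preim κ D'), y ∈ V' ∧ res h (pull κ D' g) = 0) ↔
      ∃ (D'' : Opens (Aff E)) (h : D'' ≤ D') (h' : D'' ≤ D) (a : Fin k → Sec (Aff E) D''),
        y ∈ preim κ D'' ∧ res h g = ∑ j, a j * res h' (f j))

/-- Complex (analytic) spaces: Hausdorff `ℂ`-ringed spaces which are locally isomorphic to a
local model in some `ℂ^m`. -/
def IsComplexSpace (X : Space) : Prop :=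
  T2Space X ∧ ∀ x : X, ∃ (U : Opens X) (_ : x ∈ U) (m : ℕ) (κ : sub X U ⟶ Aff (Fin m → ℂ))
    (D : Opens (Aff (Fin m → ℂ))) (k : ℕ) (f : Fin k → Sec (Aff (Fin m → ℂ)) D),
    IsLocalModel κ D f

/-- `P`, with the projections `p` and `q`, is the product of the complex space `X` and the complex
vector space `F`: locally on `X`, where `X` is the model `f = 0` in `D ⊆ ℂ^m`, the space `P` is the
model `f(z) = 0` in `D × F ⊆ ℂ^m × F`, and `p`, `q` are induced by the projections. -/
def IsProduct {F : Type} [NormedAddCommGroup F] [NormedSpace ℂ F] {X P : Space}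
    (p : P ⟶ X) (q : P ⟶ Aff F) : Prop :=
  ∀ x : X, ∃ (U : Opens X) (_ : x ∈ U) (m : ℕ) (κ : sub X U ⟶ Aff (Fin m → ℂ))
    (D : Opens (Aff (Fin m → ℂ))) (k : ℕ) (f : Fin k → Sec (Aff (Fin m → ℂ)) D)
    (μ : sub P (preim p U) ⟶ Aff ((Fin m → ℂ) × F)) (pU : sub P (preim p U) ⟶ sub X U),
    IsLocalModel κ D f ∧
    IsLocalModel μ (preim (linMap (ContinuousLinearMap.fst ℂ (Fin m → ℂ) F)) D)
      (fun j => pull (linMap (ContinuousLinearMap.fst ℂ (Fin m → ℂ) F)) D (f j)) ∧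
    pU ≫ subIncl X U = subIncl P (preim p U) ≫ p ∧
    pU ≫ κ = μ ≫ linMap (ContinuousLinearMap.fst ℂ (Fin m → ℂ) F) ∧
    subIncl P (preim p U) ≫ q = μ ≫ linMap (ContinuousLinearMap.snd ℂ (Fin m → ℂ) F)

end ComplexSpaces

section Extensions

open Abelian

variable {X : Space}

/-- The action of `Aut E₁ × Aut E₂` on extension classes, `(g₁, g₂) ξ = (g₁)_* (g₂⁻¹)^* ξ`. -/
def act {E₁ E₂ : Mod X} (g : Aut E₁ × Aut E₂) (ξ : ExtCls E₂ E₁) : ExtCls E₂ E₁ :=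
  (Ext.mk₀ g.2.inv).comp (ξ.comp (Ext.mk₀ g.1.hom) (add_zero 1)) (zero_add 1)

/-- The homomorphism `Aut E₁ × Aut E₂ → Aut (E₁ ⊕ E₂)`. -/
def autSum (E₁ E₂ : Mod X) : Aut E₁ × Aut E₂ →* Aut (E₁ ⊞ E₂) where
  toFun g := biprod.mapIso g.1 g.2
  map_one' := by
    apply Aut.ext
    change biprod.map (𝟙 E₁) (𝟙 E₂) = 𝟙 (E₁ ⊞ E₂)
    apply biprod.hom_ext <;> simp
  map_mul' g g' := by
    apply Aut.ext
    change biprod.map (g'.1.hom ≫ g.1.hom) (g'.2.hom ≫ g.2.hom) =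
      biprod.map g'.1.hom g'.2.hom ≫ biprod.map g.1.hom g.2.hom
    apply biprod.hom_ext <;> simp

/-- `η` is the inverse image under `p` of the class `ξ`: an extension of class `ξ` pulls back to an
extension of class `η`. -/
def IsPullbackClass {P : Space} (p : P ⟶ X) {E₁ E₂ : Mod X} (ξ : ExtCls E₂ E₁)
    (η : ExtCls ((pullb p).obj E₂) ((pullb p).obj E₁)) : Prop :=
  ∃ (G : Mod X) (a : E₁ ⟶ G) (b : G ⟶ E₂) (w : a ≫ b = 0)
    (w' : (pullb p).map a ≫ (pullb p).map b = 0)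
    (h : (ShortComplex.mk a b w).ShortExact)
    (h' : (ShortComplex.mk ((pullb p).map a) ((pullb p).map b) w').ShortExact),
    h.extClass = ξ ∧ h'.extClass = η

/-- The `j`-th coordinate function on `ℂ^n`, pulled back along `q : P ⟶ ℂ^n`. -/
def coord {n : ℕ} {P : Space} (q : P ⟶ Aff (Fin n → ℂ)) (j : Fin n) : Sec P ⊤ :=
  pull q ⊤ (linFun (ContinuousLinearMap.proj j))

/-- A universal extension of `E₂` by `E₁`. The space `W` of extension classes is identified with
`ℂ^n` by means of a basis `ξ₁, …, ξ_n`, and `p`, `q` are the projections of `P = X × W`. A universal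
extension is an extension of `p^* E₂` by `p^* E₁` on `X × W` whose class is the tautological one,
`∑ⱼ xⱼ · p^* ξⱼ`, with `x₁, …, x_n` the dual basis of coordinate functions on `W` (this is the image
of `id_W ∈ W^* ⊗ W`). -/
structure UniversalExtension {n : ℕ} {P : Space} {E₁ E₂ : Mod X}
    (ξ : Module.Basis (Fin n) ℂ (ExtCls E₂ E₁)) (p : P ⟶ X) (q : P ⟶ Aff (Fin n → ℂ)) where
  sheaf : Mod P
  ι : (pullb p).obj E₁ ⟶ sheaf
  π : sheaf ⟶ (pullb p).obj E₂
  zero : ι ≫ π = 0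
  exact : (ShortComplex.mk ι π zero).ShortExact
  class_eq : ∃ η : Fin n → ExtCls ((pullb p).obj E₂) ((pullb p).obj E₁),
    (∀ j, IsPullbackClass p (ξ j) (η j)) ∧
    exact.extClass = ∑ j, (η j).comp (Ext.mk₀ (mulEnd (coord q j) _)) (add_zero 1)

/-- `i₀ : X ⟶ P = X × ℂ^n` is the inclusion of `X × {0}`. -/
structure IsZeroSection {n : ℕ} {P : Space} (p : P ⟶ X) (q : P ⟶ Aff (Fin n → ℂ))
    (i₀ : X ⟶ P) : Prop where
  comp_p : i₀ ≫ p = 𝟙 X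
  coord_eq : ∀ j, coord (i₀ ≫ q) j = 0

/-- The isomorphism `i₀^* p^* E ≅ E` for a section `i₀` of `p`. -/
def sectionIso {P : Space} {p : P ⟶ X} {i₀ : X ⟶ P} (h : i₀ ≫ p = 𝟙 X) (E : Mod X) :
    (pullb i₀).obj ((pullb p).obj E) ≅ E :=
  (pullbComp i₀ p).app E ≪≫ (eqToIso (congrArg pullb h)).app E ≪≫ (pullbId X).app E

namespace UniversalExtension

variable {n : ℕ} {P : Space} {E₁ E₂ : Mod X} {ξ : Module.Basis (Fin n) ℂ (ExtCls E₂ E₁)}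
  {p : P ⟶ X} {q : P ⟶ Aff (Fin n → ℂ)} (U : UniversalExtension ξ p q) {i₀ : X ⟶ P}

/-- The central fibre. -/
def fibre (_ : IsZeroSection p q i₀) : Mod X := (pullb i₀).obj U.sheaf

/-- The morphism `E₁ ⟶ ℰ₀` to the central fibre. -/
def α (h : IsZeroSection p q i₀) : E₁ ⟶ U.fibre h :=
  (sectionIso h.comp_p E₁).inv ≫ (pullb i₀).map U.ι

/-- The morphism `ℰ₀ ⟶ E₂` from the central fibre. -/
def β (h : IsZeroSection p q i₀) : U.fibre h ⟶ E₂ :=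
  (pullb i₀).map U.π ≫ (sectionIso h.comp_p E₂).hom

end UniversalExtension

end Extensions

section Deformations

variable {X : Space}

/-- A first-order deformation of `F`, i.e. a deformation of `F` with base the double point. -/
structure FirstOrderDeformation (F : Mod X) where
  sheaf : Mod (double X)
  coherent : IsCoherent sheaf
  flat : IsFlatDual sheaf
  iso : (pullb (dualIncl X)).obj sheaf ≅ F

namespace FirstOrderDeformation

variable {F : Mod X} (D : FirstOrderDeformation F)

/-- The deformation, viewed as an `𝒪_X`-module. -/
def under : Mod X := (pushf (dualProj X)).obj D.sheaf

/-- Multiplication by `t`. -/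
def mulT : D.under ⟶ D.under := (pushf (dualProj X)).map (mulEnd (tee X) D.sheaf)

/-- The `𝒪_X`-linear surjection of the deformation onto its central fibre `F`. -/
def toFibre : D.under ⟶ F :=
  (pushf (dualProj X)).map
      ((adj (dualIncl X)).unit.app D.sheaf ≫ (pushf (dualIncl X)).map D.iso.hom) ≫
    (pushfComp (dualIncl X) (dualProj X)).hom.app F ≫
    (eqToHom (congrArg pushf (dualIncl_dualProj X))).app F ≫ (pushfId X).hom.app F

/-- `c` is the class in `Ext¹(F, F)` corresponding to the first-order deformation `D`, that is,
the class of the extension `0 ⟶ F ⟶ D ⟶ F ⟶ 0` of `𝒪_X`-modules obtained by tensoring `D` with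
`0 ⟶ 𝒪_X ⟶ 𝒪_X[t] ⟶ 𝒪_X ⟶ 0`, where the first map is `t`. So `F ⟶ D` is the map through which
the multiplication by `t` on `D` factors. -/
def HasClass (c : ExtCls F F) : Prop :=
  ∃ (j : F ⟶ D.under) (_ : D.toFibre ≫ j = D.mulT) (w : j ≫ D.toFibre = 0)
    (h : (ShortComplex.mk j D.toFibre w).ShortExact), h.extClass = c

end FirstOrderDeformation

/-- Let `x₁, …, x_n` be the coordinates on `ℂ^n`. The morphism `h` is the embedding
`X × ↗ ⟶ X × ℂ^n` induced by the tangent vector `v` of `ℂ^n` at `0`, that is, by the morphism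
`↗ ⟶ ℂ^n`, `xⱼ ↦ vⱼ t`. -/
structure IsTangentEmbedding {n : ℕ} {P : Space} (p : P ⟶ X) (q : P ⟶ Aff (Fin n → ℂ))
    (i₀ : X ⟶ P) (v : Fin n → ℂ) (h : double X ⟶ P) : Prop where
  incl : dualIncl X ≫ h = i₀
  proj : h ≫ p = dualProj X
  coord_eq : ∀ j, coord (h ≫ q) j = v j • tee X

/-- Let `ℰ` be a sheaf on `P = X × ℂ^n` with an identification `φ` of its central fibre with `F`.
The class `c ∈ Ext¹(F, F)` is the value of the tangent map of `(ℰ, φ)` at the tangent vector `v`: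
the restriction of `(ℰ, φ)` to the double point with direction `v` is a first-order deformation
of `F`, and its class is `c`. -/
def IsTangentValue {n : ℕ} {P : Space} (p : P ⟶ X) (q : P ⟶ Aff (Fin n → ℂ)) (i₀ : X ⟶ P)
    (ℰ : Mod P) {F : Mod X} (φ : (pullb i₀).obj ℰ ≅ F) (v : Fin n → ℂ) (c : ExtCls F F) : Prop :=
  ∃ (h : double X ⟶ P) (hh : IsTangentEmbedding p q i₀ v h)
    (coh : IsCoherent ((pullb h).obj ℰ)) (flat : IsFlatDual ((pullb h).obj ℰ)),
    (FirstOrderDeformation.mk ((pullb h).obj ℰ) coh flat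
      ((pullbComp (dualIncl X) h).app ℰ ≪≫
        (eqToIso (congrArg pullb hh.incl)).app ℰ ≪≫ φ)).HasClass c

end Deformations

end Cpx

end

noncomputable section

namespace Cpx

/-! ### Extensions in abelian categories. -/

section AbelianLemmas

open Abelian

universe w v u

variable {C : Type u} [Category.{v} C] [Abelian C]

/-! The universal extension is governed by one extension on `X`. The fibre product over `E₂` of
extensions representing the basis classes is an extension `G` of `E₂` by `E₁ⁿ`, and there is a
morphism of extensions `k : p^* G ⟶ ℰ` that is the identity on `p^* E₂` and the tautological map
`(e_j) ↦ ∑ x_j e_j` on `p^* E₁ⁿ` (`UniversalExtension.exists_model`). Everything is read off from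
restrictions of `k`.

On `X × {0}` the tautological map vanishes, so `k` kills `E₁ⁿ` and descends to a section `s₀` of
`β`. On the double point in direction `ξ` the coordinate `x_j` becomes `ξ(x_j) t`, so the
tautological map becomes `t` times `V = ∑ ξ(x_j) π_j`, and `V_* [G] = ξ`. Let `N` be the restriction
of `ℰ` and `F = E₁ ⊞ E₂`. Multiplication by `t` factors as `N ⟶ F ⟶ N`, so `k` gives a morphism from
`G` to the extension `N` of `F` by `F` which is `V` followed by `inl` on `E₁ⁿ` and, for the section
`s₀`, covers `inr`. Hence `inr^* [N] = inl_* ξ`. The inclusion of `p^* E₁` in `ℰ` lifts `inl`, so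
`inl^* [N] = 0`. Together, `[N] = snd^* inl_* ξ` (`extClass_of_lifts`,
`UniversalExtension.extClass_eq`). Another section differs from `s₀` by a map `E₂ ⟶ E₁`, which is
absorbed into the lift of `G`. Linearity, injectivity and equivariance are then formal.

That `N` is a first-order deformation needs the restricted sequences to be exact, although inverse
images are only right exact. On the terms coming from `X` this holds because `i₀^* p^*` is the
identity and because the inverse image on `double X` is `M ⊕ tM` (`isIso_dualProjMap`);
`mono_map_of_extension_hom` passes injectivity from `p^* G` to `ℰ`. Then the kernel of `t` on `N`
equals its image, which gives flatness, the extension of `F` by `F`, and coherence.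

It remains to produce the embedding of the double point (`exists_isTangentEmbedding`), `P` being a
product only in charts. By Hadamard's lemma a function along the zero section is `p^* c + ∑ x_j
t_j`. The sum `∑ v_j i₀^* t_j` does not depend on this decomposition, as one sees by differentiating
a relation modulo the equations of `X`; this is the derivative `∂_v`, and the embedding is `s ↦ i₀^*
s + t ∂_v s`. -/

lemma exact_mk_iff {A B Z : C} {f : A ⟶ B} {g : B ⟶ Z} (w : f ≫ g = 0) :
    (ShortComplex.mk f g w).Exact ↔ ∀ (T : C) (x : T ⟶ B), x ≫ g = 0 →
      ∃ (T' : C) (π : T' ⟶ T) (_ : Epi π) (y : T' ⟶ A), π ≫ x = y ≫ f :=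
  ShortComplex.exact_iff_exact_up_to_refinements _

lemma ShortExact.exists_lift {A B Z : C} {f : A ⟶ B} {g : B ⟶ Z} {w : f ≫ g = 0}
    (h : (ShortComplex.mk f g w).ShortExact) {T : C} (x : T ⟶ B) (hx : x ≫ g = 0) :
    ∃ y : T ⟶ A, y ≫ f = x := by
  have := h.mono_f
  exact ⟨h.exact.lift x hx, h.exact.lift_f x hx⟩

lemma ShortExact.exists_desc {A B Z : C} {f : A ⟶ B} {g : B ⟶ Z} {w : f ≫ g = 0}
    (h : (ShortComplex.mk f g w).ShortExact) {T : C} (x : B ⟶ T) (hx : f ≫ x = 0) :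
    ∃ y : Z ⟶ T, g ≫ y = x := by
  have := h.epi_g
  exact ⟨h.exact.desc x hx, h.exact.g_desc x hx⟩

/-- If the class of an extension `S` is mapped by `a` to the class of an extension `S'`, then `a`
extends to a morphism of extensions. -/
lemma exists_hom_of_extClass [HasExt.{w} C] {A' B' A B Z : C} {f' : A' ⟶ B'} {g' : B' ⟶ Z}
    {w' : f' ≫ g' = 0} {f : A ⟶ B} {g : B ⟶ Z} {w : f ≫ g = 0}
    (h' : (ShortComplex.mk f' g' w').ShortExact) (h : (ShortComplex.mk f g w).ShortExact)
    (a : A' ⟶ A) (e : h'.extClass.comp (Ext.mk₀ a) (add_zero 1) = h.extClass) :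
    ∃ k : B' ⟶ B, f' ≫ k = a ≫ f ∧ k ≫ g = g' := by
  -- The obstruction to extending `a ≫ f` along `f'` is the image of the class of `h` in `Ext¹(Z,
  -- B)`, which vanishes.
  have h0 : h'.extClass.comp (Ext.mk₀ (a ≫ f)) (add_zero 1) = 0 := by
    rw [← Ext.mk₀_comp_mk₀, ← Ext.comp_assoc_of_third_deg_zero, e]
    exact h.extClass_comp
  obtain ⟨x, hx⟩ := Ext.contravariant_sequence_exact₁ h' B (Ext.mk₀ (a ≫ f)) (add_zero 1) h0
  obtain ⟨k, rfl⟩ := (Ext.mk₀_bijective _ _).2 x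
  have hk : f' ≫ k = a ≫ f := by
    rw [Ext.mk₀_comp_mk₀] at hx
    exact (Ext.mk₀_bijective _ _).1 hx
  obtain ⟨c, hc⟩ := ShortExact.exists_desc h' (k ≫ g) (by
    rw [← Category.assoc, hk, Category.assoc, w, comp_zero])
  let φ : ShortComplex.mk f' g' w' ⟶ ShortComplex.mk f g w :=
    { τ₁ := a, τ₂ := k, τ₃ := c, comm₁₂ := hk.symm, comm₂₃ := hc.symm }
  have hn : h'.extClass.comp (Ext.mk₀ a) (add_zero 1) =
      (Ext.mk₀ c).comp h.extClass (zero_add 1) := ShortComplex.ShortExact.extClass_naturality h' h φ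
  -- The extension `k` may induce some `c` other than the identity on `Z`. Since `c^*` and the
  -- identity agree on the class of `h`, `c - 𝟙` lifts to `B`, and the lift corrects `k`.
  have h1 : (Ext.mk₀ (c - 𝟙 Z)).comp h.extClass (zero_add 1) = 0 := by
    rw [sub_eq_add_neg, Ext.mk₀_add, Ext.mk₀_neg, Ext.add_comp, Ext.neg_comp, ← hn, e,
      Ext.mk₀_id_comp]
    exact add_neg_cancel _
  obtain ⟨y, hy⟩ := Ext.covariant_sequence_exact₃ Z h (Ext.mk₀ (c - 𝟙 Z)) (zero_add 1) h1
  obtain ⟨u, rfl⟩ := (Ext.mk₀_bijective _ _).2 y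
  have hu : u ≫ g = c - 𝟙 Z := by
    rw [Ext.mk₀_comp_mk₀] at hy
    exact (Ext.mk₀_bijective _ _).1 hy
  refine ⟨k - g' ≫ u, ?_, ?_⟩
  · rw [Preadditive.comp_sub, reassoc_of% w', zero_comp, sub_zero, hk]
  · rw [Preadditive.sub_comp, Category.assoc, hu, Preadditive.comp_sub, hc, Category.comp_id]
    abel

/-- Finitely many extensions of `Z` by `E` are the images of a single extension of `Z` by a power
of `E`. -/
lemma exists_joint_extension [HasFiniteBiproducts C] {n : ℕ} {E Z : C} (B : Fin n → C) (f : ∀ j, E ⟶ B j)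
    (g : ∀ j, B j ⟶ Z) (w : ∀ j, f j ≫ g j = 0)
    (h : ∀ j, (ShortComplex.mk (f j) (g j) (w j)).ShortExact) :
    ∃ (G : C) (a : (⨁ fun (_ : Fin n) => E) ⟶ G) (b : G ⟶ Z) (w : a ≫ b = 0)
      (k : ∀ j, G ⟶ B j), (ShortComplex.mk a b w).ShortExact ∧
      (∀ j, a ≫ k j = biproduct.π _ j ≫ f j) ∧ ∀ j, k j ≫ g j = b := by
  have : ∀ j, Mono (f j) := fun j => (h j).mono_f
  have : ∀ j, Epi (g j) := fun j => (h j).epi_g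
  let gg : (⨁ B) ⟶ ⨁ fun _ : Fin n => Z := biproduct.map g
  let d : Z ⟶ ⨁ fun _ : Fin n => Z := biproduct.lift fun _ => 𝟙 Z
  let ff : (⨁ fun (_ : Fin n) => E) ⟶ ⨁ B := biproduct.map f
  have hw : ff ≫ gg = 0 := by
    apply biproduct.hom_ext
    intro j
    simp [ff, gg, w]
  -- The joint extension is the sum of the given ones pulled back along the diagonal of `Z`.
  let a : (⨁ fun (_ : Fin n) => E) ⟶ pullback gg d := pullback.lift ff 0 (by simp [hw])
  have ha : a ≫ pullback.fst gg d = ff := pullback.lift_fst _ _ _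
  have hab : a ≫ pullback.snd gg d = 0 := pullback.lift_snd _ _ _
  have hk : ∀ j, (pullback.fst gg d ≫ biproduct.π _ j) ≫ g j = pullback.snd gg d := by
    intro j
    have := congrArg (· ≫ biproduct.π _ j) (pullback.condition (f := gg) (g := d))
    simpa [gg, d] using this
  have : Mono ff := inferInstanceAs (Mono (biproduct.map f))
  have : Mono a := mono_of_mono_fac ha
  have : Epi gg := inferInstanceAs (Epi (biproduct.map g))
  refine ⟨pullback gg d, a, pullback.snd gg d, hab, fun j => pullback.fst gg d ≫ biproduct.π _ j,
    ?_, ?_, hk⟩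
  · refine ShortComplex.ShortExact.mk' ((exact_mk_iff hab).2 ?_)
      (inferInstanceAs (Mono a)) (inferInstanceAs (Epi (pullback.snd gg d)))
    intro K k hk0
    have hk1 : ∀ j, (k ≫ pullback.fst gg d ≫ biproduct.π _ j) ≫ g j = 0 := by
      intro j
      rw [Category.assoc, hk j]
      exact hk0
    choose y hy using fun j => ShortExact.exists_lift (h j) _ (hk1 j)
    refine ⟨K, 𝟙 K, inferInstance, biproduct.lift y, ?_⟩
    rw [Category.id_comp]
    apply pullback.hom_ext
    · apply biproduct.hom_ext
      intro j
      rw [Category.assoc, Category.assoc, Category.assoc, reassoc_of% ha, biproduct.map_π,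
        biproduct.lift_π_assoc, hy]
    · rw [Category.assoc, hab, comp_zero, hk0]
  · intro j
    rw [reassoc_of% ha, biproduct.map_π]

/-- A right exact functor that maps the first morphism of `S` to a monomorphism also does so for
every extension that is a push-out of `S`. -/
lemma mono_map_of_extension_hom {D : Type*} [Category* D] [Abelian D] (F : C ⥤ D)
    [F.Additive] [PreservesFiniteColimits F]
    {A' B' A B Z : C} {f' : A' ⟶ B'} {g' : B' ⟶ Z} {w' : f' ≫ g' = 0} {f : A ⟶ B} {g : B ⟶ Z}
    {w : f ≫ g = 0} (h' : (ShortComplex.mk f' g' w').ShortExact)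
    (h : (ShortComplex.mk f g w).ShortExact) (a : A' ⟶ A) (k : B' ⟶ B) (h₁ : f' ≫ k = a ≫ f)
    (h₂ : k ≫ g = g') (hm : Mono (F.map f')) : Mono (F.map f) := by
  -- `B` is the push-out: `A' ⟶ A ⊞ B' ⟶ B ⟶ 0` is exact, and a right exact functor keeps this.
  have w₀ : biprod.lift a f' ≫ biprod.desc f (-k) = 0 := by
    simp [biprod.lift_desc, h₁]
  have : Mono f := h.mono_f
  have : Epi g := h.epi_g
  have : Epi g' := h'.epi_g
  have hE : (ShortComplex.mk (biprod.lift a f') (biprod.desc f (-k)) w₀).Exact := by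
    rw [exact_mk_iff]
    intro T x hx
    have hx' : (x ≫ biprod.fst) ≫ f = (x ≫ biprod.snd) ≫ k := by
      rw [← sub_eq_zero, ← hx]
      simp [biprod.desc_eq, sub_eq_add_neg]
    have h0 : (x ≫ biprod.snd) ≫ g' = 0 := by
      rw [← h₂, ← Category.assoc, ← hx', Category.assoc, w, comp_zero]
    obtain ⟨y, hy⟩ := ShortExact.exists_lift h' _ h0
    refine ⟨T, 𝟙 T, inferInstance, y, ?_⟩
    rw [Category.id_comp]
    apply biprod.hom_ext
    · rw [← cancel_mono f, hx']
      simp only [Category.assoc, biprod.lift_fst_assoc, ← h₁, reassoc_of% hy]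
    · rw [Category.assoc, biprod.lift_snd, hy]
  have : Epi (biprod.desc f (-k)) := by
    rw [epi_iff_surjective_up_to_refinements]
    intro T y
    obtain ⟨T', π, hπ, x, hx⟩ := surjective_up_to_refinements_of_epi g' (y ≫ g)
    have h0 : (π ≫ y - x ≫ k) ≫ g = 0 := by
      rw [Preadditive.sub_comp, Category.assoc, Category.assoc, h₂, hx, sub_self]
    obtain ⟨z, hz⟩ := ShortExact.exists_lift h _ h0
    refine ⟨T', π, hπ, biprod.lift z (-x), ?_⟩
    rw [biprod.lift_desc, hz]
    simp
  have w₁ : F.map (biprod.lift a f') ≫ F.map (biprod.desc f (-k)) = 0 := by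
    rw [← F.map_comp, w₀, F.map_zero]
  have hF : (ShortComplex.mk (F.map (biprod.lift a f')) (F.map (biprod.desc f (-k))) w₁).Exact :=
    hE.map_of_epi_of_preservesCokernel F (by dsimp; infer_instance) (by dsimp; infer_instance)
  rw [exact_mk_iff] at hF
  refine Preadditive.mono_of_cancel_zero _ fun {T} x hx => ?_
  -- If `x` dies in `F B`, then `(x, 0)` comes from some `y` in `F A'`. The second component says
  -- that `F f'` kills `y`, so `y = 0`, and the first gives `x = 0`.
  obtain ⟨T', π, hπ, y, hy⟩ := hF T (x ≫ F.map biprod.inl) (by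
    rw [Category.assoc, ← F.map_comp, biprod.inl_desc, hx])
  have hy0 : y = 0 := by
    have := congrArg (· ≫ F.map biprod.snd) hy
    simp only [Category.assoc, ← F.map_comp, biprod.inl_snd, biprod.lift_snd, F.map_zero,
      comp_zero] at this
    rw [← cancel_mono (F.map f'), zero_comp, this]
  have := congrArg (· ≫ F.map biprod.fst) hy
  simp only [Category.assoc, ← F.map_comp, biprod.inl_fst, F.map_id,
    Category.comp_id, hy0, zero_comp] at this
  rw [← cancel_epi π, this, comp_zero]

/-- A right exact functor maps a short exact sequence to a short exact sequence if it preserves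
the monomorphism. -/
lemma shortExact_map_of_mono {D : Type*} [Category* D] [Abelian D] (F : C ⥤ D)
    [F.Additive] [PreservesFiniteColimits F] {A B Z : C} {f : A ⟶ B} {g : B ⟶ Z} {w : f ≫ g = 0}
    (h : (ShortComplex.mk f g w).ShortExact) (hm : Mono (F.map f))
    (w' : F.map f ≫ F.map g = 0) : (ShortComplex.mk (F.map f) (F.map g) w').ShortExact := by
  have := h.epi_g
  have : Epi g := h.epi_g
  exact ShortComplex.ShortExact.mk'
    (h.exact.map_of_epi_of_preservesCokernel F (by dsimp; infer_instance) (by dsimp; infer_instance))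
    hm (by dsimp; infer_instance)

/-- Given compatible endomorphisms of square zero of the terms of a short exact sequence, exactness
(kernel equals image) for the outer terms implies exactness for the middle term. -/
lemma exact_endo_of_shortExact {A B Z : C} {f : A ⟶ B} {g : B ⟶ Z} {w : f ≫ g = 0}
    (h : (ShortComplex.mk f g w).ShortExact) {a : A ⟶ A} {b : B ⟶ B} {c : Z ⟶ Z}
    (ha : a ≫ a = 0) (hb : b ≫ b = 0) (hc : c ≫ c = 0)
    (hab : a ≫ f = f ≫ b) (hbc : b ≫ g = g ≫ c) (ea : (ShortComplex.mk a a ha).Exact)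
    (ec : (ShortComplex.mk c c hc).Exact) : (ShortComplex.mk b b hb).Exact := by
  have : Mono f := h.mono_f
  have : Epi g := h.epi_g
  rw [exact_mk_iff] at ea ec ⊢
  intro T x hx
  obtain ⟨T₁, π₁, _, y, hy⟩ := ec T (x ≫ g) (by
    rw [Category.assoc, ← hbc, reassoc_of% hx, zero_comp])
  obtain ⟨T₂, π₂, _, z, hz⟩ := surjective_up_to_refinements_of_epi g y
  have h0 : (π₂ ≫ π₁ ≫ x - z ≫ b) ≫ g = 0 := by
    rw [Preadditive.sub_comp, Category.assoc, Category.assoc, hy, Category.assoc, hbc,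
      reassoc_of% hz, sub_self]
  obtain ⟨e, he⟩ := ShortExact.exists_lift h _ h0
  obtain ⟨T₃, π₃, _, y', hy'⟩ := ea T₂ e (by
    rw [← cancel_mono f, Category.assoc, hab, reassoc_of% he, Preadditive.sub_comp, Category.assoc,
      Category.assoc, Category.assoc, hx, hb]
    simp)
  -- After refinement `x = b z + f e` with `e = a y'`, so `x` is the image under `b` of `z + f y'`.
  refine ⟨T₃, π₃ ≫ π₂ ≫ π₁, inferInstance, y' ≫ f + π₃ ≫ z, ?_⟩
  simp only [Preadditive.add_comp, Category.assoc, ← hab, ← reassoc_of% hy', he]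
  simp

end AbelianLemmas

/-! ### Direct and inverse images, and multiplication by functions. -/

section Functors

variable {X Y : Space} (f : X ⟶ Y)

instance pushf_additive : (pushf f).Additive where
  map_add := by intros; rfl

instance pullb_additive : (pullb f).Additive := (adj f).left_adjoint_additive

instance pullb_preservesFiniteColimits : PreservesFiniteColimits (pullb f) :=
  have := (adj f).leftAdjoint_preservesColimits
  inferInstance

instance mod_hasFiniteBiproducts (X : Space) : HasFiniteBiproducts (Mod X) :=
  Abelian.hasFiniteBiproducts

lemma res_comp {U V W : Opens X} (h : V ≤ U) (h' : W ≤ V) (a : Sec X U) :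
    res h' (res h a) = res (h'.trans h) a := by
  have : X.presheaf.map (homOfLE (h'.trans h)).op =
      X.presheaf.map (homOfLE h).op ≫ X.presheaf.map (homOfLE h').op := by
    rw [← X.presheaf.map_comp]; rfl
  exact (congrArg (fun t => t.hom a) this).symm

lemma res_self {U : Opens X} (h : U ≤ U) (a : Sec X U) : res h a = a :=
  congrArg (fun t => t.hom a) (X.presheaf.map_id (op U))

lemma pull_res {U V : Opens Y} (h : V ≤ U) (a : Sec Y U) :
    pull f V (res h a) = res (X := X) (V := preim f V) (U := preim f U) (fun _ hx => h hx) (pull f U a) :=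
  congrArg (fun t => t.hom a) (f.hom.c.naturality (homOfLE h).op)

lemma pushf_map_mulEnd (a : Sec Y ⊤) (M : Mod X) :
    (pushf f).map (mulEnd (pull f ⊤ a) M) = mulEnd a ((pushf f).obj M) := by
  refine hom_ext' _ _ fun U m => ?_
  change glob (X := X) (preim f U) (pull f ⊤ a) • (show MSec M (preim f U) from m) =
    pull f U (glob U a) • (show MSec M (preim f U) from m)
  exact congrArg (fun t => t • (show MSec M (preim f U) from m)) (pull_res f le_top a).symm

/-- Both sides have the same adjoint, because multiplication by a function commutes with the unit.
This is how the coordinates in the tautological class are restricted to the zero section and to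
double points. -/
lemma pullb_map_mulEnd (a : Sec Y ⊤) (M : Mod Y) :
    (pullb f).map (mulEnd a M) = mulEnd (pull f ⊤ a) ((pullb f).obj M) := by
  apply ((adj f).homEquiv _ _).injective
  rw [Adjunction.homEquiv_unit, Adjunction.homEquiv_unit]
  exact ((adj f).unit_naturality (mulEnd a M)).trans ((mulEnd_comp a _).trans
    (congrArg (fun k => (adj f).unit.app M ≫ k)
      (pushf_map_mulEnd f a ((pullb f).obj M)).symm))

end Functors

/-! ### Modules over `𝒪_X[t]` as `𝒪_X`-modules with an endomorphism `t`. -/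

section Double

variable {X : Space}

/-- Multiplication by `t` on a module over `double X`, viewed as an `𝒪_X`-module. -/
def tMul (N : Mod (double X)) :
    (pushf (dualProj X)).obj N ⟶ (pushf (dualProj X)).obj N :=
  (pushf (dualProj X)).map (mulEnd (tee X) N)

lemma tee_mul_tee : tee X * tee X = 0 := DualNumber.eps_mul_eps

lemma tMul_tMul (N : Mod (double X)) : tMul N ≫ tMul N = 0 := by
  rw [tMul, ← Functor.map_comp, ← mulEnd_mul, tee_mul_tee, mulEnd_zero, Functor.map_zero]

lemma tMul_naturality {N N' : Mod (double X)} (g : N ⟶ N') :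
    tMul N ≫ (pushf (dualProj X)).map g = (pushf (dualProj X)).map g ≫ tMul N' := by
  rw [tMul, tMul, ← Functor.map_comp, ← Functor.map_comp, mulEnd_comp]

lemma glob_tee (U : Opens (double X)) :
    (glob U (tee X) : DualNumber (Sec X U)) = DualNumber.eps := by
  apply TrivSqZeroExt.ext
  · exact map_zero (res (X := X) (U := ⊤) (V := U) le_top)
  · exact map_one (res (X := X) (U := ⊤) (V := U) le_top)

/-- The value of a function on `X`, on the product of `X` with the double point. -/
def inlSec (U : Opens (double X)) : Sec X U →ₐ[ℂ] Sec (double X) U :=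
  TrivSqZeroExt.inlAlgHom ℂ (Sec X (show Opens X from U)) (Sec X (show Opens X from U))

lemma dualNumber_eq {A : Type*} [CommRing A] (a : DualNumber A) :
    a = TrivSqZeroExt.inl a.fst + TrivSqZeroExt.inl a.snd * DualNumber.eps := by
  apply TrivSqZeroExt.ext <;> simp

lemma sec_double_eq (U : Opens (double X)) (a : Sec (double X) U) :
    a = inlSec U (TrivSqZeroExt.fst (a : DualNumber (Sec X U))) +
      inlSec U (TrivSqZeroExt.snd (a : DualNumber (Sec X U))) * glob U (tee X) := by
  refine Eq.trans ?_ (congrArg (fun k => inlSec U (TrivSqZeroExt.fst (a : DualNumber (Sec X U))) +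
      inlSec U (TrivSqZeroExt.snd (a : DualNumber (Sec X U))) * k) (glob_tee U).symm)
  exact dualNumber_eq (A := Sec X (show Opens X from U)) a

lemma smul_double (N : Mod (double X)) (U : Opens (double X)) (a : Sec (double X) U)
    (m : MSec N U) : a • m = inlSec U (TrivSqZeroExt.fst (a : DualNumber (Sec X U))) • m +
      inlSec U (TrivSqZeroExt.snd (a : DualNumber (Sec X U))) • (glob U (tee X) • m) :=
  (congrArg (fun k => k • m) (sec_double_eq U a)).trans
    ((add_smul _ _ _).trans (congrArg (_ + ·) (mul_smul _ _ _)))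

/-- A morphism of the underlying `𝒪_X`-modules that commutes with `t` is `𝒪_X[t]`-linear. -/
lemma exists_map_eq_of_comm {N N' : Mod (double X)}
    (f : (pushf (dualProj X)).obj N ⟶ (pushf (dualProj X)).obj N')
    (hf : tMul N ≫ f = f ≫ tMul N') : ∃ g : N ⟶ N', (pushf (dualProj X)).map g = f := by
  let F : ∀ U : Opens (double X), MSec N U →+ MSec N' U := fun U =>
    (f.val.app (op (show Opens X from U))).hom.toAddMonoidHom
  have ht : ∀ (U : Opens (double X)) (m : MSec N U),
      F U (glob U (tee X) • m) = glob U (tee X) • F U m := fun U m =>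
    congrArg (fun k => k.val.app (op (show Opens X from U)) m) hf
  have hl : ∀ (U : Opens (double X)) (a : Sec X U) (m : MSec N U),
      F U (inlSec U a • m) = inlSec U a • F U m := fun U a m =>
    (f.val.app (op (show Opens X from U))).hom.map_smul a m
  have hs : ∀ (U : Opens (double X)) (a : Sec (double X) U) (m : MSec N U),
      F U (a • m) = a • F U m := fun U a m => by
    rw [smul_double N U a m, smul_double N' U a, map_add, hl, hl, ht]
  let G : ∀ U : (Opens (double X))ᵒᵖ, N.val.obj U ⟶ N'.val.obj U := fun U => ModuleCat.ofHom
    { toFun := F U.unop, map_add' := (F U.unop).map_add, map_smul' := hs U.unop }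
  refine ⟨⟨⟨G, ?_⟩⟩, rfl⟩
  intro U V i
  ext m
  exact congrArg (fun k => k.hom m) (f.val.naturality (X := op (show Opens X from U.unop))
    (Y := op (show Opens X from V.unop)) i)

end Double

/-! ### Inverse image under the projection of `double X`, and the central fibre. -/

section DualMod

variable {X : Space}

/-- The module over `A[t]` given by an `A`-module with an endomorphism of square zero. -/
abbrev dualNumberModule {A M : Type*} [CommRing A] [AddCommGroup M] [Module A M] (θ : M →ₗ[A] M)
    (hθ : ∀ m, θ (θ m) = 0) : Module (DualNumber A) M where
  smul a m := a.fst • m + a.snd • θ m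
  one_smul m := by
    change (1 : A) • m + (0 : A) • θ m = m
    simp
  mul_smul a b m := by
    change (a.fst * b.fst) • m + (a.fst • b.snd + MulOpposite.op b.fst • a.snd) • θ m =
      a.fst • (b.fst • m + b.snd • θ m) + a.snd • θ (b.fst • m + b.snd • θ m)
    simp only [map_add, map_smul, hθ, smul_zero, add_zero, smul_add, add_smul, mul_smul,
      smul_eq_mul, MulOpposite.smul_eq_mul_unop, MulOpposite.unop_op, add_assoc]
  smul_zero a := by
    change a.fst • (0 : M) + a.snd • θ 0 = 0
    simp
  smul_add a m m' := by
    change a.fst • (m + m') + a.snd • θ (m + m') = a.fst • m + a.snd • θ m +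
      (a.fst • m' + a.snd • θ m')
    simp only [map_add, smul_add]
    abel
  add_smul a b m := by
    change (a.fst + b.fst) • m + (a.snd + b.snd) • θ m = a.fst • m + a.snd • θ m +
      (b.fst • m + b.snd • θ m)
    simp only [add_smul]
    abel
  zero_smul m := by
    change (0 : A) • m + (0 : A) • θ m = 0
    simp

lemma val_app_app_eq_zero {M : Mod X} {θ : M ⟶ M} (hθ : θ ≫ θ = 0) (U : Opens X) (m : MSec M U) :
    (θ.val.app (op U)).hom ((θ.val.app (op U)).hom m) = 0 :=
  congrArg (fun k => k.val.app (op U) m) hθ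

/-- The module on `double X` given by an `𝒪_X`-module with an endomorphism of square zero. -/
def dualMod (M : Mod X) (θ : M ⟶ M) (hθ : θ ≫ θ = 0) : Mod (double X) where
  val :=
    letI (U : (Opens (double X))ᵒᵖ) : Module ((ringSheaf (double X)).obj.obj U)
        (M.val.presheaf.obj U) :=
      @dualNumberModule (Sec X (show Opens X from U.unop)) (MSec M (show Opens X from U.unop)) _ _ _
        (θ.val.app (op (show Opens X from U.unop))).hom (val_app_app_eq_zero hθ _)
    PresheafOfModules.ofPresheaf (R := (ringSheaf (double X)).obj) M.val.presheaf (by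
      intro U V i a m
      have hθ' := congrArg (fun k => k.hom m) (θ.val.naturality (X := op (show Opens X from U.unop))
        (Y := op (show Opens X from V.unop)) i)
      refine (map_add (M.val.presheaf.map i).hom _ _).trans ?_
      refine congrArg₂ (· + ·) (M.val.map_smul (X := op (show Opens X from U.unop))
        (Y := op (show Opens X from V.unop)) i _ _) ((M.val.map_smul (X := op (show Opens X from U.unop))
        (Y := op (show Opens X from V.unop)) i _ _).trans ?_)
      exact congrArg (fun k : MSec M (show Opens X from V.unop) =>
        (show Sec X (show Opens X from V.unop) from X.presheaf.map i (TrivSqZeroExt.snd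
          (show DualNumber (Sec X (show Opens X from U.unop)) from a))) • k) hθ'.symm)
  isSheaf := M.isSheaf

lemma dualMod_inl_smul {M : Mod X} {θ : M ⟶ M} (hθ : θ ≫ θ = 0) (U : Opens X) (a : Sec X U)
    (m : MSec ((pushf (dualProj X)).obj (dualMod M θ hθ)) U) :
    (show MSec M U from a • m) = a • (show MSec M U from m) := by
  change a • (show MSec M U from m) + (0 : Sec X U) • θ.val.app (op U) (show MSec M U from m) = _
  rw [zero_smul, add_zero]

/-- The sections of the `𝒪_X`-module underlying `dualMod M θ`. -/
def dualModSec (M : Mod X) (θ : M ⟶ M) (hθ : θ ≫ θ = 0) (U : Opens X) :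
    MSec ((pushf (dualProj X)).obj (dualMod M θ hθ)) U ≃ₗ[Sec X U] MSec M U where
  toFun m := m
  invFun m := m
  map_add' _ _ := rfl
  map_smul' := dualMod_inl_smul hθ U
  left_inv _ := rfl
  right_inv _ := rfl

/-- A morphism of modules, defined on sections. -/
def homOfSec {M N : Mod X} (F : ∀ U : Opens X, MSec M U →ₗ[Sec X U] MSec N U)
    (h : ∀ {U V : Opens X} (h : V ≤ U) (m : MSec M U), F V (mres M h m) = mres N h (F U m)) :
    M ⟶ N where
  val :=
    { app := fun U => ModuleCat.ofHom (F U.unop)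
      naturality := fun {U V} i => by
        ext m
        exact h (leOfHom i.unop) m }

/-- The `𝒪_X`-module underlying `dualMod M θ` is `M`. -/
def dualModIso (M : Mod X) (θ : M ⟶ M) (hθ : θ ≫ θ = 0) :
    (pushf (dualProj X)).obj (dualMod M θ hθ) ≅ M where
  hom := homOfSec (fun U => (dualModSec M θ hθ U).toLinearMap) fun _ _ => rfl
  inv := homOfSec (fun U => (dualModSec M θ hθ U).symm.toLinearMap) fun _ _ => rfl
  hom_inv_id := rfl
  inv_hom_id := rfl

lemma tMul_dualMod (M : Mod X) (θ : M ⟶ M) (hθ : θ ≫ θ = 0) :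
    tMul (dualMod M θ hθ) ≫ (dualModIso M θ hθ).hom = (dualModIso M θ hθ).hom ≫ θ := by
  refine hom_ext' _ _ fun U m => ?_
  let U' : Opens (double X) := preim (dualProj X) U
  let m' : MSec (dualMod M θ hθ) U' := m
  change (show MSec M U from glob U' (tee X) • m') = θ.val.app (op U) (show MSec M U from m)
  refine (congrArg (fun k : Sec (double X) U' => (show MSec M U from k • m')) (glob_tee U')).trans ?_
  change (0 : Sec X U) • (show MSec M U from m) +
    (1 : Sec X U) • (show MSec M U from θ.val.app (op U) (show MSec M U from m)) = _
  rw [zero_smul, one_smul, zero_add]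

lemma pushf_map_injective {N N' : Mod (double X)} {g g' : N ⟶ N'}
    (h : (pushf (dualProj X)).map g = (pushf (dualProj X)).map g') : g = g' :=
  hom_ext' _ _ fun U m => congrArg (fun k => k.val.app (op (show Opens X from U)) m) h

lemma adj_exists_lift {C D : Type*} [Category* C] [Category* D] {F : C ⥤ D} {G : D ⥤ C}
    (h : F ⊣ G) {M : C} {N : D} (g : M ⟶ G.obj N) : ∃ k : F.obj M ⟶ N, h.unit.app M ≫ G.map k = g :=
  ⟨(h.homEquiv _ _).symm g, (h.homEquiv_unit _ _ _).symm.trans (Equiv.apply_symm_apply _ _)⟩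

lemma adj_hom_ext {C D : Type*} [Category* C] [Category* D] {F : C ⥤ D} {G : D ⥤ C}
    (h : F ⊣ G) {M : C} {N : D} {k k' : F.obj M ⟶ N}
    (e : h.unit.app M ≫ G.map k = h.unit.app M ≫ G.map k') : k = k' := by
  apply (h.homEquiv _ _).injective
  rw [Adjunction.homEquiv_unit, Adjunction.homEquiv_unit, e]

/-- The endomorphism `(a, b) ↦ (0, a)` of `M ⊕ M`. -/
def shift (M : Mod X) : M ⊞ M ⟶ M ⊞ M := biprod.fst ≫ biprod.inr

lemma shift_shift (M : Mod X) : shift M ≫ shift M = 0 := by simp [shift]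

/-- The map `(a, b) ↦ a + t b` from `M ⊕ M` to `p^* M`, for the projection `p` of `double X`. -/
def dualProjMap (M : Mod X) :
    M ⊞ M ⟶ (pushf (dualProj X)).obj ((pullb (dualProj X)).obj M) :=
  biprod.desc ((adj (dualProj X)).unit.app M) ((adj (dualProj X)).unit.app M ≫ tMul _)

lemma shift_dualProjMap (M : Mod X) :
    shift M ≫ dualProjMap M = dualProjMap M ≫ tMul _ := by
  apply biprod.hom_ext' <;> simp [shift, dualProjMap, tMul_tMul]

/-- `M ⊞ M` with the shift is a model of `M[t]`. The universal property of the inverse image gives a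
map `k` into the model, and `dualProjMap` is `t`-linear, hence comes from a map `e` back. They are
inverse to each other: it suffices to check on `M`, which generates both sides over `t`. -/
instance isIso_dualProjMap (M : Mod X) : IsIso (dualProjMap M) := by
  let I := dualModIso (M ⊞ M) (shift M) (shift_shift M)
  have hI : tMul _ ≫ I.hom = I.hom ≫ shift M := tMul_dualMod _ _ _
  let η := (adj (dualProj X)).unit.app M
  obtain ⟨k, hk⟩ := adj_exists_lift (adj (dualProj X))
    (N := dualMod (M ⊞ M) (shift M) (shift_shift M)) (biprod.inl ≫ I.inv)
  obtain ⟨e, he⟩ := exists_map_eq_of_comm (N := dualMod (M ⊞ M) (shift M) (shift_shift M))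
    (I.hom ≫ dualProjMap M) (by
      rw [Category.assoc, ← shift_dualProjMap, reassoc_of% hI])
  have hke : k ≫ e = 𝟙 _ := by
    apply adj_hom_ext (adj (dualProj X))
    rw [Functor.map_comp, reassoc_of% hk, he,
      Iso.inv_hom_id_assoc, dualProjMap, biprod.inl_desc, CategoryTheory.Functor.map_id]
    exact (Category.comp_id _).symm
  refine ⟨(pushf (dualProj X)).map k ≫ I.hom, ?_, ?_⟩
  · apply biprod.hom_ext'
    · rw [dualProjMap, biprod.inl_desc_assoc, reassoc_of% hk, Iso.inv_hom_id]
    · rw [dualProjMap, biprod.inr_desc_assoc, Category.assoc,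
        reassoc_of% (tMul_naturality k), hI, reassoc_of% hk, Iso.inv_hom_id_assoc, shift,
        biprod.inl_fst_assoc, Category.comp_id]
  · rw [Category.assoc, ← he, ← Functor.map_comp, hke, CategoryTheory.Functor.map_id]

lemma dualProjMap_naturality {M M' : Mod X} (f : M ⟶ M') :
    dualProjMap M ≫ (pushf (dualProj X)).map ((pullb (dualProj X)).map f) =
      biprod.map f f ≫ dualProjMap M' := by
  have h := (adj (dualProj X)).unit.naturality f
  dsimp at h
  apply biprod.hom_ext'
  · rw [dualProjMap, biprod.inl_desc_assoc, biprod.inl_map_assoc, dualProjMap, biprod.inl_desc, h]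
  · rw [dualProjMap, biprod.inr_desc_assoc, biprod.inr_map_assoc, dualProjMap, biprod.inr_desc,
      Category.assoc, tMul_naturality, reassoc_of% h]

/-- The projection is flat: through `dualProjMap` the inverse image of `f` is `f ⊞ f`. -/
lemma mono_pullb_dualProj {M M' : Mod X} (f : M ⟶ M') [Mono f] :
    Mono ((pullb (dualProj X)).map f) := by
  have h : (pushf (dualProj X)).map ((pullb (dualProj X)).map f) =
      inv (dualProjMap M) ≫ biprod.map f f ≫ dualProjMap M' := by
    rw [← dualProjMap_naturality, IsIso.inv_hom_id_assoc]
  have : Mono ((pushf (dualProj X)).map ((pullb (dualProj X)).map f)) := by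
    rw [h]; infer_instance
  refine ⟨fun u v huv => pushf_map_injective ?_⟩
  rw [← cancel_mono ((pushf (dualProj X)).map ((pullb (dualProj X)).map f)), ← Functor.map_comp,
    huv, Functor.map_comp]

/-- Through `dualProjMap`, `t` is the shift `(a, b) ↦ (0, a)`, whose kernel and image are both the
second summand. -/
lemma exact_tMul_pullb_dualProj (M : Mod X) :
    (ShortComplex.mk _ _ (tMul_tMul ((pullb (dualProj X)).obj M))).Exact := by
  rw [exact_mk_iff]
  intro T x hx
  have h0 : (x ≫ inv (dualProjMap M)) ≫ biprod.fst = 0 := by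
    have : (x ≫ inv (dualProjMap M)) ≫ shift M = 0 := by
      rw [← cancel_mono (dualProjMap M), Category.assoc, shift_dualProjMap]
      simp [hx]
    have := congrArg (· ≫ biprod.snd) this
    simpa [shift] using this
  refine ⟨T, 𝟙 T, inferInstance,
    (x ≫ inv (dualProjMap M)) ≫ biprod.snd ≫ biprod.inl ≫ dualProjMap M, ?_⟩
  have e : (x ≫ inv (dualProjMap M)) ≫ biprod.snd ≫ biprod.inr = x ≫ inv (dualProjMap M) := by
    apply biprod.hom_ext
    · rw [h0]; simp
    · simp
  have e' := congrArg (· ≫ dualProjMap M) e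
  simp only [Category.assoc, IsIso.inv_hom_id, Category.comp_id] at e'
  simp only [Category.assoc, ← shift_dualProjMap]
  simp only [shift, biprod.inl_fst_assoc, Category.assoc]
  rw [Category.id_comp, e']

/-- An `𝒪_X`-linear map `f` to `M` is the second component of the `𝒪_X[t]`-linear map `(f ∘ t, f)`
to `M ⊞ M` with the shift (the coinduced module). If `f` kills the image of `g`, so does this map,
which is therefore zero. -/
lemma epi_pushf_dualProj {N N' : Mod (double X)} (g : N ⟶ N') [Epi g] :
    Epi ((pushf (dualProj X)).map g) := by
  refine Preadditive.epi_of_cancel_zero _ fun {M} f hf => ?_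
  let I := dualModIso (M ⊞ M) (shift M) (shift_shift M)
  have hI : tMul _ ≫ I.hom = I.hom ≫ shift M := tMul_dualMod _ _ _
  have hI' : I.inv ≫ tMul _ = shift M ≫ I.inv := by
    rw [Iso.inv_comp_eq, reassoc_of% hI.symm, Iso.hom_inv_id, Category.comp_id]
  obtain ⟨F, hF⟩ := exists_map_eq_of_comm (N' := dualMod (M ⊞ M) (shift M) (shift_shift M))
    (biprod.lift (tMul N' ≫ f) f ≫ I.inv) (by
      rw [Category.assoc, hI', ← Category.assoc, ← Category.assoc]
      congr 1
      apply biprod.hom_ext <;> simp [shift, reassoc_of% (tMul_tMul N')])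
  have hg : g ≫ F = 0 := by
    apply pushf_map_injective
    rw [Functor.map_comp, hF, Functor.map_zero, ← Category.assoc, ← cancel_mono I.hom]
    apply biprod.hom_ext <;> simp [hf, ← reassoc_of% (tMul_naturality g)]
  have hF0 : F = 0 := by rw [← cancel_epi g, hg, comp_zero]
  rw [hF0, Functor.map_zero] at hF
  have := congrArg (· ≫ I.hom ≫ biprod.snd) hF
  simpa using this.symm

lemma shortExact_pushf_dualProj {A B Z : Mod (double X)} {f : A ⟶ B} {g : B ⟶ Z} {w : f ≫ g = 0}
    (h : (ShortComplex.mk f g w).ShortExact)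
    (w' : (pushf (dualProj X)).map f ≫ (pushf (dualProj X)).map g = 0) :
    (ShortComplex.mk ((pushf (dualProj X)).map f) ((pushf (dualProj X)).map g) w').ShortExact := by
  have : Mono f := h.mono_f
  have : Epi g := h.epi_g
  have : Mono (ShortComplex.mk f g w).f := h.mono_f
  exact ShortComplex.ShortExact.mk'
    (h.exact.map_of_mono_of_preservesKernel (pushf (dualProj X)) (by dsimp; infer_instance)
      (by dsimp; infer_instance)) (by dsimp; infer_instance) (epi_pushf_dualProj g)

/-- `p_* i_* M ≅ M` for the inclusion `i` and the projection `p` of `double X`. -/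
def dualInclIso (M : Mod X) :
    (pushf (dualProj X)).obj ((pushf (dualIncl X)).obj M) ≅ M :=
  (pushfComp (dualIncl X) (dualProj X)).app M ≪≫
    (eqToIso (congrArg pushf (dualIncl_dualProj X))).app M ≪≫ (pushfId X).app M

lemma dualInclIso_naturality {M M' : Mod X} (f : M ⟶ M') :
    (pushf (dualProj X)).map ((pushf (dualIncl X)).map f) ≫ (dualInclIso M').hom =
      (dualInclIso M).hom ≫ f := by
  have h₁ := (pushfComp (dualIncl X) (dualProj X)).hom.naturality f
  have h₂ := (eqToIso (congrArg pushf (dualIncl_dualProj X))).hom.naturality f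
  have h₃ := (pushfId X).hom.naturality f
  dsimp only [Functor.comp_map, Functor.id_map] at h₁ h₃
  simp only [dualInclIso, Iso.trans_hom, Iso.app_hom, Category.assoc]
  rw [reassoc_of% h₁, reassoc_of% h₂, h₃]

lemma tMul_dualIncl (M : Mod X) : tMul ((pushf (dualIncl X)).obj M) = 0 := by
  have h : mulEnd (tee X) ((pushf (dualIncl X)).obj M) = 0 := by
    rw [← pushf_map_mulEnd]
    exact (congrArg (pushf (dualIncl X)).map (mulEnd_zero M)).trans (Functor.map_zero _ _ _)
  rw [tMul, h, Functor.map_zero]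

/-- The restriction map from a module on `double X` to its central fibre. -/
def toCentral (N : Mod (double X)) :
    (pushf (dualProj X)).obj N ⟶ (pullb (dualIncl X)).obj N :=
  (pushf (dualProj X)).map ((adj (dualIncl X)).unit.app N) ≫ (dualInclIso _).hom

lemma tMul_toCentral (N : Mod (double X)) : tMul N ≫ toCentral N = 0 := by
  rw [toCentral, reassoc_of% (tMul_naturality ((adj (dualIncl X)).unit.app N))]
  have := tMul_dualIncl ((pullb (dualIncl X)).obj N)
  erw [this]
  simp

/-- By adjunction, a map out of the central fibre is determined by its composite with the unit. -/
instance epi_toCentral (N : Mod (double X)) : Epi (toCentral N) := by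
  refine Preadditive.epi_of_cancel_zero _ fun {M} g hg => ?_
  rw [toCentral, Category.assoc, ← dualInclIso_naturality, ← Category.assoc,
    ← Functor.map_comp] at hg
  have h := congrArg (· ≫ (dualInclIso M).inv) hg
  simp only [Category.assoc, Iso.hom_inv_id, Category.comp_id, zero_comp] at h
  apply adj_hom_ext (adj (dualIncl X))
  apply pushf_map_injective
  rw [h, Functor.map_zero, comp_zero, Functor.map_zero]

/-- The direct image of `M` under the inclusion is `M` with `t = 0`, so a map killing `t` is
`𝒪_X[t]`-linear into it and factors through the inverse image. Thus the central fibre is the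
cokernel of `t`. -/
lemma exists_toCentral_desc {N : Mod (double X)} {M : Mod X}
    (f : (pushf (dualProj X)).obj N ⟶ M) (hf : tMul N ≫ f = 0) :
    ∃ g, toCentral N ≫ g = f := by
  obtain ⟨k, hk⟩ := exists_map_eq_of_comm (N' := (pushf (dualIncl X)).obj M)
    (f ≫ (dualInclIso M).inv) (by rw [tMul_dualIncl, comp_zero, reassoc_of% hf, zero_comp])
  obtain ⟨g, hg⟩ := adj_exists_lift (adj (dualIncl X)) k
  refine ⟨g, ?_⟩
  rw [toCentral, Category.assoc, ← dualInclIso_naturality, ← Functor.map_comp_assoc, hg, hk,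
    Category.assoc, Iso.inv_hom_id, Category.comp_id]

lemma exact_toCentral (N : Mod (double X)) :
    (ShortComplex.mk _ _ (tMul_toCentral N)).Exact := by
  refine ShortComplex.exact_of_g_is_cokernel _ (CokernelCofork.IsColimit.ofπ' _ _ fun f hf => ?_)
  exact ⟨(exists_toCentral_desc f hf).choose, (exists_toCentral_desc f hf).choose_spec⟩

end DualMod

/-! ### Exactness on local sections, and coherence. -/

section Sections

variable {X : Space}

/-- The map on sections given by a morphism of modules. -/
def onSec {M N : Mod X} (f : M ⟶ N) (U : Opens X) : MSec M U →ₗ[Sec X U] MSec N U :=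
  (f.val.app (op U)).hom

lemma onSec_mres {M N : Mod X} (f : M ⟶ N) {U V : Opens X} (h : V ≤ U) (m : MSec M U) :
    onSec f V (mres M h m) = mres N h (onSec f U m) :=
  congrArg (fun k => k.hom m) (f.val.naturality (homOfLE h).op)

lemma mres_zero (M : Mod X) {U V : Opens X} (h : V ≤ U) : mres M h 0 = 0 :=
  map_zero (M.val.presheaf.map (homOfLE h).op).hom

lemma mres_sub (M : Mod X) {U V : Opens X} (h : V ≤ U) (m m' : MSec M U) :
    mres M h (m - m') = mres M h m - mres M h m' :=
  map_sub (M.val.presheaf.map (homOfLE h).op).hom m m'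

lemma mres_sum (M : Mod X) {U V : Opens X} (h : V ≤ U) {ι : Type*} (s : Finset ι)
    (m : ι → MSec M U) : mres M h (∑ i ∈ s, m i) = ∑ i ∈ s, mres M h (m i) :=
  map_sum (M.val.presheaf.map (homOfLE h).op).hom m s

lemma mres_comp (M : Mod X) {U V W : Opens X} (h : V ≤ U) (h' : W ≤ V) (m : MSec M U) :
    mres M h' (mres M h m) = mres M (h'.trans h) m :=
  (congrArg (fun k => k.hom m) (M.val.presheaf.map_comp (homOfLE h).op (homOfLE h').op)).symm

lemma onSec_injective {M N : Mod X} (f : M ⟶ N) [Mono f] (U : Opens X) :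
    Function.Injective (onSec f U) := by
  have : Mono ((SheafOfModules.evaluation.{0} (ringSheaf X) (op U)).map f) := inferInstance
  exact (ModuleCat.mono_iff_injective _).1 this

lemma exists_onSec_eq {A B Z : Mod X} {f : A ⟶ B} {g : B ⟶ Z} {w : f ≫ g = 0}
    (h : (ShortComplex.mk f g w).ShortExact) (U : Opens X) (m : MSec B U)
    (hm : onSec g U m = 0) : ∃ a, onSec f U a = m := by
  have : (SheafOfModules.evaluation.{0} (ringSheaf X) (op U)).Additive := ⟨by intros; rfl⟩
  have : Mono f := h.mono_f
  have := h.exact.map_of_mono_of_preservesKernel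
    (SheafOfModules.evaluation.{0} (ringSheaf X) (op U)) h.mono_f inferInstance
  exact (ShortComplex.moduleCat_exact_iff _).1 this m hm

/-- The map from `N` to the sheafified presheaf cokernel of `g` kills `g`, so it is zero. Hence the
class of a section in the presheaf cokernel vanishes locally, that is, the section lifts locally. -/
lemma exists_onSec_eq_of_epi {M N : Mod X} (g : M ⟶ N) [Epi g] (U : Opens X) (n : MSec N U)
    (x : X) (hx : x ∈ U) :
    ∃ (V : Opens X) (h : V ≤ U) (_ : x ∈ V) (m : MSec M V), onSec g V m = mres N h n := by
  let c := cokernel.π g.val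
  let J := Opens.grothendieckTopology X
  let K := cokernel g.val
  let A := PresheafOfModules.sheafificationAdjunction (𝟙 (ringSheaf X).obj)
  let aK : Mod X := (PresheafOfModules.sheafification (𝟙 (ringSheaf X).obj)).obj K
  let k := c ≫ A.unit.app K
  let F : N ⟶ aK := homOfSec (fun U =>
    { toFun := fun m => k.app (op U) m
      map_add' := (k.app (op U)).hom.map_add
      map_smul' := (k.app (op U)).hom.map_smul }) fun {U V} h m =>
        congrArg (fun t => t.hom m) (k.naturality (homOfLE h).op)
  have hgk : g.val ≫ k = 0 := by
    rw [← Category.assoc, cokernel.condition, zero_comp]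
  have hF : F = 0 := by
    rw [← cancel_epi g, comp_zero]
    exact hom_ext' _ _ fun U m => congrArg (fun t => t.app (op U) m) hgk
  have hk : (toSheafify J K.presheaf).app (op U) (c.app (op U) n) =
      (toSheafify J K.presheaf).app (op U) 0 := by
    rw [map_zero]
    have := congrArg (fun t => t.val.app (op U) n) hF
    refine Eq.trans ?_ this
    exact congrArg (fun t => t.app (op U) (c.app (op U) n))
      (PresheafOfModules.toPresheaf_map_sheafificationAdjunction_unit_app
        (𝟙 (ringSheaf X).obj) K).symm
  -- Sections of a presheaf with the same image in the sheafification agree on a covering.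
  obtain ⟨V, i, hi, hxV⟩ := Presheaf.equalizerSieve_mem J (toSheafify J K.presheaf) _ _ hk x hx
  have hi₁ : K.presheaf.map i.op (c.app (op U) n) = K.presheaf.map i.op 0 := hi
  have hi' : K.presheaf.map i.op (c.app (op U) n) = 0 := hi₁.trans (map_zero _)
  have h0 : c.app (op V) (mres N (leOfHom i) n) = 0 :=
    (congrArg (fun t => t.hom n) (c.naturality i.op)).trans hi'
  have hex := (ShortComplex.exact_cokernel g.val).map
    (PresheafOfModules.evaluation.{0} (ringSheaf X).obj (op V))
  obtain ⟨m, hm⟩ := (ShortComplex.moduleCat_exact_iff _).1 hex _ h0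
  exact ⟨V, leOfHom i, hxV, m, hm⟩

lemma exists_nhd_le {n : ℕ} (V : Fin n → Opens X) (x : X) (hx : ∀ i, x ∈ V i) :
    ∃ W : Opens X, x ∈ W ∧ ∀ i, W ≤ V i :=
  ⟨⟨⋂ i, V i, isOpen_iInter_of_finite fun i => (V i).2⟩, Set.mem_iInter.2 hx,
    fun i => Set.iInter_subset (fun i => (V i : Set X)) i⟩

lemma exists_onSec_eq_fin {M N : Mod X} (g : M ⟶ N) [Epi g] (U : Opens X) {n : ℕ}
    (s : Fin n → MSec N U) (x : X) (hx : x ∈ U) :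
    ∃ (V : Opens X) (h : V ≤ U) (_ : x ∈ V) (m : Fin n → MSec M V),
      ∀ i, onSec g V (m i) = mres N h (s i) := by
  choose V h hxV m hm using fun i => exists_onSec_eq_of_epi g U (s i) x hx
  obtain ⟨W, hxW, hW⟩ := exists_nhd_le V x hxV
  refine ⟨W ⊓ U, inf_le_right, ⟨hxW, hx⟩, fun i => mres M (inf_le_left.trans (hW i)) (m i), ?_⟩
  intro i
  rw [onSec_mres, hm, mres_comp]

/-- An extension of coherent sheaves is coherent. -/
lemma isCoherent_of_shortExact {A B Z : Mod X} {f : A ⟶ B} {g : B ⟶ Z} {w : f ≫ g = 0}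
    (h : (ShortComplex.mk f g w).ShortExact) (hA : IsCoherent A) (hZ : IsCoherent Z) :
    IsCoherent B := by
  have : Mono f := h.mono_f
  have : Epi g := h.epi_g
  have hfg : ∀ U m, onSec g U (onSec f U m) = 0 := fun U m =>
    congrArg (fun t => t.val.app (op U) m) w
  refine ⟨fun x => ?_, fun U n s x hx => ?_⟩
  -- Generators: local lifts of generators of `Z` together with the images of generators of `A`.
  · obtain ⟨U, hxU, n, s, hs⟩ := hZ.1 x
    obtain ⟨V, hVU, hxV, b, hb⟩ := exists_onSec_eq_fin g U s x hxU
    obtain ⟨U', hxU', m, a, ha⟩ := hA.1 x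
    refine ⟨V ⊓ U', ⟨hxV, hxU'⟩, n + m, Fin.append (fun i => mres B inf_le_left (b i))
      (fun j => onSec f _ (mres A inf_le_right (a j))), fun V₁ h₁ e y hy => ?_⟩
    obtain ⟨V₂, h₂, hy₂, c, hc⟩ := hs V₁ (h₁.trans (inf_le_left.trans hVU)) (onSec g V₁ e) y hy
    obtain ⟨e', he'⟩ := exists_onSec_eq h V₂ (mres B h₂ e -
        ∑ i, c i • mres B (h₂.trans (h₁.trans inf_le_left)) (b i)) (by
      simp only [map_sub, map_sum, map_smul, onSec_mres, hb, mres_comp, hc, sub_self])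
    obtain ⟨V₃, h₃, hy₃, d, hd⟩ := ha V₂ (h₂.trans (h₁.trans inf_le_right)) e' y hy₂
    refine ⟨V₃, h₃.trans h₂, hy₃, Fin.append (fun i => res h₃ (c i)) d, ?_⟩
    have := congrArg (onSec f V₃) hd
    rw [onSec_mres, he', mres_sub, mres_comp, mres_sum, sub_eq_iff_eq_add'] at this
    rw [this, Fin.sum_univ_add]
    simp only [Fin.append_left, Fin.append_right, mres_smul, mres_comp, map_sum, map_smul,
      onSec_mres]
  -- Relations: the generating relations `r j` between the images in `Z` produce sections `α j` of
  -- `A`. A combination of the `r j` is a relation in `B` exactly when its coefficients are a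
  -- relation between the `α j`, so the products of `q` and `r` generate.
  · obtain ⟨V, hVU, hxV, k, r, hr, hr'⟩ := hZ.2 U n (fun i => onSec g U (s i)) x hx
    choose α hα using fun j => exists_onSec_eq h V (∑ i, r j i • mres B hVU (s i)) (by
      simp only [map_sum, map_smul, onSec_mres, hr])
    obtain ⟨V', hV', hxV', l, q, hq, hq'⟩ := hA.2 V k α x hxV
    refine ⟨V', hV'.trans hVU, hxV', l, fun p i => ∑ j, q p j * res hV' (r j i), ?_, ?_⟩
    · intro p
      have := congrArg (onSec f V') (hq p)
      simp only [map_sum, map_smul, onSec_mres, hα, mres_sum, mres_smul, mres_comp, map_zero,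
        Finset.smul_sum] at this
      rw [Finset.sum_comm] at this
      simp only [Finset.sum_smul, mul_smul, this]
    · intro V₂ h₂ a ha y hy
      obtain ⟨V₃, h₃, hy₃, b, hb⟩ := hr' V₂ (h₂.trans hV') a (by
        simpa only [map_sum, map_smul, onSec_mres, map_zero] using congrArg (onSec g V₂) ha) y hy
      have h0 : ∑ j, b j • mres A ((h₃.trans h₂).trans hV') (α j) = 0 := by
        apply onSec_injective f
        have := congrArg (mres B h₃) ha
        simp only [mres_sum, mres_smul, mres_comp, hb, Finset.sum_smul, mul_smul, mres_zero] at this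
        rw [Finset.sum_comm] at this
        simpa only [map_sum, map_smul, onSec_mres, hα, mres_sum, mres_smul, mres_comp, map_zero,
          Finset.smul_sum] using this
      obtain ⟨V₄, h₄, hy₄, c, hc⟩ := hq' V₃ (h₃.trans h₂) b h0 y hy₃
      refine ⟨V₄, h₄.trans h₃, hy₄, c, fun i => ?_⟩
      have := congrArg (res h₄) (hb i)
      rw [res_comp] at this
      rw [this, map_sum]
      simp only [map_mul, map_sum, hc, res_comp, Finset.sum_mul, Finset.mul_sum, mul_assoc]
      exact Finset.sum_comm

lemma res_inlSec {U V : Opens (double X)} (h : V ≤ U) (a : Sec X U) :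
    res h (inlSec U a) = inlSec V (res (X := X) h a) := by
  apply TrivSqZeroExt.ext
  · rfl
  · exact map_zero (res (X := X) h)

lemma res_glob {U V : Opens X} (h : V ≤ U) (a : Sec X ⊤) : res h (glob U a) = glob V a :=
  res_comp _ _ _

lemma sum_append_tee_smul (N : Mod (double X)) (U : Opens (double X)) {n : ℕ}
    (a : Fin (n + n) → Sec X U) (m : Fin n → MSec N U) :
    ∑ i, inlSec U (a i) • Fin.append m (fun i => glob U (tee X) • m i) i =
      ∑ i, (inlSec U (a (Fin.castAdd n i)) + inlSec U (a (Fin.natAdd n i)) * glob U (tee X)) •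
        m i := by
  simp only [Fin.sum_univ_add, Fin.append_left, Fin.append_right, add_smul, mul_smul,
    Finset.sum_add_distrib]

/-- A module on `double X` that is coherent as an `𝒪_X`-module is coherent. -/
lemma isCoherent_of_pushf_dualProj (N : Mod (double X))
    (h : IsCoherent ((pushf (dualProj X)).obj N)) : IsCoherent N := by
  refine ⟨fun x => ?_, fun U n s x hx => ?_⟩
  · obtain ⟨U, hxU, n, s, hs⟩ := h.1 x
    refine ⟨preim (dualProj X) U, hxU, n, s, fun V hV m y hy => ?_⟩
    obtain ⟨V', h', hy', a, ha⟩ := hs V hV m y hy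
    exact ⟨preim (dualProj X) V', h', hy', fun i => inlSec _ (a i), ha⟩
  -- An `𝒪_X[t]`-relation between the `s i` is an `𝒪_X`-relation between the `2n` sections `s i` and
  -- `t s i`.
  · have happ : ∀ (V : Opens (double X)) (hV : V ≤ U) (i : Fin (n + n)),
        mres N hV (Fin.append s (fun i => glob U (tee X) • s i) i) =
          Fin.append (fun i => mres N hV (s i)) (fun i => glob V (tee X) • mres N hV (s i)) i := by
      intro V hV i
      refine Fin.addCases (fun i => ?_) (fun i => ?_) i
      · simp only [Fin.append_left]
      · simp only [Fin.append_right, mres_smul, res_glob]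
    have h2 : ∀ (U : Opens (double X)) (n : ℕ) (s : Fin n → MSec N U), ∀ x ∈ U,
        ∃ (V : Opens (double X)) (hV : V ≤ U) (_ : x ∈ V) (k : ℕ) (r : Fin k → Fin n → Sec X V),
        (∀ j, ∑ i, inlSec V (r j i) • mres N hV (s i) = 0) ∧
        ∀ (V' : Opens (double X)) (h : V' ≤ V) (a : Fin n → Sec X V'),
          ∑ i, inlSec V' (a i) • mres N (h.trans hV) (s i) = 0 → ∀ y ∈ V',
          ∃ (V'' : Opens (double X)) (h' : V'' ≤ V') (_ : y ∈ V'') (b : Fin k → Sec X V''),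
            ∀ i, res (X := X) h' (a i) = ∑ j, b j * res (X := X) (h'.trans h) (r j i) := h.2
    obtain ⟨V, hVU, hxV, k, r, hr, hr'⟩ := h2 U (n + n)
      (Fin.append s (fun i => glob U (tee X) • s i)) x hx
    refine ⟨V, hVU, hxV, k, fun j i => inlSec V (r j (Fin.castAdd n i)) +
      inlSec V (r j (Fin.natAdd n i)) * glob V (tee X), ?_, ?_⟩
    · intro j
      refine (sum_append_tee_smul N V (r j) fun i => mres N hVU (s i)).symm.trans ?_
      refine Eq.trans (Finset.sum_congr rfl fun i _ => ?_) (hr j)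
      exact congrArg (fun t => inlSec V (r j i) • t) (happ V hVU i).symm
    · intro V' h' a ha y hy
      obtain ⟨V₂, h₂, hy₂, b, hb⟩ := hr' V' h' (Fin.append
        (fun i => TrivSqZeroExt.fst (a i : DualNumber (Sec X V')))
        (fun i => TrivSqZeroExt.snd (a i : DualNumber (Sec X V')))) (by
          refine Eq.trans (Finset.sum_congr rfl fun i _ => ?_)
            ((sum_append_tee_smul N V' (Fin.append
              (fun i => TrivSqZeroExt.fst (a i : DualNumber (Sec X V')))
              (fun i => TrivSqZeroExt.snd (a i : DualNumber (Sec X V'))))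
              fun i => mres N (h'.trans hVU) (s i)).trans ?_)
          · exact congrArg (fun t => inlSec V' _ • t) (happ V' (h'.trans hVU) i)
          · simp only [Fin.append_left, Fin.append_right, ← sec_double_eq]
            exact ha) y hy
      refine ⟨V₂, h₂, hy₂, fun j => inlSec V₂ (b j), fun i => ?_⟩
      have h₁ := hb (Fin.castAdd n i)
      have h₃ := hb (Fin.natAdd n i)
      rw [Fin.append_left] at h₁
      rw [Fin.append_right] at h₃
      refine (congrArg (res h₂) (sec_double_eq V' (a i))).trans ?_
      rw [map_add, map_mul, res_inlSec h₂, res_inlSec h₂, res_glob]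
      refine (congrArg₂ (fun u v => inlSec V₂ u + inlSec V₂ v *
        glob V₂ (tee X)) h₁ h₃).trans ?_
      simp only [map_sum, map_mul, map_add, res_inlSec, res_glob, mul_add, Finset.sum_mul,
        Finset.sum_add_distrib, mul_assoc]

end Sections

/-! ### Flatness over the double point. -/

section Flat

variable {X : Space}

/-- Kernels are computed on sections, and the map from `A` onto the kernel of `g` is locally
surjective. -/
lemma exists_onSec_eq_of_exact {A B Z : Mod X} {f : A ⟶ B} {g : B ⟶ Z} {w : f ≫ g = 0}
    (h : (ShortComplex.mk f g w).Exact) (U : Opens X) (m : MSec B U) (hm : onSec g U m = 0)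
    (x : X) (hx : x ∈ U) :
    ∃ (V : Opens X) (h : V ≤ U) (_ : x ∈ V) (a : MSec A V), onSec f V a = mres B h m := by
  have : (SheafOfModules.evaluation.{0} (ringSheaf X) (op U)).Additive := ⟨by intros; rfl⟩
  have hk := (ShortComplex.exact_kernel g).map_of_mono_of_preservesKernel
    (SheafOfModules.evaluation.{0} (ringSheaf X) (op U)) (by dsimp; infer_instance) inferInstance
  obtain ⟨k, hk⟩ : ∃ k, onSec (kernel.ι g) U k = m :=
    (ShortComplex.moduleCat_exact_iff _).1 hk m hm
  have : Epi (kernel.lift g f w) := h.epi_kernelLift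
  obtain ⟨V, hV, hxV, a, ha⟩ := exists_onSec_eq_of_epi (kernel.lift g f w) U k x hx
  refine ⟨V, hV, hxV, a, ?_⟩
  rw [← hk, ← onSec_mres, ← ha]
  exact congrArg (fun t => t.val.app (op V) a) (kernel.lift_ι g f w).symm

open scoped TensorProduct in
lemma exists_tmul_span_singleton {R M : Type*} [CommRing R] [AddCommGroup M] [Module R M] (e : R)
    (z : Ideal.span {e} ⊗[R] M) :
    ∃ m : M, z = (⟨e, Ideal.mem_span_singleton_self e⟩ : Ideal.span {e}) ⊗ₜ[R] m := by
  induction z using TensorProduct.induction_on with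
  | zero => exact ⟨0, by simp⟩
  | tmul i m =>
    obtain ⟨i, hi⟩ := i
    obtain ⟨r, rfl⟩ := Ideal.mem_span_singleton'.1 hi
    refine ⟨r • m, ?_⟩
    rw [← TensorProduct.smul_tmul]
    rfl
  | add x y hx hy =>
    obtain ⟨m, rfl⟩ := hx
    obtain ⟨m', rfl⟩ := hy
    exact ⟨m + m', (TensorProduct.tmul_add _ _ _).symm⟩

/-- A module over the dual numbers of a field is flat if the kernel of `ε` is contained in the
image of `ε`. -/
lemma flat_dualNumber {K M : Type*} [Field K] [AddCommGroup M] [Module (DualNumber K) M]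
    (h : ∀ m : M, (DualNumber.eps : DualNumber K) • m = 0 →
      ∃ m' : M, m = (DualNumber.eps : DualNumber K) • m') : Module.Flat (DualNumber K) M := by
  rw [Module.Flat.iff_lift_lsmul_comp_subtype_injective]
  intro I _
  rw [← LinearMap.ker_eq_bot, LinearMap.ker_eq_bot']
  intro z hz
  -- The ideals are `0`, `(ε)` and the whole ring. Only `(ε)` uses the hypothesis: if `ε m = 0`,
  -- then `m = ε m'` and `ε ⊗ m = ε² ⊗ m' = 0`.
  rcases DualNumber.ideal_trichotomy I with rfl | rfl | rfl
  · rw [Subsingleton.elim z 0]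
  · obtain ⟨m, rfl⟩ := exists_tmul_span_singleton _ z
    obtain ⟨m', rfl⟩ := h m (by simpa using hz)
    rw [← TensorProduct.smul_tmul]
    have : (DualNumber.eps : DualNumber K) • (⟨DualNumber.eps,
        Ideal.mem_span_singleton_self _⟩ : Ideal.span {(DualNumber.eps : DualNumber K)}) = 0 :=
      Subtype.ext DualNumber.eps_mul_eps
    rw [this, TensorProduct.zero_tmul]
  · obtain ⟨m, hm⟩ : ∃ m : M, z = (⟨1, trivial⟩ : (⊤ : Ideal (DualNumber K))) ⊗ₜ m := by
      clear hz
      induction z using TensorProduct.induction_on with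
      | zero => exact ⟨0, by simp⟩
      | tmul i m =>
        refine ⟨(i : DualNumber K) • m, ?_⟩
        rw [← TensorProduct.smul_tmul]
        congr 1
        exact Subtype.ext (mul_one _).symm
      | add x y hx hy =>
        obtain ⟨m, rfl⟩ := hx
        obtain ⟨m', rfl⟩ := hy
        exact ⟨m + m', (TensorProduct.tmul_add _ _ _).symm⟩
    subst hm
    have : m = 0 := by simpa using hz
    rw [this, TensorProduct.tmul_zero]

lemma dualStr_eps (X : Space) : dualStr X ⊤ DualNumber.eps = tee X := by
  apply TrivSqZeroExt.ext
  · exact map_zero (Algebra.ofId ℂ (Sec X ⊤))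
  · exact map_one (Algebra.ofId ℂ (Sec X ⊤))

/-- A module on `double X` is flat over the double point if the kernel of `t` equals its image. -/
lemma isFlatDual_of_exact (N : Mod (double X))
    (h : (ShortComplex.mk _ _ (tMul_tMul N)).Exact) : IsFlatDual N := by
  intro x
  let S := TopCat.Presheaf.stalk (C := Ab.{0}) (X := (double X : TopCat)) N.val.presheaf x
  let g : ∀ (U : Opens (double X)) (_ : x ∈ U), MSec N U → S := fun U hxU s =>
    TopCat.Presheaf.germ (C := Ab.{0}) (X := (double X : TopCat)) N.val.presheaf U x hxU s
  have hsm : ∀ (U : Opens (double X)) (hxU : x ∈ U) (s : MSec N U),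
      dualStalk X x DualNumber.eps • g U hxU s = g U hxU (glob U (tee X) • s) := by
    intro U hxU s
    refine Eq.symm ((PresheafOfModules.germ_ringCat_smul N.val x U hxU (glob U (tee X)) s).trans ?_)
    refine congrArg (fun k => k • g U hxU s) ?_
    refine (TopCat.Presheaf.germ_res_apply (C := RingCat.{0}) (X := (double X : TopCat))
      (ringSheaf (double X)).obj (homOfLE (le_top : U ≤ ⊤)) x hxU (tee X)).trans ?_
    exact congrArg (TopCat.Presheaf.germ (C := RingCat.{0}) (X := (double X : TopCat))
      (ringSheaf (double X)).obj ⊤ x trivial) (dualStr_eps X).symm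
  let := Module.compHom S (dualStalk X x)
  refine flat_dualNumber (K := ℂ) (M := S) fun m hm => ?_
  obtain ⟨U, hxU, s, rfl⟩ : ∃ (U : Opens (double X)) (hxU : x ∈ U) (s : MSec N U),
      g U hxU s = m := TopCat.Presheaf.exists_germ_eq _ m
  replace hm : g U hxU (glob U (tee X) • s) = g U hxU 0 :=
    ((hsm U hxU s).symm.trans hm).trans (map_zero (TopCat.Presheaf.germ (C := Ab.{0})
      (X := (double X : TopCat)) N.val.presheaf U x hxU).hom).symm
  obtain ⟨W, hxW, i, i', hW⟩ := TopCat.Presheaf.germ_eq _ x hxU hxU _ _ hm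
  have hW' : glob W (tee X) • mres N (leOfHom i) s = 0 := by
    have h₁ : mres N (leOfHom i) (glob U (tee X) • s) = mres N (leOfHom i') 0 := hW
    rwa [mres_smul, mres_zero, res_glob] at h₁
  -- A germ killed by `t` is represented by a section killed by `t`, which by exactness is locally
  -- `t` times a section.
  obtain ⟨V, hV, hxV, a, ha⟩ := exists_onSec_eq_of_exact h (show Opens X from W)
    (mres N (leOfHom i) s) hW' x hxW
  let V' : Opens (double X) := V
  let a' : MSec N V' := a
  refine ⟨g V' hxV a', ?_⟩
  refine Eq.trans ?_ (hsm V' hxV a').symm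
  have ha' : glob V' (tee X) • a' = mres N (hV.trans (leOfHom i)) s :=
    ha.trans (mres_comp N (leOfHom i) hV s)
  rw [ha']
  exact (TopCat.Presheaf.germ_res_apply (C := Ab.{0}) (X := (double X : TopCat))
    N.val.presheaf (homOfLE (hV.trans (leOfHom i))) x hxV s).symm

end Flat

/-! ### Comparison isomorphisms of inverse images, on sections. -/

section InverseImageSections

variable {X Y Z : Space}

/-- The inverse image of a section of a module. -/
def usec (f : X ⟶ Y) {M : Mod Y} {U : Opens Y} (m : MSec M U) :
    MSec ((pullb f).obj M) (preim f U) :=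
  onSec ((adj f).unit.app M) U m

lemma onSec_comp {M N K : Mod X} (f : M ⟶ N) (g : N ⟶ K) (U : Opens X) (m : MSec M U) :
    onSec (f ≫ g) U m = onSec g U (onSec f U m) := rfl

/-- The comparison isomorphism is the mate of the one for direct images, which does nothing on
sections. Such formulas replace coherence diagrams for inverse images. -/
lemma onSec_pullbComp (f : X ⟶ Y) (g : Y ⟶ Z) {M : Mod Z} {U : Opens Z} (m : MSec M U) :
    onSec ((pullbComp f g).hom.app M) (preim (f ≫ g) U) (usec f (usec g m)) = usec (f ≫ g) m :=
  (congrArg (fun t => onSec t U m) (unit_conjugateEquiv_symm (adj (f ≫ g)) ((adj g).comp (adj f))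
    (pushfComp f g).inv M)).symm

lemma onSec_pullbId {M : Mod X} {U : Opens X} (m : MSec M U) :
    onSec ((pullbId X).hom.app M) U (usec (𝟙 X) m) = m :=
  (congrArg (fun t => onSec t U m) (unit_conjugateEquiv_symm .id (adj (𝟙 X))
    (pushfId X).inv M)).symm

lemma onSec_eqToIso {f g : X ⟶ Y} (h : f = g) {M : Mod Y} {U : Opens Y} (m : MSec M U) :
    onSec ((eqToIso (congrArg pullb h)).app M).hom (preim f U) (usec f m) =
      mres _ (le_of_eq (by rw [h])) (usec g m) := by
  subst h
  exact (congrArg (fun k => k.hom (usec f m)) (((pullb f).obj M).val.map_id (op (preim f U)))).symm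

lemma mres_self (M : Mod X) {U : Opens X} (h : U ≤ U) (m : MSec M U) : mres M h m = m :=
  congrArg (fun k => k.hom m) (M.val.map_id (op U))

lemma onSec_pushf_eqToIso {f g : X ⟶ Y} (h : f = g) {M : Mod X} {U : Opens Y}
    (m : MSec ((pushf f).obj M) U) : onSec ((eqToIso (congrArg pushf h)).app M).hom U m =
      mres M (U := preim f U) (V := preim g U) (le_of_eq (by rw [h])) m := by
  subst h
  exact (mres_self M _ _).symm

lemma onSec_dualInclIso {M : Mod X} {U : Opens X}
    (m : MSec ((pushf (dualProj X)).obj ((pushf (dualIncl X)).obj M)) U) :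
    onSec (dualInclIso M).hom U m = (show MSec M U from m) := by
  let m₁ : MSec ((pushf (dualIncl X ≫ dualProj X)).obj M) U := m
  have h₁ : onSec (dualInclIso M).hom U m = onSec ((pushfId X).hom.app M) U
    (onSec ((eqToIso (congrArg pushf (dualIncl_dualProj X))).app M).hom U m₁) := by
    rw [dualInclIso, Iso.trans_hom, Iso.trans_hom, onSec_comp, onSec_comp]
    rfl
  exact h₁.trans ((congrArg (onSec ((pushfId X).hom.app M) U)
    (onSec_pushf_eqToIso (dualIncl_dualProj X) m₁)).trans (mres_self M (le_refl U) m))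

lemma onSec_toCentral (N : Mod (double X)) (U : Opens X)
    (m : MSec ((pushf (dualProj X)).obj N) U) :
    onSec (toCentral N) U m = (show MSec ((pullb (dualIncl X)).obj N) U from
      usec (dualIncl X) (U := preim (dualProj X) U) m) := by
  rw [toCentral, onSec_comp]
  exact onSec_dualInclIso _

end InverseImageSections

/-! ### Modules from `X`, restricted to the zero section and to double points. -/

section Fibres

variable {X P Y : Space} {p : P ⟶ X} {i₀ : X ⟶ P}

lemma sectionIso_naturality (h : i₀ ≫ p = 𝟙 X) {M M' : Mod X} (g : M ⟶ M') :
    (pullb i₀).map ((pullb p).map g) ≫ (sectionIso h M').hom = (sectionIso h M).hom ≫ g := by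
  have h₁ := (pullbComp i₀ p).hom.naturality g
  have h₂ := (eqToIso (congrArg pullb h)).hom.naturality g
  have h₃ := (pullbId X).hom.naturality g
  dsimp only [Functor.comp_map, Functor.id_map] at h₁ h₃
  simp only [sectionIso, Iso.trans_hom, Iso.app_hom, Category.assoc]
  rw [reassoc_of% h₁, reassoc_of% h₂, h₃]

lemma onSec_sectionIso (h : i₀ ≫ p = 𝟙 X) {M : Mod X} {U : Opens X} (m : MSec M U) :
    onSec (sectionIso h M).hom (preim i₀ (preim p U)) (usec i₀ (usec p m)) =
      mres M (le_of_eq (congrArg (fun f => preim f U) h)) m := by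
  refine (congrArg (fun t => onSec ((pullbId X).hom.app M) (preim i₀ (preim p U))
    (onSec ((eqToIso (congrArg pullb h)).app M).hom (preim i₀ (preim p U)) t))
    (onSec_pullbComp i₀ p m)).trans ?_
  refine (congrArg (onSec ((pullbId X).hom.app M) (preim i₀ (preim p U)))
    (onSec_eqToIso h m)).trans ?_
  exact (onSec_mres _ _ _).trans (congrArg (mres M _) (onSec_pullbId m))

/-- `h^* p^* M ≅ r^* M` if `h ≫ p = r`. -/
def compIso {h : Y ⟶ P} {r : Y ⟶ X} (e : h ≫ p = r) (M : Mod X) :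
    (pullb h).obj ((pullb p).obj M) ≅ (pullb r).obj M :=
  (pullbComp h p).app M ≪≫ (eqToIso (congrArg pullb e)).app M

lemma compIso_naturality {h : Y ⟶ P} {r : Y ⟶ X} (e : h ≫ p = r) {M M' : Mod X} (g : M ⟶ M') :
    (pullb h).map ((pullb p).map g) ≫ (compIso e M').hom = (compIso e M).hom ≫ (pullb r).map g := by
  have h₁ := (pullbComp h p).hom.naturality g
  have h₂ := (eqToIso (congrArg pullb e)).hom.naturality g
  dsimp only [Functor.comp_map] at h₁
  simp only [compIso, Iso.trans_hom, Iso.app_hom, Category.assoc]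
  rw [reassoc_of% h₁, h₂]

lemma onSec_compIso {h : Y ⟶ P} {r : Y ⟶ X} (e : h ≫ p = r) {M : Mod X} {U : Opens X}
    (m : MSec M U) : onSec (compIso e M).hom (preim h (preim p U)) (usec h (usec p m)) =
      mres _ (le_of_eq (congrArg (fun f => preim f U) e)) (usec r m) :=
  (congrArg (onSec ((eqToIso (congrArg pullb e)).app M).hom (preim h (preim p U)))
    (onSec_pullbComp h p m)).trans (onSec_eqToIso e m)

/-- A section of a module on `X`, as a section of its inverse image on `double X`. -/
def toDouble {h : double X ⟶ P} (e : h ≫ p = dualProj X) (M : Mod X) :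
    M ⟶ (pushf (dualProj X)).obj ((pullb h).obj ((pullb p).obj M)) :=
  (adj (dualProj X)).unit.app M ≫ (pushf (dualProj X)).map (compIso e M).inv

lemma toDouble_naturality {h : double X ⟶ P} (e : h ≫ p = dualProj X) {M M' : Mod X}
    (g : M ⟶ M') : toDouble e M ≫ (pushf (dualProj X)).map ((pullb h).map ((pullb p).map g)) =
      g ≫ toDouble e M' := by
  have h₁ : (compIso e M).inv ≫ (pullb h).map ((pullb p).map g) =
      (pullb (dualProj X)).map g ≫ (compIso e M').inv := by
    rw [Iso.inv_comp_eq, ← Category.assoc, ← compIso_naturality, Category.assoc, Iso.hom_inv_id,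
      Category.comp_id]
  have h₂ := (adj (dualProj X)).unit_naturality g
  rw [toDouble, toDouble, Category.assoc, ← Functor.map_comp, h₁, Functor.map_comp,
    reassoc_of% h₂]

lemma onSec_toDouble {h : double X ⟶ P} (e : h ≫ p = dualProj X) {M : Mod X} {U : Opens X}
    (m : MSec M U) : onSec (toDouble e M) U m =
      mres _ (U := preim h (preim p U)) (V := preim (dualProj X) U)
        (le_of_eq (congrArg (fun f => preim f U) e.symm)) (usec h (usec p m)) := by
  have h₁ : onSec (compIso e M).hom (preim (dualProj X) U) (mres _ (U := preim h (preim p U))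
      (V := preim (dualProj X) U) (le_of_eq (congrArg (fun f => preim f U) e.symm))
      (usec h (usec p m))) = usec (dualProj X) m := by
    rw [onSec_mres, onSec_compIso]
    exact (mres_comp _ _ _ _).trans (mres_self _ _ _)
  have h₂ : onSec (compIso e M).inv (preim (dualProj X) U) (usec (dualProj X) m) = _ :=
    congrArg (onSec (compIso e M).inv (preim (dualProj X) U)) h₁.symm
  refine h₂.trans ?_
  rw [← onSec_comp, Iso.hom_inv_id]
  rfl

/-- A section of a module on `X`, pulled back to `double X` and restricted to the central fibre. -/
lemma toDouble_toCentral {h : double X ⟶ P} (e : h ≫ p = dualProj X)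
    (e' : dualIncl X ≫ h = i₀) (e'' : i₀ ≫ p = 𝟙 X) (M : Mod X) :
    toDouble e M ≫ toCentral _ ≫ (compIso e' ((pullb p).obj M)).hom ≫ (sectionIso e'' M).hom =
      𝟙 M := by
  refine hom_ext' _ _ fun U m => ?_
  let M' := (pullb h).obj ((pullb p).obj M)
  let W : Opens X := preim (dualIncl X) (preim h (preim p U))
  have hW : U ≤ W := le_of_eq (congrArg (fun f => preim f U)
    ((congrArg (· ≫ p) e').trans e'' : (dualIncl X ≫ h) ≫ p = 𝟙 X).symm)
  have h₁ : onSec (toCentral M') U (onSec (toDouble e M) U m) =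
      mres ((pullb (dualIncl X)).obj M') hW (usec (dualIncl X) (usec h (usec p m))) :=
    ((congrArg (onSec (toCentral M') U) (onSec_toDouble e m)).trans (onSec_toCentral M' U _)).trans
      (onSec_mres ((adj (dualIncl X)).unit.app M') _ _)
  have h₂ : onSec (compIso e' ((pullb p).obj M)).hom U
      (mres ((pullb (dualIncl X)).obj M') hW (usec (dualIncl X) (usec h (usec p m)))) =
      mres _ (le_of_eq (congrArg (fun f => preim f U) e'').symm) (usec i₀ (usec p m)) :=
    ((onSec_mres _ _ _).trans (congrArg (mres _ hW) (onSec_compIso e' (usec p m)))).trans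
      (mres_comp _ _ _ _)
  have h₃ : onSec (sectionIso e'' M).hom U
      (mres _ (le_of_eq (congrArg (fun f => preim f U) e'').symm) (usec i₀ (usec p m))) = m :=
    ((onSec_mres _ _ _).trans (congrArg (mres _ _) (onSec_sectionIso e'' m))).trans
      ((mres_comp _ _ _ _).trans (mres_self _ _ _))
  exact (congrArg (onSec (sectionIso e'' M).hom U)
    ((congrArg (onSec (compIso e' ((pullb p).obj M)).hom U) h₁).trans h₂)).trans h₃

end Fibres

/-! ### Computing extension classes. -/

section ExtLemmas

open Abelian

universe w v u

variable {C : Type u} [Category.{v} C] [Abelian C] [HasExt.{w} C]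

lemma extClass_comp_mk₀ {A' B' A B Z' Z : C} {f' : A' ⟶ B'} {g' : B' ⟶ Z'}
    {w' : f' ≫ g' = 0} {f : A ⟶ B} {g : B ⟶ Z} {w : f ≫ g = 0}
    (h' : (ShortComplex.mk f' g' w').ShortExact) (h : (ShortComplex.mk f g w).ShortExact)
    (a : A' ⟶ A) (k : B' ⟶ B) (c : Z' ⟶ Z) (h₁ : f' ≫ k = a ≫ f) (h₂ : k ≫ g = g' ≫ c) :
    h'.extClass.comp (Ext.mk₀ a) (add_zero 1) = (Ext.mk₀ c).comp h.extClass (zero_add 1) :=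
  ShortComplex.ShortExact.extClass_naturality h' h
    { τ₁ := a, τ₂ := k, τ₃ := c, comm₁₂ := h₁.symm, comm₂₃ := h₂ }

lemma comp_mk₀_sum {A B Z : C} (x : Ext.{w} Z A 1) {ι : Type*} [Fintype ι] (f : ι → (A ⟶ B)) :
    x.comp (Ext.mk₀ (∑ i, f i)) (add_zero 1) =
      ∑ i, x.comp (Ext.mk₀ (f i)) (add_zero 1) := by
  rw [Ext.mk₀_sum, Ext.comp_sum]

/-- The class of an extension of `E₁ ⊞ E₂` which is split over `E₁`. -/
lemma extClass_of_lift_inl [HasBinaryBiproducts C] {E₁ E₂ A B A' G : C} {f : A ⟶ B}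
    {g : B ⟶ E₁ ⊞ E₂} {w : f ≫ g = 0} (h : (ShortComplex.mk f g w).ShortExact) (ε : E₁ ⟶ B)
    (hε : ε ≫ g = biprod.inl) {f' : A' ⟶ G} {g' : G ⟶ E₂} {w' : f' ≫ g' = 0}
    (h' : (ShortComplex.mk f' g' w').ShortExact) (a : A' ⟶ A) (k : G ⟶ B) (h₁ : f' ≫ k = a ≫ f)
    (h₂ : k ≫ g = g' ≫ biprod.inr) :
    h.extClass = (Ext.mk₀ biprod.snd).comp (h'.extClass.comp (Ext.mk₀ a) (add_zero 1))
      (zero_add 1) := by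
  have hz : (Ext.mk₀ (biprod.inl : E₁ ⟶ E₁ ⊞ E₂)).comp h.extClass (zero_add 1) = 0 := by
    rw [← hε, ← Ext.mk₀_comp_mk₀, Ext.comp_assoc _ _ _ (zero_add 0) (zero_add 1) (by simp)]
    erw [h.comp_extClass]
    rw [Ext.comp_zero]
  rw [extClass_comp_mk₀ h' h a k biprod.inr h₁ h₂, Ext.mk₀_comp_mk₀_assoc]
  conv_lhs => rw [← Ext.mk₀_id_comp h.extClass]
  -- The class is the sum of its pull-backs through the two summands. The one along `inl` vanishes
  -- because `inl` lifts to `B`; the one along `inr` is the push-out of the class of `h'`.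
  have ht : 𝟙 (E₁ ⊞ E₂) = biprod.fst ≫ biprod.inl + biprod.snd ≫ biprod.inr :=
    biprod.total.symm
  have : (Ext.mk₀ (biprod.fst ≫ biprod.inl : E₁ ⊞ E₂ ⟶ E₁ ⊞ E₂)).comp h.extClass (zero_add 1)
      = 0 := by
    rw [← Ext.mk₀_comp_mk₀_assoc, hz, Ext.comp_zero]
  change (Ext.mk₀ (𝟙 (E₁ ⊞ E₂))).comp h.extClass (zero_add 1) = _
  rw [ht, Ext.mk₀_add, Ext.add_comp, this, zero_add]

end ExtLemmas

/-! ### The universal extension as a push-out of an extension from `X`. -/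

section TautologicalModel

open Abelian

variable {X P : Space} {n : ℕ} {E₁ E₂ : Mod X} {ξ : Module.Basis (Fin n) ℂ (ExtCls E₂ E₁)}
  {p : P ⟶ X} {q : P ⟶ Aff (Fin n → ℂ)}

/-- The tautological morphism `p^*(E₁ⁿ) ⟶ p^* E₁`, `(e_j) ↦ ∑ x_j e_j`. -/
def tautMap (E₁ : Mod X) (p : P ⟶ X) (q : P ⟶ Aff (Fin n → ℂ)) :
    (pullb p).obj (⨁ fun _ : Fin n => E₁) ⟶ (pullb p).obj E₁ :=
  ∑ j, (pullb p).map (biproduct.π _ j) ≫ mulEnd (coord q j) _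

/-- An additive functor preserves the biproduct, so an element of `F(Eⁿ)` is zero once all its
components are, and these are detected by the `F (f j)`. -/
lemma mono_map_of_comp_biproduct_π {C D : Type*} [Category* C] [Category* D] [Abelian C]
    [Abelian D] [HasFiniteBiproducts C]
    (F : C ⥤ D) [F.Additive] {n : ℕ} {E G : C} {B : Fin n → C} {a : (⨁ fun _ : Fin n => E) ⟶ G}
    {f : ∀ j, E ⟶ B j} (k : ∀ j, G ⟶ B j) (h : ∀ j, a ≫ k j = biproduct.π _ j ≫ f j)
    (hm : ∀ j, Mono (F.map (f j))) : Mono (F.map a) := by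
  refine Preadditive.mono_of_cancel_zero _ fun {T} x hx => ?_
  have h₁ : ∀ j, x ≫ F.map (biproduct.π _ j) = 0 := fun j => by
    have := hm j
    rw [← cancel_mono (F.map (f j)), Category.assoc, ← F.map_comp, ← h, F.map_comp,
      reassoc_of% hx, zero_comp, zero_comp]
  have h₂ : (∑ j, F.map (biproduct.π (fun _ : Fin n => E) j) ≫ F.map (biproduct.ι (fun _ : Fin n => E) j)) = 𝟙 _ := by
    rw [← F.map_id, ← biproduct.total, F.map_sum]
    simp only [F.map_comp]
  rw [← Category.comp_id x, ← h₂, Preadditive.comp_sum]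
  exact Finset.sum_eq_zero fun j _ => by rw [reassoc_of% (h₁ j), zero_comp]

/-- The universal extension is the push-out along the tautological morphism of the inverse image
of an extension on `X`. -/
lemma UniversalExtension.exists_model (U : UniversalExtension ξ p q) :
    ∃ (G : Mod X) (a : (⨁ fun _ : Fin n => E₁) ⟶ G) (c : G ⟶ E₂) (w : a ≫ c = 0)
      (w' : (pullb p).map a ≫ (pullb p).map c = 0)
      (hG : (ShortComplex.mk a c w).ShortExact)
      (_ : (ShortComplex.mk ((pullb p).map a) ((pullb p).map c) w').ShortExact)
      (k : (pullb p).obj G ⟶ U.sheaf),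
      (∀ j, hG.extClass.comp (Ext.mk₀ (biproduct.π _ j)) (add_zero 1) = ξ j) ∧
      (pullb p).map a ≫ k = tautMap E₁ p q ≫ U.ι ∧ k ≫ U.π = (pullb p).map c := by
  obtain ⟨η, hη, hU⟩ := U.class_eq
  choose B f g w w' hB hB' hξ hη' using hη
  obtain ⟨G, a, c, wG, k, hG, hak, hkc⟩ := exists_joint_extension B f g w hB
  -- Flatness of `p` is not used: injectivity of each `p^* (f j)` is part of the data saying that `η
  -- j` is the inverse image of `ξ j`.
  have hm : Mono ((pullb p).map a) :=
    mono_map_of_comp_biproduct_π _ k hak fun j => (hB' j).mono_f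
  have wG' : (pullb p).map a ≫ (pullb p).map c = 0 := by
    rw [← Functor.map_comp, wG, Functor.map_zero]
  have hG' := shortExact_map_of_mono (pullb p) hG hm wG'
  have h₁ : ∀ j, hG'.extClass.comp (Ext.mk₀ ((pullb p).map (biproduct.π _ j))) (add_zero 1) =
      η j := fun j => by
    rw [extClass_comp_mk₀ hG' (hB' j) _ ((pullb p).map (k j)) (𝟙 _), Ext.mk₀_id_comp, hη']
    · rw [← Functor.map_comp, hak, Functor.map_comp]
    · rw [← Functor.map_comp, hkc, Category.comp_id]
  -- Pushing the class of `p^* G` out along the tautological map gives `∑ x_j η_j`, the class of the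
  -- universal extension.
  obtain ⟨t, ht, ht'⟩ := exists_hom_of_extClass hG' U.exact (tautMap E₁ p q) (by
    rw [tautMap, comp_mk₀_sum, hU]
    refine Finset.sum_congr rfl fun j _ => ?_
    rw [← Ext.mk₀_comp_mk₀, ← Ext.comp_assoc_of_third_deg_zero, h₁])
  refine ⟨G, a, c, wG, wG', hG, hG', t, fun j => ?_, ht, ht'⟩
  rw [extClass_comp_mk₀ hG (hB j) _ (k j) (𝟙 _) (hak j) (by rw [hkc, Category.comp_id]),
    Ext.mk₀_id_comp, hξ]

lemma pullb_map_tautMap {Y : Space} (f : Y ⟶ P) (E₁ : Mod X) :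
    (pullb f).map (tautMap E₁ p q) =
      ∑ j, (pullb f).map ((pullb p).map (biproduct.π (fun _ : Fin n => E₁) j)) ≫
        mulEnd (coord (f ≫ q) j) _ := by
  rw [tautMap, Functor.map_sum]
  refine Finset.sum_congr rfl fun j _ => ?_
  rw [Functor.map_comp, pullb_map_mulEnd]
  rfl

end TautologicalModel

/-! ### The extension of the central fibre by itself. -/

section DoubleModules

variable {X : Space}

lemma exact_tMul_of_iso {N N' : Mod (double X)} (e : N ≅ N')
    (h : (ShortComplex.mk _ _ (tMul_tMul N)).Exact) :
    (ShortComplex.mk _ _ (tMul_tMul N')).Exact :=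
  ShortComplex.exact_of_iso (ShortComplex.isoMk ((pushf (dualProj X)).mapIso e)
    ((pushf (dualProj X)).mapIso e) ((pushf (dualProj X)).mapIso e)
    (tMul_naturality e.hom).symm (tMul_naturality e.hom).symm) h

lemma exact_tMul_of_shortExact {A N Z : Mod (double X)} {f : A ⟶ N} {g : N ⟶ Z}
    {w : f ≫ g = 0} (h : (ShortComplex.mk f g w).ShortExact)
    (hA : (ShortComplex.mk _ _ (tMul_tMul A)).Exact)
    (hZ : (ShortComplex.mk _ _ (tMul_tMul Z)).Exact) :
    (ShortComplex.mk _ _ (tMul_tMul N)).Exact :=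
  exact_endo_of_shortExact (shortExact_pushf_dualProj h
    (by rw [← Functor.map_comp, w, Functor.map_zero])) (tMul_tMul A) (tMul_tMul N) (tMul_tMul Z)
    (tMul_naturality f) (tMul_naturality g) hA hZ

/-- The extension of `F` by `F` defined by a module on `double X`, flat over the double point, with
central fibre `F`. -/
lemma exists_shortExact_of_exact_tMul {N : Mod (double X)} {F : Mod X}
    (hN : (ShortComplex.mk _ _ (tMul_tMul N)).Exact) (e : (pullb (dualIncl X)).obj N ≅ F) :
    ∃ (j : F ⟶ (pushf (dualProj X)).obj N) (_ : (toCentral N ≫ e.hom) ≫ j = tMul N)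
      (w : j ≫ toCentral N ≫ e.hom = 0),
      (ShortComplex.mk j (toCentral N ≫ e.hom) w).ShortExact := by
  obtain ⟨g, hg⟩ := exists_toCentral_desc (tMul N) (tMul_tMul N)
  have hj : (toCentral N ≫ e.hom) ≫ e.inv ≫ g = tMul N := by
    rw [Category.assoc, Iso.hom_inv_id_assoc, hg]
  have hepi : Epi (toCentral N ≫ e.hom) := inferInstance
  have w : (e.inv ≫ g) ≫ toCentral N ≫ e.hom = 0 := by
    rw [← cancel_epi (toCentral N ≫ e.hom), ← Category.assoc, hj, comp_zero, ← Category.assoc,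
      tMul_toCentral, zero_comp]
  -- An element of `F` killed by this map lifts to some `y` in `N` with `t y = 0`. Then `y` is a
  -- multiple of `t`, so its image in `F` is zero.
  have hmono : Mono (e.inv ≫ g) := by
    refine Preadditive.mono_of_cancel_zero _ fun {T} x hx => ?_
    obtain ⟨T', π, _, y, hy⟩ := surjective_up_to_refinements_of_epi (toCentral N ≫ e.hom) x
    rw [exact_mk_iff] at hN
    obtain ⟨T₂, π₂, _, z, hz⟩ := hN T' y (by
      rw [← hj, ← Category.assoc, ← hy, Category.assoc, hx, comp_zero])
    rw [← cancel_epi π, ← cancel_epi π₂, hy, reassoc_of% hz, reassoc_of% (tMul_toCentral N)]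
    simp
  refine ⟨e.inv ≫ g, hj, w, ShortComplex.ShortExact.mk' ?_ hmono hepi⟩
  have h₁ := exact_toCentral N
  rw [exact_mk_iff] at h₁ ⊢
  intro T x hx
  obtain ⟨T', π, hπ, y, hy⟩ := h₁ T x (by
    rw [← cancel_mono e.hom, Category.assoc, hx, zero_comp])
  exact ⟨T', π, hπ, y ≫ toCentral N ≫ e.hom, by rw [hy, Category.assoc, hj]⟩

lemma FirstOrderDeformation.toFibre_eq {F : Mod X} (D : FirstOrderDeformation F) :
    D.toFibre = toCentral D.sheaf ≫ D.iso.hom := by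
  rw [toCentral, Category.assoc, ← dualInclIso_naturality]
  rw [FirstOrderDeformation.toFibre, Functor.map_comp]
  exact Category.assoc _ _ _

lemma toCentral_naturality {N N' : Mod (double X)} (g : N ⟶ N') :
    (pushf (dualProj X)).map g ≫ toCentral N' = toCentral N ≫ (pullb (dualIncl X)).map g := by
  have h := (adj (dualIncl X)).unit_naturality g
  rw [toCentral, toCentral, Category.assoc, ← dualInclIso_naturality, ← Functor.map_comp_assoc,
    ← Functor.map_comp_assoc]
  exact congrArg (fun t => (pushf (dualProj X)).map t ≫ (dualInclIso _).hom) h.symm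

lemma pushf_map_mulEnd_smul_tee (z : ℂ) (N : Mod (double X)) :
    (pushf (dualProj X)).map (mulEnd (z • tee X) N) = z • tMul N := by
  have h₁ : mulEnd (z • tee X) N = mulEnd (algebraMap ℂ _ z) N ≫ mulEnd (tee X) N := by
    rw [← mulEnd_mul, Algebra.smul_def]
  have h₂ := pushf_map_mulEnd (dualProj X) (algebraMap ℂ _ z) N
  rw [AlgHom.commutes] at h₂
  rw [h₁, Functor.map_comp]
  exact congrArg (· ≫ tMul N) h₂

end DoubleModules

/-! ### Restrictions of the universal extension and their classes. -/

section CentralFibre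

open Abelian

variable {X P Y : Space} {n : ℕ} {E₁ E₂ : Mod X} {ξ : Module.Basis (Fin n) ℂ (ExtCls E₂ E₁)}
  {p : P ⟶ X} {q : P ⟶ Aff (Fin n → ℂ)} {i₀ : X ⟶ P}

/-- `i₀^* p^*` is isomorphic to the identity functor. With the analogue for double points, this is
all the exactness needed of inverse images. -/
lemma mono_pullb_section (h : i₀ ≫ p = 𝟙 X) {M M' : Mod X} (a : M ⟶ M') [Mono a] :
    Mono ((pullb i₀).map ((pullb p).map a)) := by
  have h₁ : (pullb i₀).map ((pullb p).map a) =
      (sectionIso h M).hom ≫ a ≫ (sectionIso h M').inv := by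
    rw [← Category.assoc, ← sectionIso_naturality, Category.assoc, Iso.hom_inv_id,
      Category.comp_id]
  rw [h₁]
  infer_instance

lemma mono_pullb_double {h : double X ⟶ P} (e : h ≫ p = dualProj X) {M M' : Mod X} (a : M ⟶ M')
    [Mono a] : Mono ((pullb h).map ((pullb p).map a)) := by
  have h₁ : (pullb h).map ((pullb p).map a) =
      (compIso e M).hom ≫ (pullb (dualProj X)).map a ≫ (compIso e M').inv := by
    rw [← Category.assoc, ← compIso_naturality, Category.assoc, Iso.hom_inv_id,
      Category.comp_id]
  have := mono_pullb_dualProj a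
  rw [h₁]
  infer_instance

lemma exists_iso_biprod {C : Type*} [Category* C] [Abelian C] {A B Z : C} {f : A ⟶ B} {g : B ⟶ Z}
    {w : f ≫ g = 0} (h : (ShortComplex.mk f g w).ShortExact) (s : Z ⟶ B) (hs : s ≫ g = 𝟙 Z) :
    ∃ φ : B ≅ A ⊞ Z, φ.inv = biprod.desc f s ∧ f ≫ φ.hom = biprod.inl ∧
      s ≫ φ.hom = biprod.inr ∧ φ.inv ≫ g = biprod.snd := by
  have : Mono f := h.mono_f
  obtain ⟨r, hr⟩ := ShortExact.exists_lift h (𝟙 B - g ≫ s) (by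
    rw [Preadditive.sub_comp, Category.assoc, hs, Category.id_comp, Category.comp_id, sub_self])
  have hfr : f ≫ r = 𝟙 A := by
    rw [← cancel_mono f, Category.assoc, hr, Preadditive.comp_sub, ← Category.assoc f g, w]
    simp
  have hsr : s ≫ r = 0 := by
    rw [← cancel_mono f, Category.assoc, hr, Preadditive.comp_sub, ← Category.assoc s g, hs]
    simp
  let φ : B ≅ A ⊞ Z :=
    { hom := biprod.lift r g
      inv := biprod.desc f s
      hom_inv_id := by rw [biprod.lift_desc, hr]; simp
      inv_hom_id := by
        ext <;> simp [hfr, hsr, hs, w] }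
  refine ⟨φ, rfl, ?_, ?_, ?_⟩
  · ext <;> simp [φ, hfr, w]
  · ext <;> simp [φ, hsr, hs]
  · ext <;> simp [φ, hs, w]

lemma exists_shortExact_conj {C : Type*} [Category* C] [Abelian C] {A A' B Z Z' : C} (e : A ≅ A')
    (e' : Z ≅ Z') {f : A ⟶ B} {g : B ⟶ Z} {w : f ≫ g = 0}
    (h : (ShortComplex.mk f g w).ShortExact) :
    ∃ w, (ShortComplex.mk (e.inv ≫ f) (g ≫ e'.hom) w).ShortExact :=
  have w' : (e.inv ≫ f) ≫ g ≫ e'.hom = 0 := by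
    rw [Category.assoc, reassoc_of% w, zero_comp, comp_zero]
  let i : ShortComplex.mk f g w ≅ ShortComplex.mk (e.inv ≫ f) (g ≫ e'.hom) w' :=
    ShortComplex.isoMk e (Iso.refl _) e' (by simp) (by simp)
  ⟨w', ShortComplex.shortExact_of_iso i h⟩

/-- The class of an extension of `E₁ ⊞ E₂` by `E₁ ⊞ E₂` in which `E₁` is lifted by `ε` and the
restriction to `E₂` is covered by an extension `G`. -/
lemma extClass_of_lifts {C : Type*} [Category* C] [Abelian C] [HasExt C] {E₁ E₂ E₀ A G N : C}
    {α : E₁ ⟶ E₀} {s s₀ : E₂ ⟶ E₀} (φ : E₀ ≅ E₁ ⊞ E₂) (hα : α ≫ φ.hom = biprod.inl)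
    (hs : s ≫ φ.hom = biprod.inr) {u : E₂ ⟶ E₁} (hu : u ≫ α = s - s₀)
    {a : A ⟶ G} {c : G ⟶ E₂} {wG : a ≫ c = 0} (hG : (ShortComplex.mk a c wG).ShortExact)
    {r : N ⟶ E₁ ⊞ E₂} {j : E₁ ⊞ E₂ ⟶ N} {w : j ≫ r = 0}
    (hS : (ShortComplex.mk j r w).ShortExact) (ε : E₁ ⟶ N) (hε : ε ≫ r = α ≫ φ.hom) (γ : G ⟶ N)
    (hγ : γ ≫ r = (c ≫ s₀) ≫ φ.hom) (V : A ⟶ E₁) (ha : a ≫ γ = V ≫ ε ≫ r ≫ j)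
    {x : Ext E₂ E₁ 1} (hx : hG.extClass.comp (Ext.mk₀ V) (add_zero 1) = x) :
    hS.extClass = (Ext.mk₀ biprod.snd).comp (x.comp (Ext.mk₀ biprod.inl) (add_zero 1))
      (zero_add 1) := by
  rw [hα] at hε
  -- `γ` covers `s₀`, whereas `φ` is adapted to `s = s₀ + u ≫ α`. The term `c ≫ u ≫ ε` makes up the
  -- difference and vanishes on `A`.
  rw [extClass_of_lift_inl hS ε hε hG (V ≫ biprod.inl) (γ + c ≫ u ≫ ε), ← hx,
    Ext.comp_assoc_of_third_deg_zero, Ext.mk₀_comp_mk₀]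
  · rw [Preadditive.comp_add, ha, reassoc_of% wG, zero_comp, add_zero, Category.assoc, ← hε,
      Category.assoc]
  · have hs' : s = s₀ + u ≫ α := by rw [hu]; abel
    rw [Preadditive.add_comp, hγ, Category.assoc, Category.assoc, Category.assoc, hε, ← hα, ← hs,
      hs', Preadditive.add_comp, Preadditive.comp_add, Category.assoc]

lemma FirstOrderDeformation.hasClass_iff {F : Mod X} (D : FirstOrderDeformation F)
    {e : (pullb (dualIncl X)).obj D.sheaf ≅ F} (he : D.iso = e) (z : ExtCls F F) :
    D.HasClass z ↔ ∃ (j : F ⟶ (pushf (dualProj X)).obj D.sheaf)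
      (_ : (toCentral D.sheaf ≫ e.hom) ≫ j = tMul D.sheaf) (w : j ≫ toCentral D.sheaf ≫ e.hom = 0)
      (h : (ShortComplex.mk j (toCentral D.sheaf ≫ e.hom) w).ShortExact), h.extClass = z := by
  subst he
  have h := D.toFibre_eq
  generalize toCentral D.sheaf ≫ D.iso.hom = r at h
  subst h
  rfl

lemma toDouble_toCentral_inv {h : double X ⟶ P} (e : h ≫ p = dualProj X)
    (e' : dualIncl X ≫ h = i₀) (e'' : i₀ ≫ p = 𝟙 X) (M : Mod X) :
    toDouble e M ≫ toCentral _ ≫ (compIso e' ((pullb p).obj M)).hom = (sectionIso e'' M).inv := by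
  rw [← cancel_mono (sectionIso e'' M).hom, Iso.inv_hom_id, Category.assoc, Category.assoc]
  exact toDouble_toCentral e e' e'' M

namespace UniversalExtension

variable (U : UniversalExtension ξ p q)

/-- The inverse image of a universal extension under a morphism `f` is an extension, if `f^* p^*`
preserves monomorphisms. -/
lemma shortExact_pullb (f : Y ⟶ P)
    (hf : ∀ {M M' : Mod X} (a : M ⟶ M') [Mono a], Mono ((pullb f).map ((pullb p).map a))) :
    ∃ w, (ShortComplex.mk ((pullb f).map U.ι) ((pullb f).map U.π) w).ShortExact := by
  obtain ⟨G, a, c, w, w', hG, hG', k, -, h₁, h₂⟩ := U.exists_model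
  have : Mono a := hG.mono_f
  have w₀ : (pullb f).map U.ι ≫ (pullb f).map U.π = 0 := by
    rw [← Functor.map_comp, U.zero, Functor.map_zero]
  exact ⟨w₀, shortExact_map_of_mono (pullb f) U.exact
    (mono_map_of_extension_hom (pullb f) hG' U.exact _ k h₁ h₂ (hf a)) w₀⟩

lemma shortExact_fibre (h₀ : IsZeroSection p q i₀) :
    ∃ w, (ShortComplex.mk (U.α h₀) (U.β h₀) w).ShortExact := by
  obtain ⟨w, h⟩ := U.shortExact_pullb i₀ (fun a _ => mono_pullb_section h₀.comp_p a)
  exact exists_shortExact_conj (sectionIso h₀.comp_p E₁) (sectionIso h₀.comp_p E₂) h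

/-- The coordinates vanish on the zero section, so there the tautological map is zero and `k`
descends along `c` to `E₂`. The second formula is kept because the class over a double point is
computed with the same `k`. -/
lemma exists_section_of_model (h₀ : IsZeroSection p q i₀) {G : Mod X}
    {a : (⨁ fun _ : Fin n => E₁) ⟶ G} {c : G ⟶ E₂} {w : a ≫ c = 0}
    (hG : (ShortComplex.mk a c w).ShortExact) {k : (pullb p).obj G ⟶ U.sheaf}
    (h₁ : (pullb p).map a ≫ k = tautMap E₁ p q ≫ U.ι) (h₂ : k ≫ U.π = (pullb p).map c) :
    ∃ s : E₂ ⟶ U.fibre h₀, s ≫ U.β h₀ = 𝟙 E₂ ∧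
      (sectionIso h₀.comp_p G).inv ≫ (pullb i₀).map k = c ≫ s := by
  have hinv : ∀ {M M' : Mod X} (g : M ⟶ M'), g ≫ (sectionIso h₀.comp_p M').inv =
      (sectionIso h₀.comp_p M).inv ≫ (pullb i₀).map ((pullb p).map g) := fun g => by
    rw [Iso.eq_inv_comp, ← Category.assoc, ← sectionIso_naturality, Category.assoc,
      Iso.hom_inv_id, Category.comp_id]
  have ht : (pullb i₀).map (tautMap E₁ p q) = 0 := by
    rw [pullb_map_tautMap]
    refine Finset.sum_eq_zero fun j _ => ?_
    rw [h₀.coord_eq, mulEnd_zero, comp_zero]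
  have hepi : Epi c := hG.epi_g
  obtain ⟨s, hs⟩ := ShortExact.exists_desc hG
    (T := (pullb i₀).obj U.sheaf) ((sectionIso h₀.comp_p G).inv ≫ (pullb i₀).map k) (by
      rw [← Category.assoc, hinv, Category.assoc, ← Functor.map_comp, h₁, Functor.map_comp, ht,
        zero_comp, comp_zero])
  refine ⟨s, ?_, hs.symm⟩
  change s ≫ (pullb i₀).map U.π ≫ (sectionIso h₀.comp_p E₂).hom = _
  rw [← cancel_epi c, ← Category.assoc, hs, Category.assoc, ← Category.assoc ((pullb i₀).map k),
    ← Functor.map_comp, h₂, sectionIso_naturality, Iso.inv_hom_id_assoc, Category.comp_id]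

lemma exists_section (h₀ : IsZeroSection p q i₀) : ∃ s : E₂ ⟶ U.fibre h₀, s ≫ U.β h₀ = 𝟙 E₂ := by
  obtain ⟨G, a, c, w, w', hG, hG', k, -, h₁, h₂⟩ := U.exists_model
  obtain ⟨s, hs, -⟩ := U.exists_section_of_model h₀ hG h₁ h₂
  exact ⟨s, hs⟩

/-- The restriction to the double point is an extension of modules that come from `X`, for which the
kernel of `t` is its image. -/
lemma exact_tMul {h : double X ⟶ P} (e : h ≫ p = dualProj X) :
    (ShortComplex.mk _ _ (tMul_tMul ((pullb h).obj U.sheaf))).Exact := by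
  obtain ⟨w, hU⟩ := U.shortExact_pullb h (fun a _ => mono_pullb_double e a)
  exact exact_tMul_of_shortExact hU
    (exact_tMul_of_iso (compIso e E₁).symm (exact_tMul_pullb_dualProj E₁))
    (exact_tMul_of_iso (compIso e E₂).symm (exact_tMul_pullb_dualProj E₂))

/-- A morphism to the restriction of `ℰ` to a double point, on the central fibre. -/
lemma toDouble_pushf_toCentral (h₀ : IsZeroSection p q i₀) {h : double X ⟶ P}
    (e : h ≫ p = dualProj X) (e' : dualIncl X ≫ h = i₀) {M : Mod X}
    (g : (pullb p).obj M ⟶ U.sheaf) :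
    (toDouble e M ≫ (pushf (dualProj X)).map ((pullb h).map g)) ≫ toCentral _ ≫
      (compIso e' U.sheaf).hom = (sectionIso h₀.comp_p M).inv ≫ (pullb i₀).map g := by
  have h₃ : (pullb (dualIncl X)).map ((pullb h).map g) ≫ (compIso e' U.sheaf).hom =
    (compIso e' ((pullb p).obj M)).hom ≫ (pullb i₀).map g := compIso_naturality e' g
  rw [Category.assoc, ← Category.assoc _ (toCentral _), toCentral_naturality, Category.assoc, h₃,
    ← toDouble_toCentral_inv e e' h₀.comp_p]
  simp only [Category.assoc]

/-- The restriction of a morphism `p^* G ⟶ ℰ` of the form `∑ x_j g_j` on `p^* E₁ⁿ` to the double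
point with direction `v`. -/
lemma toDouble_tautMap (U : UniversalExtension ξ p q) {h : double X ⟶ P}
    (e : h ≫ p = dualProj X) {v : Fin n → ℂ} (hv : ∀ j, coord (h ≫ q) j = v j • tee X) {G : Mod X}
    {a : (⨁ fun _ : Fin n => E₁) ⟶ G} {k : (pullb p).obj G ⟶ U.sheaf}
    (h₁ : (pullb p).map a ≫ k = tautMap E₁ p q ≫ U.ι) :
    a ≫ toDouble e G ≫ (pushf (dualProj X)).map ((pullb h).map k) =
      (∑ j, v j • biproduct.π (fun _ : Fin n => E₁) j) ≫
        (toDouble e E₁ ≫ (pushf (dualProj X)).map ((pullb h).map U.ι)) ≫ tMul _ := by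
  rw [← Category.assoc, ← toDouble_naturality, Category.assoc, ← Functor.map_comp,
    ← Functor.map_comp, h₁, Functor.map_comp, Functor.map_comp, pullb_map_tautMap,
    Functor.map_sum, Preadditive.sum_comp, Preadditive.comp_sum, Preadditive.sum_comp]
  refine Finset.sum_congr rfl fun j _ => ?_
  rw [hv, Functor.map_comp, pushf_map_mulEnd_smul_tee, Category.assoc, ← Category.assoc,
    toDouble_naturality, Category.assoc, Category.assoc, Linear.smul_comp, Linear.smul_comp,
    Linear.comp_smul, Linear.comp_smul, tMul_naturality]

/-- The class of the restriction of a universal extension to a double point. -/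
lemma extClass_eq (U : UniversalExtension ξ p q) (h₀ : IsZeroSection p q i₀)
    {s : E₂ ⟶ U.fibre h₀} (hs : s ≫ U.β h₀ = 𝟙 E₂) (φ : U.fibre h₀ ≅ E₁ ⊞ E₂)
    (hα : U.α h₀ ≫ φ.hom = biprod.inl) (hsφ : s ≫ φ.hom = biprod.inr)
    {x : ExtCls E₂ E₁} {h : double X ⟶ P} (hh : IsTangentEmbedding p q i₀ (ξ.repr x) h)
    {j : E₁ ⊞ E₂ ⟶ (pushf (dualProj X)).obj ((pullb h).obj U.sheaf)}
    {r : (pushf (dualProj X)).obj ((pullb h).obj U.sheaf) ⟶ E₁ ⊞ E₂}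
    (hr : r = toCentral _ ≫ (compIso hh.incl U.sheaf ≪≫ φ).hom) (hj : r ≫ j = tMul _)
    {w : j ≫ r = 0} (hS : (ShortComplex.mk j r w).ShortExact) :
    hS.extClass = (Ext.mk₀ biprod.snd).comp (x.comp (Ext.mk₀ biprod.inl) (add_zero 1))
      (zero_add 1) := by
  obtain ⟨G, a, c, wG, wG', hG, hG', k, hx, h₁, h₂⟩ := U.exists_model
  obtain ⟨s₀, hs₀, hk⟩ := U.exists_section_of_model h₀ hG h₁ h₂
  obtain ⟨wβ, hβ⟩ := U.shortExact_fibre h₀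
  -- The section `s` is arbitrary, while the model knows only `s₀`; their difference takes values in
  -- `E₁`.
  obtain ⟨u, hu⟩ := ShortExact.exists_lift hβ (s - s₀) (by
    rw [Preadditive.sub_comp, hs, hs₀, sub_self])
  have hφ : ∀ {M : Mod X} (g : (pullb p).obj M ⟶ U.sheaf),
      (toDouble hh.proj M ≫ (pushf (dualProj X)).map ((pullb h).map g)) ≫ r =
        ((sectionIso h₀.comp_p M).inv ≫ (pullb i₀).map g) ≫ φ.hom := fun g => by
    rw [hr, ← U.toDouble_pushf_toCentral h₀ hh.proj hh.incl g]
    exact (congrArg (_ ≫ ·) (Category.assoc _ _ _).symm).trans (Category.assoc _ _ _).symm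
  refine extClass_of_lifts φ hα hsφ hu hG hS
    (toDouble hh.proj E₁ ≫ (pushf (dualProj X)).map ((pullb h).map U.ι)) (hφ U.ι)
    (toDouble hh.proj G ≫ (pushf (dualProj X)).map ((pullb h).map k))
    ((hφ k).trans (congrArg (· ≫ φ.hom) hk))
    (∑ j, ξ.repr x j • biproduct.π (fun _ : Fin n => E₁) j) ?_ ?_
  · rw [hj]
    exact U.toDouble_tautMap hh.proj hh.coord_eq h₁
  · rw [comp_mk₀_sum]
    simp only [Ext.mk₀_smul, Ext.comp_smul, hx]
    exact ξ.sum_repr x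

/-- The values of the tangent map of a universal extension. -/
lemma isTangentValue_iff (U : UniversalExtension ξ p q) (h₀ : IsZeroSection p q i₀)
    (hE₁ : IsCoherent E₁) (hE₂ : IsCoherent E₂)
    {s : E₂ ⟶ U.fibre h₀} (hs : s ≫ U.β h₀ = 𝟙 E₂) (φ : U.fibre h₀ ≅ E₁ ⊞ E₂)
    (hα : U.α h₀ ≫ φ.hom = biprod.inl) (hsφ : s ≫ φ.hom = biprod.inr)
    (x : ExtCls E₂ E₁) (hex : ∃ h, IsTangentEmbedding p q i₀ (ξ.repr x) h)
    (z : ExtCls (E₁ ⊞ E₂) (E₁ ⊞ E₂)) :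
    IsTangentValue p q i₀ U.sheaf φ (ξ.repr x) z ↔
      z = (Ext.mk₀ biprod.snd).comp (x.comp (Ext.mk₀ biprod.inl) (add_zero 1)) (zero_add 1) := by
  have he : ∀ {h : double X ⟶ P} (hh : IsTangentEmbedding p q i₀ (ξ.repr x) h),
      (pullbComp (dualIncl X) h).app U.sheaf ≪≫
        (eqToIso (congrArg pullb hh.incl)).app U.sheaf ≪≫ φ = compIso hh.incl U.sheaf ≪≫ φ :=
    fun hh => (Iso.trans_assoc _ _ _).symm
  constructor
  -- Any tangent embedding yields the same class, so its uniqueness is not needed here.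
  · rintro ⟨h, hh, coh, flat, hz⟩
    obtain ⟨j, hj, w, hS, rfl⟩ := (FirstOrderDeformation.hasClass_iff _ (he hh) z).1 hz
    exact U.extClass_eq h₀ hs φ hα hsφ hh rfl hj hS
  · rintro rfl
    obtain ⟨h, hh⟩ := hex
    have hN := U.exact_tMul hh.proj
    obtain ⟨j, hj, w, hS⟩ := exists_shortExact_of_exact_tMul hN (compIso hh.incl U.sheaf ≪≫ φ)
    -- Over `𝒪_X` the restriction is an extension of `E₁ ⊞ E₂` by itself, hence coherent, and this
    -- implies coherence over `𝒪_X[t]`.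
    have hF : IsCoherent (E₁ ⊞ E₂) := isCoherent_of_shortExact
      (ShortComplex.Splitting.ofHasBinaryBiproduct E₁ E₂).shortExact hE₁ hE₂
    refine ⟨h, hh, isCoherent_of_pushf_dualProj _ (isCoherent_of_shortExact hS hF hF),
      isFlatDual_of_exact _ hN, (FirstOrderDeformation.hasClass_iff _ (he hh) _).2
        ⟨j, hj, w, hS, U.extClass_eq h₀ hs φ hα hsφ hh rfl hj hS⟩⟩

end UniversalExtension

end CentralFibre

/-! ### Hadamard's lemma for convergent power series. -/

section Hadamard

variable {V : Type*} [NormedAddCommGroup V] [NormedSpace ℂ V]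

/-- The series of `u ↦ k(u)` in the expansion `f(x + u) - f(x + L u) = k(u) (u - L u)`, applied to
the vector `e`. -/
def telescope (p : FormalMultilinearSeries ℂ V ℂ) (L : V →L[ℂ] V) (e : V) :
    FormalMultilinearSeries ℂ V ℂ := fun n =>
  ∑ i : Fin (n + 1), ((p (n + 1)).curryMid i e).compContinuousLinearMap
    fun j : Fin n => if j.castSucc < i then ContinuousLinearMap.id ℂ V else L

lemma telescope_add (p : FormalMultilinearSeries ℂ V ℂ) (L : V →L[ℂ] V) (n : ℕ) (u : Fin n → V)
    {ι : Type*} (s : Finset ι) (c : ι → ℂ) (e : ι → V) :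
    telescope p L (∑ j ∈ s, c j • e j) n u = ∑ j ∈ s, c j * telescope p L (e j) n u := by
  simp only [telescope, sum_apply,
    ContinuousMultilinearMap.compContinuousLinearMap_apply, map_sum, map_smul,
    smul_apply, Finset.mul_sum, smul_eq_mul]
  rw [Finset.sum_comm]

lemma telescope_sub (p : FormalMultilinearSeries ℂ V ℂ) (L : V →L[ℂ] V) (n : ℕ) (u : V) :
    telescope p L (u - L u) n (fun _ => u) = p (n + 1) (fun _ => u) - p (n + 1) (fun _ => L u) := by
  -- Replace the arguments `L u` by `u` one at a time. The `i`-th step changes only slot `i` and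
  -- contributes the summand with `u - L u` inserted there.
  let A : ℕ → ℂ := fun k => p (n + 1) (fun j : Fin (n + 1) => if j.1 < k then u else L u)
  have h : ∀ i : Fin (n + 1), ((p (n + 1)).curryMid i (u - L u)).compContinuousLinearMap
      (fun j : Fin n => if j.castSucc < i then ContinuousLinearMap.id ℂ V else L) (fun _ => u) =
      A (i + 1) - A i := fun i => by
    rw [map_sub, ContinuousMultilinearMap.compContinuousLinearMap_apply,
      sub_apply, ContinuousMultilinearMap.curryMid_apply,
      ContinuousMultilinearMap.curryMid_apply]
    have hc : ∀ j : Fin n, (i.succAbove j).1 < i.1 + 1 ↔ j.castSucc < i := fun j => by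
      rcases lt_or_ge j.castSucc i with hj | hj
      · rw [Fin.succAbove_of_castSucc_lt i j hj]
        have : j.1 < i.1 := hj
        simp [hj]; omega
      · rw [Fin.succAbove_of_le_castSucc i j hj]
        have : i.1 ≤ j.1 := hj
        simp [not_lt.2 hj]; omega
    have hc' : ∀ j : Fin n, (i.succAbove j).1 < i.1 ↔ j.castSucc < i := fun j =>
      Fin.succAbove_lt_iff_castSucc_lt i j
    congr 2
    · refine Fin.insertNth_eq_iff.2 ⟨by simp, funext fun j => ?_⟩
      simp only [Fin.removeNth, hc]
      split_ifs <;> rfl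
    · refine Fin.insertNth_eq_iff.2 ⟨by simp, funext fun j => ?_⟩
      simp only [Fin.removeNth, hc']
      split_ifs <;> rfl
  rw [telescope, sum_apply, Finset.sum_congr rfl fun i _ => h i,
    Fin.sum_univ_eq_sum_range (fun i => A (i + 1) - A i), Finset.sum_range_sub]
  congr 1
  exact congrArg (p (n + 1)) (funext fun j => if_pos j.2)

/-- Each of the `n + 1` summands is bounded geometrically: `M = 1 + ‖L‖` dominates the norms of both
the identity and `L`. The factor `n + 1` costs only `2 ^ n`. -/
lemma telescope_radius_pos {p : FormalMultilinearSeries ℂ V ℂ} (hp : 0 < p.radius) (L : V →L[ℂ] V)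
    (e : V) : 0 < (telescope p L e).radius := by
  obtain ⟨C, r, hC, hr, h⟩ := p.le_mul_pow_of_radius_pos hp
  let M : ℝ := 1 + ‖L‖
  have hM : 0 < M := by positivity
  have hb : ∀ n, ‖telescope p L e n‖ ≤ C * r * ‖e‖ * (2 * r * M) ^ n := fun n => by
    have h₁ : ∀ i : Fin (n + 1), ‖((p (n + 1)).curryMid i e).compContinuousLinearMap
        (fun j : Fin n => if j.castSucc < i then ContinuousLinearMap.id ℂ V else L)‖ ≤
        C * r ^ (n + 1) * ‖e‖ * M ^ n := fun i => by
      refine (ContinuousMultilinearMap.norm_compContinuousLinearMap_le _ _).trans ?_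
      refine mul_le_mul ?_ ?_ (Finset.prod_nonneg fun _ _ => norm_nonneg _) (by positivity)
      · refine ((ContinuousMultilinearMap.curryMid i (p (n + 1))).le_opNorm e).trans ?_
        rw [ContinuousMultilinearMap.norm_curryMid]
        exact mul_le_mul_of_nonneg_right (h _) (norm_nonneg _)
      · refine (Finset.prod_le_prod (fun _ _ => norm_nonneg _) (g := fun _ => M)
          fun j _ => ?_).trans (by simp)
        split_ifs
        · exact ContinuousLinearMap.norm_id_le.trans (by simp [M])
        · simp [M]
    refine (norm_sum_le _ _).trans ((Finset.sum_le_sum fun i _ => h₁ i).trans ?_)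
    rw [Finset.sum_const, Finset.card_univ, Fintype.card_fin, nsmul_eq_mul]
    have h₂ : ((n + 1 : ℕ) : ℝ) ≤ 2 ^ n := by exact_mod_cast Nat.lt_two_pow_self
    calc ((n + 1 : ℕ) : ℝ) * (C * r ^ (n + 1) * ‖e‖ * M ^ n)
        ≤ 2 ^ n * (C * r ^ (n + 1) * ‖e‖ * M ^ n) := by gcongr
      _ = C * r * ‖e‖ * (2 * r * M) ^ n := by rw [mul_pow, mul_pow, pow_succ]; ring
  let ρ : NNReal := ⟨(2 * r * M)⁻¹, by positivity⟩
  have hρ : 0 < ρ := by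
    change (0 : ℝ) < (2 * r * M)⁻¹
    positivity
  refine lt_of_lt_of_le (ENNReal.coe_pos.2 hρ)
    ((telescope p L e).le_radius_of_bound (C * r * ‖e‖) fun n => ?_)
  calc ‖telescope p L e n‖ * (ρ : ℝ) ^ n ≤ C * r * ‖e‖ * (2 * r * M) ^ n * (2 * r * M)⁻¹ ^ n :=
        mul_le_mul_of_nonneg_right (hb n) (by positivity)
    _ = C * r * ‖e‖ := by
        rw [mul_assoc, ← mul_pow, mul_inv_cancel₀ (by positivity), one_pow, mul_one]

/-- Hadamard's lemma for the difference of a holomorphic function and its composition with an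
affine map. -/
lemma exists_analyticAt_sub_eq {f : V → ℂ} {x : V} (hf : AnalyticAt ℂ f x) (L : V →L[ℂ] V)
    {ι : Type*} [Fintype ι] (c : V → ι → ℂ) (e : ι → V) (hc : ∀ u, u - L u = ∑ j, c u j • e j) :
    ∃ k : ι → V → ℂ, (∀ j, AnalyticAt ℂ (k j) x) ∧
      ∀ᶠ u in 𝓝 0, f (x + u) - f (x + L u) = ∑ j, c u j * k j (x + u) := by
  obtain ⟨p, hp⟩ := hf
  have hr : ∀ j, 0 < (telescope p L (e j)).radius := fun j =>
    telescope_radius_pos hp.radius_pos L (e j)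
  refine ⟨fun j y => (telescope p L (e j)).sum (y - x), fun j => ?_, ?_⟩
  · have h₁ : AnalyticAt ℂ (telescope p L (e j)).sum (x - x) := by
      rw [sub_self]
      exact ((telescope p L (e j)).hasFPowerSeriesOnBall (hr j)).analyticAt
    exact h₁.comp (f := fun y => y - x) (analyticAt_id.sub analyticAt_const)
  · have h₁ := hp.eventually_hasSum
    have h₂ : ∀ᶠ u in 𝓝 (0 : V), HasSum (fun n => p n fun _ => L u) (f (x + L u)) := by
      have : Filter.Tendsto L (𝓝 0) (𝓝 0) := by simpa using L.continuous.tendsto 0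
      exact this.eventually h₁
    have h₃ : ∀ᶠ u in 𝓝 (0 : V), ∀ j, u ∈ Metric.eball (0 : V) (telescope p L (e j)).radius :=
      Filter.eventually_all.2 fun j => Metric.eball_mem_nhds _ (hr j)
    filter_upwards [h₁, h₂, h₃] with u k₁ k₂ k₃
    have k₄ : HasSum (fun n => telescope p L (u - L u) n fun _ => u)
        (∑ j, c u j * (telescope p L (e j)).sum u) := by
      simp only [hc, telescope_add]
      exact hasSum_sum fun j _ => ((telescope p L (e j)).hasSum (k₃ j)).mul_left _
    simp only [telescope_sub] at k₄
    have k₅ := k₁.sub k₂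
    -- The constant terms cancel; the shift by one matches degree `n + 1` of `p` with degree `n` of
    -- the telescope.
    rw [← hasSum_nat_add_iff' 1] at k₅
    simp only [add_sub_cancel_left]
    have k₆ : (p 0 fun _ => u) = p 0 fun _ => L u := congrArg (p 0) (Subsingleton.elim _ _)
    rw [Finset.sum_range_one, k₆, sub_self, sub_zero] at k₅
    exact k₅.unique k₄

end Hadamard

/-! ### Holomorphic functions along `E × {0}`. -/

section HolomorphicSections

variable {E : Type} [NormedAddCommGroup E] [NormedSpace ℂ E] {n : ℕ}

/-- The value of a holomorphic function at a point. -/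
def evalSec {D : Opens (Aff E)} (z : E) (hz : z ∈ D) : Sec (Aff E) D →ₐ[ℂ] ℂ :=
  (Pi.evalAlgHom ℂ (fun _ : D => ℂ) ⟨z, hz⟩).comp (hol E D).val

lemma sec_ext {D : Opens (Aff E)} {g g' : Sec (Aff E) D}
    (h : ∀ (z : E) (hz : z ∈ D), evalSec z hz g = evalSec z hz g') : g = g' :=
  Subtype.ext (funext fun z => h z.1 z.2)

lemma evalSec_res {D D' : Opens (Aff E)} (h : D' ≤ D) (g : Sec (Aff E) D) (z : E) (hz : z ∈ D') :
    evalSec z hz (res h g) = evalSec z (h hz) g := rfl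

lemma evalSec_coord (L : E →L[ℂ] (Fin n → ℂ)) (j : Fin n) (D : Opens (Aff E)) (z : E)
    (hz : z ∈ D) : evalSec z hz (glob D (coord (linMap L) j)) = L z j := rfl

/-- The section defined by a function that is analytic at all points of an open set. -/
def mkSec (D : Opens (Aff E)) (f : E → ℂ) (hf : ∀ z ∈ D, AnalyticAt ℂ f z) : Sec (Aff E) D :=
  (⟨fun z => f z, fun z => ⟨f, hf z.1 z.2, by simp⟩⟩ : hol E D)

lemma evalSec_mkSec {D : Opens (Aff E)} {f : E → ℂ} (hf : ∀ z ∈ D, AnalyticAt ℂ f z) (z : E)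
    (hz : z ∈ D) : evalSec z hz (mkSec D f hf) = f z := rfl

open Classical in
/-- Extension of a section by zero. -/
def extZero {D : Opens (Aff E)} (g : Sec (Aff E) D) (z : E) : ℂ :=
  if h : z ∈ D then evalSec z h g else 0

lemma extZero_apply {D : Opens (Aff E)} (g : Sec (Aff E) D) {z : E} (hz : z ∈ D) :
    extZero g z = evalSec z hz g := dif_pos hz

lemma analyticAt_extZero {D : Opens (Aff E)} (g : Sec (Aff E) D) {z : E} (hz : z ∈ D) :
    AnalyticAt ℂ (extZero g) z := by
  obtain ⟨k, hk, e⟩ := (show hol E D from g).2 ⟨z, hz⟩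
  refine hk.congr ?_
  have ho : ∀ᶠ y in 𝓝 z, y ∈ (D.1 : Set E) := D.isOpen.mem_nhds hz
  filter_upwards [e, ho] with y h₁ h₂
  rw [extZero_apply g h₂, h₁ h₂]
  rfl

/-- Hadamard's lemma on `E × ℂⁿ`. -/
lemma exists_hadamard {g : E × (Fin n → ℂ) → ℂ} {z : E} (hg : AnalyticAt ℂ g (z, 0)) :
    ∃ k : Fin n → E × (Fin n → ℂ) → ℂ, (∀ j, AnalyticAt ℂ (k j) (z, 0)) ∧
      ∀ᶠ u in 𝓝 (z, 0), g u = g (u.1, 0) + ∑ j, u.2 j * k j u := by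
  -- Take for `L` the projection `(y, w) ↦ (y, 0)`, so that `u - L u` is the combination of the unit
  -- vectors with coefficients `w j`.
  obtain ⟨k, hk, h⟩ := exists_analyticAt_sub_eq hg
    ((ContinuousLinearMap.inl ℂ E (Fin n → ℂ)).comp (ContinuousLinearMap.fst ℂ E (Fin n → ℂ)))
    (fun u => u.2) (fun j => ((0 : E), Pi.single j (1 : ℂ))) (fun u => by
      refine Prod.ext ?_ ?_
      · simp [Prod.fst_sum]
      · funext i
        simp [Prod.snd_sum, Pi.single_apply])
  refine ⟨k, hk, ?_⟩
  have ht : Filter.Tendsto (fun y : E × (Fin n → ℂ) => y - (z, 0)) (𝓝 (z, 0)) (𝓝 0) := by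
    have : Continuous fun y : E × (Fin n → ℂ) => y - (z, 0) := by fun_prop
    simpa using this.tendsto (z, 0)
  filter_upwards [ht.eventually h] with u hu
  rw [add_sub_cancel] at hu
  rw [sub_eq_iff_eq_add'.1 hu]
  simp

lemma exists_sec_hadamard {D : Opens (Aff (E × (Fin n → ℂ)))} (g : Sec (Aff (E × (Fin n → ℂ))) D)
    (z : E) (hz : (z, (0 : Fin n → ℂ)) ∈ D) :
    ∃ (A : Opens (Aff E)) (c : Sec (Aff E) A) (D' : Opens (Aff (E × (Fin n → ℂ)))) (h : D' ≤ D)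
      (hA : D' ≤ preim (linMap (ContinuousLinearMap.fst ℂ E (Fin n → ℂ))) A)
      (k : Fin n → Sec (Aff (E × (Fin n → ℂ))) D'), (z, (0 : Fin n → ℂ)) ∈ D' ∧ z ∈ A ∧
      (∀ (y : E) (hy : y ∈ A), ∃ hy' : (y, (0 : Fin n → ℂ)) ∈ D,
        evalSec y hy c = evalSec (E := E × (Fin n → ℂ)) (y, 0) hy' g) ∧
      res h g = res hA (pull (linMap (ContinuousLinearMap.fst ℂ E (Fin n → ℂ))) A c) +
        ∑ j, glob D' (coord (linMap (ContinuousLinearMap.snd ℂ E (Fin n → ℂ))) j) * k j := by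
  obtain ⟨k, hk, hg⟩ := exists_hadamard (analyticAt_extZero g hz)
  have hi : Continuous fun y : E => (y, (0 : Fin n → ℂ)) := by fun_prop
  let A : Opens (Aff E) := ⟨{y : E | (y, (0 : Fin n → ℂ)) ∈ D}, D.isOpen.preimage hi⟩
  let c : Sec (Aff E) A := mkSec A (fun y => extZero g (y, 0)) fun y hy =>
    (analyticAt_extZero g hy).comp (f := fun y : E => (y, (0 : Fin n → ℂ)))
      (analyticAt_id.prod analyticAt_const)
  have hA : ∀ᶠ u in 𝓝 (z, (0 : Fin n → ℂ)), (u.1, (0 : Fin n → ℂ)) ∈ (D.1 : Set (E × (Fin n → ℂ))) := by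
    have hc : Continuous fun u : E × (Fin n → ℂ) => (u.1, (0 : Fin n → ℂ)) := by fun_prop
    exact (D.isOpen.preimage hc).mem_nhds hz
  have hD : ∀ᶠ u in 𝓝 (z, (0 : Fin n → ℂ)), u ∈ (D.1 : Set (E × (Fin n → ℂ))) := D.isOpen.mem_nhds hz
  have hk' : ∀ᶠ u in 𝓝 (z, (0 : Fin n → ℂ)), ∀ j, AnalyticAt ℂ (k j) u :=
    Filter.eventually_all.2 fun j => (hk j).eventually_analyticAt
  obtain ⟨t, ht, hto, hzt⟩ := eventually_nhds_iff.1 (hg.and (hA.and (hD.and hk')))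
  let D' : Opens (Aff (E × (Fin n → ℂ))) := ⟨t, hto⟩
  refine ⟨A, c, D', fun u hu => (ht u hu).2.2.1, fun u hu => (ht u hu).2.1,
    fun j => mkSec D' (k j) fun u hu => (ht u hu).2.2.2 j, hzt, hz,
    fun y hy => ⟨hy, extZero_apply g hy⟩, sec_ext fun u hu => ?_⟩
  have hu' := (ht u hu).1
  rw [map_add, map_sum]
  simp only [map_mul, evalSec_coord, evalSec_mkSec]
  rw [evalSec_res, ← extZero_apply g, hu']
  rfl

/-- Differentiate the relation at `w = 0` in the direction `v`. The left side gives `∑ v_j g_j(y,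
0)`; on the right the `f l` do not depend on `w`, so the result stays in the ideal that they
generate. -/
lemma exists_sum_eq_of_sum_coord_mul {k : ℕ} {D : Opens (Aff E)} (f : Fin k → Sec (Aff E) D)
    {D' : Opens (Aff (E × (Fin n → ℂ)))}
    (hD : D' ≤ preim (linMap (ContinuousLinearMap.fst ℂ E (Fin n → ℂ))) D)
    (g : Fin n → Sec (Aff (E × (Fin n → ℂ))) D') (a : Fin k → Sec (Aff (E × (Fin n → ℂ))) D')
    (h : ∑ j, glob D' (coord (linMap (ContinuousLinearMap.snd ℂ E (Fin n → ℂ))) j) * g j =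
      ∑ l, a l * res hD (pull (linMap (ContinuousLinearMap.fst ℂ E (Fin n → ℂ))) D (f l)))
    {A : Opens (Aff E)} (c : Fin n → Sec (Aff E) A)
    (hc : ∀ j (y : E) (hy : y ∈ A), ∃ hy' : (y, (0 : Fin n → ℂ)) ∈ D',
      evalSec y hy (c j) = evalSec (E := E × (Fin n → ℂ)) (y, 0) hy' (g j))
    (v : Fin n → ℂ) (hA : A ≤ D) :
    ∃ (b : Fin k → Sec (Aff E) A), ∑ j, v j • c j = ∑ l, b l * res hA (f l) := by
  -- An index `j` is needed to see from `hc` that `(y, 0)` lies in `D'`.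
  by_cases hn : n = 0
  · subst hn
    exact ⟨0, by simp⟩
  have hA' : ∀ y ∈ A, (y, (0 : Fin n → ℂ)) ∈ D' := fun y hy =>
    (hc ⟨0, Nat.pos_of_ne_zero hn⟩ y hy).choose
  -- The new coefficients are the derivatives of the `a l` in the direction `(0, v)`.
  refine ⟨fun l => mkSec A (fun y => fderiv ℂ (extZero (a l)) (y, 0) (0, v)) fun y hy => ?_,
    sec_ext fun y hy => ?_⟩
  · have h₁ : AnalyticAt ℂ (fun y : E => fderiv ℂ (extZero (a l)) (y, 0)) y :=
      (analyticAt_extZero (a l) (hA' y hy)).fderiv.comp (f := fun y : E => (y, (0 : Fin n → ℂ)))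
        (analyticAt_id.prod analyticAt_const)
    exact ((ContinuousLinearMap.apply ℂ ℂ ((0 : E), v)).analyticAt _).comp h₁
  · have hy' := hA' y hy
    let γ : ℂ → E × (Fin n → ℂ) := fun s => (y, s • v)
    have hγ : HasDerivAt γ ((0 : E), v) 0 := by
      have : HasDerivAt (fun s : ℂ => s • v) ((1 : ℂ) • v) 0 := (hasDerivAt_id 0).smul_const v
      rw [one_smul] at this
      exact (hasDerivAt_const (0 : ℂ) y).prodMk this
    have hγ0 : γ 0 = (y, 0) := by simp [γ]
    have hd : ∀ x : Sec (Aff (E × (Fin n → ℂ))) D', HasDerivAt (fun s => extZero x (γ s))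
        (fderiv ℂ (extZero x) (y, 0) (0, v)) 0 := fun x => by
      have h₁ : HasFDerivAt (extZero x) (fderiv ℂ (extZero x) (y, 0)) (γ 0) := by
        rw [hγ0]
        exact (analyticAt_extZero x hy').differentiableAt.hasFDerivAt
      exact h₁.comp_hasDerivAt 0 hγ
    have h₁ : HasDerivAt (fun s => ∑ j, (s * v j) * extZero (g j) (γ s))
        (∑ j, ((1 * v j) * extZero (g j) (γ 0) +
          (0 * v j) * fderiv ℂ (extZero (g j)) (y, 0) (0, v))) 0 :=
      HasDerivAt.fun_sum fun j _ => ((hasDerivAt_id (0 : ℂ)).mul_const (v j)).mul (hd (g j))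
    have h₂ : HasDerivAt (fun s => ∑ l, extZero (a l) (γ s) * evalSec y (hA hy) (f l))
        (∑ l, fderiv ℂ (extZero (a l)) (y, 0) (0, v) * evalSec y (hA hy) (f l)) 0 :=
      HasDerivAt.fun_sum fun l _ => (hd (a l)).mul_const _
    have he : (fun s => ∑ l, extZero (a l) (γ s) * evalSec y (hA hy) (f l)) =ᶠ[𝓝 0]
        fun s => ∑ j, (s * v j) * extZero (g j) (γ s) := by
      have ho : ∀ᶠ s in 𝓝 (0 : ℂ), γ s ∈ (D'.1 : Set (E × (Fin n → ℂ))) :=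
        hγ.continuousAt (D'.isOpen.mem_nhds (by rw [hγ0]; exact hy'))
      filter_upwards [ho] with s hs
      have h₃ := congrArg (evalSec (γ s) hs) h
      rw [map_sum, map_sum] at h₃
      simp only [map_mul] at h₃
      have hx : ∀ x : Sec (Aff (E × (Fin n → ℂ))) D', extZero x (γ s) = evalSec (γ s) hs x :=
        fun x => extZero_apply x hs
      simp only [hx]
      exact h₃.symm
    have h₄ := (h₁.congr_of_eventuallyEq he).unique h₂
    rw [map_sum, map_sum]
    simp only [map_mul, map_smul, smul_eq_mul]
    refine Eq.trans ?_ h₄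
    refine Finset.sum_congr rfl fun j _ => ?_
    obtain ⟨hy'', e⟩ := hc j y hy
    have h₅ : extZero (g j) (γ 0) = evalSec y hy (c j) := by
      rw [hγ0, e]
      exact extZero_apply (g j) hy'
    rw [h₅]
    ring

end HolomorphicSections

/-! ### Germs of functions on spaces and open subspaces. -/

section Germs

variable {X Y Z : Space}

/-- The stalk of the structure sheaf. -/
abbrev Stk (X : Space) (x : X) : CommRingCat.{0} :=
  TopCat.Presheaf.stalk (C := CommRingCat.{0}) (X := (X : TopCat))
    (X.presheaf ⋙ forget₂ (CommAlgCat.{0} ℂ) CommRingCat.{0}) x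

/-- The germ of a section of the structure sheaf. -/
def gm {U : Opens X} (x : X) (hx : x ∈ U) : Sec X U →+* Stk X x :=
  (TopCat.Presheaf.germ (C := CommRingCat.{0}) (X := (X : TopCat))
    (X.presheaf ⋙ forget₂ (CommAlgCat.{0} ℂ) CommRingCat.{0}) U x hx).hom

lemma gm_res {U V : Opens X} (h : V ≤ U) (x : X) (hx : x ∈ V) (s : Sec X U) :
    gm x hx (res h s) = gm x (h hx) s :=
  TopCat.Presheaf.germ_res_apply (C := CommRingCat.{0}) (X := (X : TopCat))
    (X.presheaf ⋙ forget₂ (CommAlgCat.{0} ℂ) CommRingCat.{0}) (homOfLE h) x hx s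

lemma gm_eq_iff {U V : Opens X} (x : X) (hx : x ∈ U) (hx' : x ∈ V) (s : Sec X U) (t : Sec X V) :
    gm x hx s = gm x hx' t ↔ ∃ (W : Opens X) (h : W ≤ U) (h' : W ≤ V), x ∈ W ∧
      res h s = res h' t := by
  constructor
  · intro e
    obtain ⟨W, hW, i, j, e'⟩ := TopCat.Presheaf.germ_eq (C := CommRingCat.{0}) (X := (X : TopCat))
      (X.presheaf ⋙ forget₂ (CommAlgCat.{0} ℂ) CommRingCat.{0}) x hx hx' s t e
    exact ⟨W, leOfHom i, leOfHom j, hW, e'⟩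
  · rintro ⟨W, h, h', hW, e⟩
    rw [← gm_res h x hW, ← gm_res h' x hW, e]

lemma exists_gm_eq (x : X) (a : Stk X x) : ∃ (U : Opens X) (hx : x ∈ U) (s : Sec X U),
    gm x hx s = a :=
  TopCat.Presheaf.exists_germ_eq (C := CommRingCat.{0}) (X := (X : TopCat))
    (X.presheaf ⋙ forget₂ (CommAlgCat.{0} ℂ) CommRingCat.{0}) a

lemma existsUnique_glue {U : Opens X} {ι : Type} (V : ι → Opens X) (hV : ∀ i, V i ≤ U)
    (hU : ∀ x ∈ U, ∃ i, x ∈ V i) (s : ∀ i, Sec X (V i))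
    (hs : ∀ i j, res (inf_le_left : V i ⊓ V j ≤ V i) (s i) = res inf_le_right (s j)) :
    ∃! t : Sec X U, ∀ i, res (hV i) t = s i := by
  obtain rfl : U = iSup V := le_antisymm (fun x hx => Opens.mem_iSup.2 (hU x hx)) (iSup_le hV)
  exact (TopCat.Presheaf.isSheaf_iff_isSheafUniqueGluing X.presheaf).mp X.IsSheaf V s hs

lemma sec_ext_gm {U : Opens X} {s t : Sec X U} (h : ∀ x (hx : x ∈ U), gm x hx s = gm x hx t) :
    s = t := by
  choose W k k' hW e using fun x : U => (gm_eq_iff x.1 x.2 x.2 s t).1 (h x.1 x.2)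
  refine (existsUnique_glue (ι := U) W k (fun x hx => ⟨⟨x, hx⟩, hW _⟩) (fun x => res (k x) t)
    fun i j => ?_).unique e fun _ => rfl
  rw [res_comp, res_comp]

lemma gm_pull_congr (f : X ⟶ Y) {U V : Opens Y} (x : X) (hx : f.hom.base x ∈ U)
    (hx' : f.hom.base x ∈ V) {s : Sec Y U} {t : Sec Y V} (h : gm _ hx s = gm _ hx' t) :
    gm (U := preim f U) x hx (pull f U s) = gm (U := preim f V) x hx' (pull f V t) := by
  obtain ⟨W, k, k', hW, e⟩ := (gm_eq_iff _ hx hx' s t).1 h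
  exact (gm_eq_iff x _ _ _ _).2 ⟨preim f W, fun _ hy => k hy, fun _ hy => k' hy, hW, by
    rw [← pull_res, ← pull_res, e]⟩

lemma gm_pull_of_eq {f g : X ⟶ Y} (e : f = g) {U : Opens Y} (x : X) (hx : f.hom.base x ∈ U)
    (hx' : g.hom.base x ∈ U) (s : Sec Y U) :
    gm (U := preim f U) x hx (pull f U s) = gm (U := preim g U) x hx' (pull g U s) := by
  subst e
  rfl

/-- The image of an open subset of an open subspace. -/
abbrev imOpen {U : Opens X} (V : Opens (sub X U)) : Opens X :=
  U.isOpenEmbedding.isOpenMap.functor.obj V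

/-- A section over an open subset of an open subspace, as a section on the ambient space. -/
def ofSub {U : Opens X} {V : Opens (sub X U)} (s : Sec (sub X U) V) : Sec X (imOpen V) := s

lemma mem_imOpen {U : Opens X} {V : Opens (sub X U)} {x : sub X U} (hx : x ∈ V) :
    (subIncl X U).hom.base x ∈ imOpen V := ⟨x, hx, rfl⟩

lemma imOpen_mono {U : Opens X} {V V' : Opens (sub X U)} (h : V ≤ V') : imOpen V ≤ imOpen V' := by
  rintro _ ⟨y, hy, rfl⟩
  exact mem_imOpen (h hy)

lemma imOpen_preim_le {U : Opens X} (A : Opens X) : imOpen (preim (subIncl X U) A) ≤ A := by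
  rintro _ ⟨y, hy, rfl⟩
  exact hy

lemma gm_pull_subIncl_iff {U : Opens X} {A B : Opens X} (x : sub X U)
    (hA : (subIncl X U).hom.base x ∈ A) (hB : (subIncl X U).hom.base x ∈ B) (s : Sec X A)
    (t : Sec X B) :
    gm (U := preim (subIncl X U) A) x hA (pull (subIncl X U) A s) =
      gm (U := preim (subIncl X U) B) x hB (pull (subIncl X U) B t) ↔ gm _ hA s = gm _ hB t := by
  refine ⟨fun h => ?_, gm_pull_congr _ x hA hB⟩
  obtain ⟨W, k, k', hW, e⟩ := (gm_eq_iff _ _ _ _ _).1 h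
  refine (gm_eq_iff _ _ _ _ _).2 ⟨imOpen W, ?_, ?_, ⟨x, hW, rfl⟩, ?_⟩
  · rintro _ ⟨y, hy, rfl⟩
    exact k hy
  · rintro _ ⟨y, hy, rfl⟩
    exact k' hy
  · have h₁ : ∀ {A : Opens X} (k : W ≤ preim (subIncl X U) A) (h : imOpen W ≤ A) (s : Sec X A),
      ofSub (res k (pull (subIncl X U) A s)) = res h s := fun {A} k h s =>
      res_comp (X := X) (U := A) (V := imOpen (preim (subIncl X U) A)) (W := imOpen W)
        (imOpen_preim_le A) (imOpen_mono k) s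
    exact (h₁ k _ s).symm.trans ((congrArg ofSub e).trans (h₁ k' _ t))

lemma gm_pull_ofSub {U : Opens X} {V : Opens (sub X U)} (x : sub X U) (hx : x ∈ V)
    (s : Sec (sub X U) V) :
    gm (U := preim (subIncl X U) (imOpen V)) x (mem_imOpen hx)
      (pull (subIncl X U) (imOpen V) (ofSub s)) = gm x hx s := by
  refine (gm_eq_iff _ _ _ _ _).2 ⟨V, fun y hy => mem_imOpen hy, le_rfl, hx, ?_⟩
  rw [res_self]
  exact (res_comp (X := X) (U := imOpen V) (V := imOpen (preim (subIncl X U) (imOpen V)))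
    (W := imOpen V) (imOpen_preim_le _) (imOpen_mono fun y hy => mem_imOpen hy) (ofSub s)).trans
    (res_self (X := X) le_rfl _)

end Germs

/-! ### Maps of stalks and local models. -/

section StalkMaps

variable {X Y Z : Space}

/-- The morphism of stalks induced by a morphism of spaces. -/
def stkMap (f : X ⟶ Y) (x : X) : Stk Y (f.hom.base x) →+* Stk X x :=
  (PresheafedSpace.Hom.stalkMap
    ((forget₂ (CommAlgCat.{0} ℂ) CommRingCat.{0}).mapPresheaf.map f.hom) x).hom

/-- The germ of the inverse image of a section. -/
def gp (f : X ⟶ Y) (x : X) {U : Opens Y} (hx : f.hom.base x ∈ U) : Sec Y U →+* Stk X x :=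
  (gm (U := preim f U) x hx).comp (pull f U).toRingHom

lemma gp_apply (f : X ⟶ Y) (x : X) {U : Opens Y} (hx : f.hom.base x ∈ U) (s : Sec Y U) :
    gp f x hx s = gm (U := preim f U) x hx (pull f U s) := rfl

lemma gp_res (f : X ⟶ Y) (x : X) {U V : Opens Y} (h : V ≤ U) (hx : f.hom.base x ∈ V)
    (s : Sec Y U) : gp f x hx (res h s) = gp f x (h hx) s :=
  gm_pull_congr f x hx (h hx) (gm_res h _ hx s)

lemma gp_of_eq {f g : X ⟶ Y} (e : f = g) (x : X) {U : Opens Y} (hx : f.hom.base x ∈ U)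
    (hx' : g.hom.base x ∈ U) (s : Sec Y U) : gp f x hx s = gp g x hx' s :=
  gm_pull_of_eq e x hx hx' s

lemma gp_ofSub {U : Opens X} {V : Opens (sub X U)} (x : sub X U) (hx : x ∈ V)
    (s : Sec (sub X U) V) : gp (subIncl X U) x (mem_imOpen hx) (ofSub s) = gm x hx s :=
  gm_pull_ofSub x hx s

lemma stkMap_gm (f : X ⟶ Y) (x : X) {U : Opens Y} (hx : f.hom.base x ∈ U) (s : Sec Y U) :
    stkMap f x (gm _ hx s) = gp f x hx s :=
  PresheafedSpace.stalkMap_germ_apply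
    ((forget₂ (CommAlgCat.{0} ℂ) CommRingCat.{0}).mapPresheaf.map f.hom) U x hx s

lemma stkMap_subIncl_bijective {U : Opens X} (x : sub X U) :
    Function.Bijective (stkMap (subIncl X U) x) := by
  constructor
  · intro a b h
    obtain ⟨A, hA, s, rfl⟩ := exists_gm_eq _ a
    obtain ⟨B, hB, t, rfl⟩ := exists_gm_eq _ b
    rw [stkMap_gm, stkMap_gm] at h
    exact (gm_pull_subIncl_iff x hA hB s t).1 h
  · intro a
    obtain ⟨A, hA, s, rfl⟩ := exists_gm_eq _ a
    exact ⟨gm _ (mem_imOpen hA) (ofSub s), (stkMap_gm _ _ _ _).trans (gp_ofSub x hA s)⟩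

lemma stkMap_surjective_of_isLocalModel {E : Type} [NormedAddCommGroup E] [NormedSpace ℂ E]
    {κ : Y ⟶ Aff E} {D : Opens (Aff E)} {k : ℕ} {f : Fin k → Sec (Aff E) D}
    (h : IsLocalModel κ D f) (y : Y) (a : Stk Y y) :
    ∃ (D' : Opens (Aff E)) (hy : κ.hom.base y ∈ D') (g : Sec (Aff E) D'),
      a = gp κ y hy g := by
  obtain ⟨V, hV, s, rfl⟩ := exists_gm_eq y a
  obtain ⟨D', g, V', i, i', hy, e⟩ := h.surj V s y hV
  exact ⟨D', i' hy, g, (gm_eq_iff _ _ _ _ _).2 ⟨V', i, i', hy, e⟩⟩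

lemma gp_eq_zero_iff {E : Type} [NormedAddCommGroup E] [NormedSpace ℂ E]
    {κ : Y ⟶ Aff E} {D : Opens (Aff E)} {k : ℕ} {f : Fin k → Sec (Aff E) D}
    (h : IsLocalModel κ D f) (y : Y) {D' : Opens (Aff E)} (hy : κ.hom.base y ∈ D')
    (g : Sec (Aff E) D') : gp κ y hy g = 0 ↔
      ∃ (D'' : Opens (Aff E)) (h : D'' ≤ D') (h' : D'' ≤ D) (a : Fin k → Sec (Aff E) D''),
        κ.hom.base y ∈ D'' ∧ res h g = ∑ j, a j * res h' (f j) := by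
  refine Iff.trans ?_ (h.ker D' g y hy)
  rw [← map_zero (gm (U := preim κ D') y hy)]
  refine (gm_eq_iff (U := preim κ D') (V := preim κ D') y hy hy (pull κ D' g) 0).trans ?_
  constructor
  · rintro ⟨V, i, i', hV, e⟩
    exact ⟨V, i, hV, e.trans (map_zero _)⟩
  · rintro ⟨V, i, hV, e⟩
    exact ⟨V, i, i, hV, e.trans (map_zero _).symm⟩

/-- The equations vanish at the point, so `1` is not in the ideal that they generate there. -/
lemma nontrivial_stk {E : Type} [NormedAddCommGroup E] [NormedSpace ℂ E]
    {κ : Y ⟶ Aff E} {D : Opens (Aff E)} {k : ℕ} {f : Fin k → Sec (Aff E) D}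
    (h : IsLocalModel κ D f) (y : Y) : (1 : Stk Y y) ≠ 0 := by
  intro h10
  have h₁ : gp κ y (Opens.mem_top _) 1 = 0 := by
    rw [map_one, h10]
  obtain ⟨D', i, i', a, hy, e⟩ := (gp_eq_zero_iff h y (Opens.mem_top _) 1).1 h₁
  obtain ⟨hz, hf⟩ := (h.range (κ.hom.base y)).1 ⟨y, rfl⟩
  have h₂ := congrArg (evalSec (E := E) (κ.hom.base y) hy) e
  rw [map_one, map_one, map_sum, Finset.sum_eq_zero] at h₂
  · exact one_ne_zero h₂
  · intro j _
    rw [map_mul]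
    exact mul_eq_zero_of_right _ (hf j)

end StalkMaps

/-! ### Decomposing germs in a product chart. -/

section Charts

variable {E : Type} [NormedAddCommGroup E] [NormedSpace ℂ E] {n : ℕ} {X P : Space} {p : P ⟶ X}
  {q : P ⟶ Aff (Fin n → ℂ)} {U : Opens X} {κ : sub X U ⟶ Aff E}
  {μ : sub P (preim p U) ⟶ Aff (E × (Fin n → ℂ))} {pU : sub P (preim p U) ⟶ sub X U}

/-- The germ of a coordinate function. -/
def cg (q : P ⟶ Aff (Fin n → ℂ)) (y : P) (j : Fin n) : Stk P y := gm y (Opens.mem_top y) (coord q j)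

lemma stkMap_cg (e₃ : subIncl P (preim p U) ≫ q = μ ≫ linMap (ContinuousLinearMap.snd ℂ E (Fin n → ℂ)))
    (y : sub P (preim p U)) (j : Fin n) {D : Opens (Aff (E × (Fin n → ℂ)))}
    (hy : μ.hom.base y ∈ D) :
    stkMap (subIncl P (preim p U)) y (cg q _ j) = gp μ y hy
      (glob D (coord (linMap (ContinuousLinearMap.snd ℂ E (Fin n → ℂ))) j)) := by
  rw [cg, stkMap_gm, glob, gp_res]
  exact gp_of_eq e₃ (U := ⊤) y trivial trivial (linFun (ContinuousLinearMap.proj j))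

/-- The decomposition `s = p^* c + ∑ x_j t_j` of the germ of a function given in a chart. -/
lemma exists_stk_eq_of_chart (e₁ : pU ≫ subIncl X U = subIncl P (preim p U) ≫ p)
    (e₂ : pU ≫ κ = μ ≫ linMap (ContinuousLinearMap.fst ℂ E (Fin n → ℂ)))
    (e₃ : subIncl P (preim p U) ≫ q = μ ≫ linMap (ContinuousLinearMap.snd ℂ E (Fin n → ℂ)))
    (y : sub P (preim p U)) {D D' : Opens (Aff (E × (Fin n → ℂ)))} (h : D' ≤ D)
    (hy : μ.hom.base y ∈ D') (g : Sec (Aff (E × (Fin n → ℂ))) D) {A : Opens (Aff E)}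
    (c : Sec (Aff E) A) (hA : D' ≤ preim (linMap (ContinuousLinearMap.fst ℂ E (Fin n → ℂ))) A)
    (k : Fin n → Sec (Aff (E × (Fin n → ℂ))) D')
    (hg : res h g = res hA (pull (linMap (ContinuousLinearMap.fst ℂ E (Fin n → ℂ))) A c) +
        ∑ j, glob D' (coord (linMap (ContinuousLinearMap.snd ℂ E (Fin n → ℂ))) j) * k j)
    (a : Stk P ((subIncl P (preim p U)).hom.base y))
    (ha : stkMap (subIncl P (preim p U)) y a = gp μ y (h hy) g)
    (hp : p.hom.base ((subIncl P (preim p U)).hom.base y) ∈ imOpen (preim κ A)) :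
    ∃ t : Fin n → Stk P ((subIncl P (preim p U)).hom.base y),
      a = gp p _ hp (ofSub (pull κ A c)) + ∑ j, cg q _ j * t j := by
  choose t ht using fun j => (stkMap_subIncl_bijective y).2 (gp μ y hy (k j))
  refine ⟨t, (stkMap_subIncl_bijective y).1 ?_⟩
  have h₁ : stkMap (subIncl P (preim p U)) y (gp p _ hp (ofSub (pull κ A c))) =
      gp μ y hy (res hA (pull (linMap (ContinuousLinearMap.fst ℂ E (Fin n → ℂ))) A c)) := by
    have hpU : pU.hom.base y ∈ preim κ A := by
      have : (pU ≫ κ).hom.base y ∈ A := by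
        rw [e₂]
        exact hA hy
      exact this
    refine (stkMap_gm (subIncl P (preim p U)) y (U := preim p (imOpen (preim κ A))) hp _).trans ?_
    refine (gp_of_eq e₁.symm (U := imOpen (preim κ A)) y hp (mem_imOpen hpU)
      (ofSub (pull κ A c))).trans ?_
    refine (gm_pull_congr pU y (mem_imOpen hpU) hpU (gp_ofSub _ hpU (pull κ A c))).trans ?_
    refine (gp_of_eq e₂ (U := A) y hpU (hA hy) c).trans ?_
    rw [gp_res]
    rfl
  rw [ha, map_add, map_sum, h₁, ← gp_res μ y h hy g, hg, map_add, map_sum]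
  congr 1
  refine Finset.sum_congr rfl fun j _ => ?_
  rw [map_mul, map_mul, ht, stkMap_cg e₃ y j hy]

end Charts

/-! ### Constant germs. -/

section Constants

variable {X Y : Space}

/-- A constant, as a germ. -/
def cst (x : X) (v : ℂ) : Stk X x := gm x (Opens.mem_top x) (algebraMap ℂ _ v)

lemma gm_algebraMap (x : X) {U : Opens X} (hx : x ∈ U) (v : ℂ) :
    gm x hx (algebraMap ℂ _ v) = cst x v := by
  rw [cst, ← gm_res (le_top : U ≤ ⊤) x hx, AlgHom.commutes]

lemma gm_smul (x : X) {U : Opens X} (hx : x ∈ U) (v : ℂ) (s : Sec X U) :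
    gm x hx (v • s) = cst x v * gm x hx s := by
  rw [Algebra.smul_def, map_mul, gm_algebraMap]

lemma gp_smul (f : X ⟶ Y) (x : X) {U : Opens Y} (hx : f.hom.base x ∈ U) (v : ℂ) (s : Sec Y U) :
    gp f x hx (v • s) = cst x v * gp f x hx s := by
  rw [gp_apply, map_smul]
  exact gm_smul x (U := preim f U) hx v (pull f U s)

lemma stkMap_cst (f : X ⟶ Y) (x : X) (v : ℂ) : stkMap f x (cst _ v) = cst x v := by
  rw [cst, stkMap_gm, gp_apply, AlgHom.commutes]
  exact gm_algebraMap _ _ _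

end Constants

/-! ### Functions along the zero section, and relations between them. -/

section ZeroSection

variable {E : Type} [NormedAddCommGroup E] [NormedSpace ℂ E] {n : ℕ} {X P : Space} {p : P ⟶ X}
  {q : P ⟶ Aff (Fin n → ℂ)} {i₀ : X ⟶ P}

lemma IsZeroSection.base_p (h₀ : IsZeroSection p q i₀) (x : X) : p.hom.base (i₀.hom.base x) = x :=
  congrArg (fun f : X ⟶ X => f.hom.base x) h₀.comp_p

lemma IsZeroSection.gp_coord (h₀ : IsZeroSection p q i₀) (x : X) (j : Fin n) :
    stkMap i₀ x (cg q _ j) = 0 := by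
  rw [cg, stkMap_gm]
  refine Eq.trans ?_ (map_zero (gm x (Opens.mem_top x)))
  exact congrArg (gm x (Opens.mem_top x)) (h₀.coord_eq j)

/-- Only the pulled-back coordinate functions are known to vanish, and morphisms are not assumed
local. If a coordinate were nonzero at the image point, it would be invertible nearby, and its
pull-back would be both zero and a unit. -/
lemma IsZeroSection.base_q (h₀ : IsZeroSection p q i₀) (x : X) (h1 : (1 : Stk X x) ≠ 0) :
    q.hom.base (i₀.hom.base x) = (0 : Fin n → ℂ) := by
  refine funext fun j => ?_
  by_contra hj
  let D : Opens (Aff (Fin n → ℂ)) := ⟨{w : Fin n → ℂ | w j ≠ 0},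
    isOpen_ne_fun (by fun_prop) (by fun_prop)⟩
  let u : Sec (Aff (Fin n → ℂ)) D := mkSec D (fun w => (w j)⁻¹) fun w hw =>
    ((ContinuousLinearMap.proj (R := ℂ) (φ := fun _ : Fin n => ℂ) j).analyticAt w).inv hw
  have h₁ : glob D (linFun (ContinuousLinearMap.proj j)) * u = 1 := sec_ext fun w hw => by
    rw [map_mul, map_one]
    exact mul_inv_cancel₀ hw
  have hx : (i₀ ≫ q).hom.base x ∈ D := hj
  have h₂ := congrArg (gp (i₀ ≫ q) x hx) h₁
  rw [map_mul, map_one, glob, gp_res] at h₂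
  have h₃ : gp (i₀ ≫ q) x (U := ⊤) trivial (linFun (ContinuousLinearMap.proj j)) = 0 :=
    (stkMap_gm i₀ x (Opens.mem_top _) (coord q j)).symm.trans (h₀.gp_coord x j)
  rw [h₃, zero_mul] at h₂
  exact h1 h₂.symm

/-- A point of an open subspace. -/
def subPt {U : Opens X} (x : X) (hx : x ∈ U) : sub X U := ⟨x, hx⟩

lemma base_chart (h₀ : IsZeroSection p q i₀) {U : Opens X} {κ : sub X U ⟶ Aff E}
    {μ : sub P (preim p U) ⟶ Aff (E × (Fin n → ℂ))} {pU : sub P (preim p U) ⟶ sub X U}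
    (e₁ : pU ≫ subIncl X U = subIncl P (preim p U) ≫ p)
    (e₂ : pU ≫ κ = μ ≫ linMap (ContinuousLinearMap.fst ℂ E (Fin n → ℂ)))
    (e₃ : subIncl P (preim p U) ≫ q = μ ≫ linMap (ContinuousLinearMap.snd ℂ E (Fin n → ℂ)))
    (x : X) (hx : x ∈ U) (hy : i₀.hom.base x ∈ preim p U) (h1 : (1 : Stk X x) ≠ 0) :
    μ.hom.base (subPt (i₀.hom.base x) hy) = ((κ.hom.base (subPt x hx) : E), (0 : Fin n → ℂ)) := by
  have h₁ : pU.hom.base (subPt (i₀.hom.base x) hy) = subPt x hx := by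
    refine Subtype.ext ?_
    have := congrArg (fun f : sub P (preim p U) ⟶ X => f.hom.base (subPt (i₀.hom.base x) hy)) e₁
    exact this.trans (h₀.base_p x)
  refine Prod.ext ?_ ?_
  · have := congrArg (fun f : sub P (preim p U) ⟶ Aff E => f.hom.base (subPt (i₀.hom.base x) hy)) e₂
    exact this.symm.trans (congrArg κ.hom.base h₁)
  · have := congrArg (fun f : sub P (preim p U) ⟶ Aff (Fin n → ℂ) =>
      f.hom.base (subPt (i₀.hom.base x) hy)) e₃
    exact this.symm.trans (h₀.base_q x h1)

lemma nontrivial_stk_sub {U : Opens X} {κ : sub X U ⟶ Aff E} {D : Opens (Aff E)} {k : ℕ}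
    {f : Fin k → Sec (Aff E) D} (h : IsLocalModel κ D f) (x : X) (hx : x ∈ U) :
    (1 : Stk X x) ≠ 0 := fun h10 => nontrivial_stk h (subPt x hx) (by
  have := congrArg (stkMap (subIncl X U) (subPt x hx)) h10
  exact (map_one _).symm.trans (this.trans (map_zero _)))

/-- Along the zero section, every function is the sum of a function on `X` and a combination of the
coordinate functions. -/
lemma exists_stk_decomposition (hP : IsProduct p q) (h₀ : IsZeroSection p q i₀) (x : X)
    (a : Stk P (i₀.hom.base x)) :
    ∃ (A : Opens X) (hA : p.hom.base (i₀.hom.base x) ∈ A) (c : Sec X A)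
      (t : Fin n → Stk P (i₀.hom.base x)), a = gp p _ hA c + ∑ j, cg q _ j * t j := by
  obtain ⟨U, hx, m, κ, D, k, f, μ, pU, hκ, hμ, e₁, e₂, e₃⟩ := hP x
  have hy : i₀.hom.base x ∈ preim p U := by
    change p.hom.base (i₀.hom.base x) ∈ U
    rwa [h₀.base_p]
  have hb := base_chart h₀ e₁ e₂ e₃ x hx hy (nontrivial_stk_sub hκ x hx)
  obtain ⟨D', hD', g, hg⟩ := stkMap_surjective_of_isLocalModel hμ (subPt (i₀.hom.base x) hy)
    (stkMap (subIncl P (preim p U)) (subPt (i₀.hom.base x) hy) a)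
  have hz : ((κ.hom.base (subPt x hx) : Fin m → ℂ), (0 : Fin n → ℂ)) ∈ D' := hb ▸ hD'
  obtain ⟨A, c, D'', i, hA, l, hz', hzA, -, e⟩ := exists_sec_hadamard g _ hz
  have hpA : p.hom.base (i₀.hom.base x) ∈ imOpen (preim κ A) := by
    rw [h₀.base_p]
    exact mem_imOpen (x := subPt x hx) (V := preim κ A) hzA
  have hz'' : μ.hom.base (subPt (i₀.hom.base x) hy) ∈ D'' := by
    rw [hb]
    exact hz'
  obtain ⟨t, ht⟩ := exists_stk_eq_of_chart e₁ e₂ e₃ (subPt (i₀.hom.base x) hy) i hz'' g c hA l e a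
    hg hpA
  exact ⟨_, hpA, _, t, ht⟩

lemma gp_p_stkMap (h₀ : IsZeroSection p q i₀) (x : X) {A : Opens X}
    (hA : p.hom.base (i₀.hom.base x) ∈ A) (hx : x ∈ A) (c : Sec X A) :
    stkMap i₀ x (gp p _ hA c) = gm x hx c :=
  (stkMap_gm i₀ x (U := preim p A) hA (pull p A c)).trans
    (gp_of_eq h₀.comp_p x (U := A) hA hx c)

lemma IsZeroSection.stkMap_of_decomposition (h₀ : IsZeroSection p q i₀) (x : X) {A : Opens X}
    (hA : p.hom.base (i₀.hom.base x) ∈ A) (hx : x ∈ A) {c : Sec X A} {a : Stk P (i₀.hom.base x)}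
    {t : Fin n → Stk P (i₀.hom.base x)} (h : a = gp p _ hA c + ∑ j, cg q _ j * t j) :
    stkMap i₀ x a = gm x hx c := by
  rw [h, map_add, gp_p_stkMap h₀ x hA hx, map_sum, Finset.sum_eq_zero, add_zero]
  intro j _
  rw [map_mul, h₀.gp_coord, zero_mul]

/-- The derivative of a relation between the coordinate functions along the zero section. -/
lemma sum_smul_eq_zero (hP : IsProduct p q) (h₀ : IsZeroSection p q i₀) (v : Fin n → ℂ) (x : X)
    (t : Fin n → Stk P (i₀.hom.base x)) (ht : ∑ j, cg q _ j * t j = 0) :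
    ∑ j, cst x (v j) * stkMap i₀ x (t j) = 0 := by
  obtain ⟨U, hx, m, κ, D, k, f, μ, pU, hκ, hμ, e₁, e₂, e₃⟩ := hP x
  have hy : i₀.hom.base x ∈ preim p U := by
    change p.hom.base (i₀.hom.base x) ∈ U
    rwa [h₀.base_p]
  have hb := base_chart h₀ e₁ e₂ e₃ x hx hy (nontrivial_stk_sub hκ x hx)
  choose D₁ hD₁ g₁ hg₁ using fun j => stkMap_surjective_of_isLocalModel hμ
    (subPt (i₀.hom.base x) hy) (stkMap (subIncl P (preim p U)) (subPt (i₀.hom.base x) hy) (t j))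
  obtain ⟨D₀, hD₀, hD₀₁⟩ := exists_nhd_le D₁ _ hD₁
  have hg : ∀ j, stkMap (subIncl P (preim p U)) (subPt (i₀.hom.base x) hy) (t j) =
      gp μ _ hD₀ (res (hD₀₁ j) (g₁ j)) := fun j => (hg₁ j).trans (gp_res μ _ (hD₀₁ j) hD₀ _).symm
  have h₁ : gp μ (subPt (i₀.hom.base x) hy) hD₀ (∑ j, glob D₀
      (coord (linMap (ContinuousLinearMap.snd ℂ (Fin m → ℂ) (Fin n → ℂ))) j) *
        res (hD₀₁ j) (g₁ j)) = 0 := by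
    have h₂ := congrArg (stkMap (subIncl P (preim p U)) (subPt (i₀.hom.base x) hy)) ht
    refine Eq.trans ?_ (h₂.trans (map_zero _))
    refine Eq.trans ?_ (map_sum _ _ _).symm
    rw [map_sum]
    refine Finset.sum_congr rfl fun j _ => ?_
    rw [map_mul]
    refine Eq.trans ?_ (map_mul _ _ _).symm
    exact congrArg₂ (· * ·) (stkMap_cg e₃ _ j hD₀).symm (hg j).symm
  -- The relation holds on `P`, so for the lifts to `ℂ^m × ℂ^n` it holds modulo the equations of
  -- `X`.
  obtain ⟨D₂, i, i', a, hD₂, e⟩ := (gp_eq_zero_iff hμ _ hD₀ _).1 h₁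
  have e' : ∑ j, glob D₂ (coord (linMap (ContinuousLinearMap.snd ℂ (Fin m → ℂ) (Fin n → ℂ))) j) *
      res i (res (hD₀₁ j) (g₁ j)) = ∑ l, a l * res i'
        (pull (linMap (ContinuousLinearMap.fst ℂ (Fin m → ℂ) (Fin n → ℂ))) D (f l)) := by
    rw [← e, map_sum]
    refine Finset.sum_congr rfl fun j _ => ?_
    rw [map_mul, res_glob]
  have hz : ((κ.hom.base (subPt x hx) : Fin m → ℂ), (0 : Fin n → ℂ)) ∈ D₂ := hb ▸ hD₂
  choose A c D₃ i₃ hA l hz₃ hzA hc e₄ using fun j =>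
    exists_sec_hadamard (res i (res (hD₀₁ j) (g₁ j))) _ hz
  obtain ⟨A₀, hzA₀, hA₀⟩ := exists_nhd_le A _ hzA
  have hzD : κ.hom.base (subPt x hx) ∈ D := ((hκ.range _).1 ⟨_, rfl⟩).choose
  have hA₁ : ∀ j, A₀ ⊓ D ≤ A j := fun j => inf_le_left.trans (hA₀ j)
  -- Here `c j` is the restriction of the lift of `t j` to `w = 0`; the differentiated relation lies
  -- in the ideal of `X`, hence vanishes on `X`.
  obtain ⟨b, hb'⟩ := exists_sum_eq_of_sum_coord_mul f i' _ a e' (fun j => res (hA₁ j) (c j))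
    (fun j y hy => hc j y (hA₁ j hy)) v inf_le_right
  have hzA₁ : κ.hom.base (subPt x hx) ∈ A₀ ⊓ D := ⟨hzA₀, hzD⟩
  have h₃ : gp κ (subPt x hx) hzA₁ (∑ j, v j • res (hA₁ j) (c j)) = 0 :=
    (gp_eq_zero_iff hκ _ hzA₁ _).2 ⟨A₀ ⊓ D, le_rfl, inf_le_right, b, hzA₁, by rw [res_self, hb']⟩
  have hpA : ∀ j, p.hom.base (i₀.hom.base x) ∈ imOpen (preim κ (A j)) := fun j => by
    rw [h₀.base_p]
    exact mem_imOpen (x := subPt x hx) (V := preim κ (A j)) (hzA j)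
  have h₄ : ∀ j, stkMap i₀ x (t j) = gm x (mem_imOpen (x := subPt x hx) (V := preim κ (A j))
      (hzA j)) (ofSub (pull κ (A j) (c j))) := fun j => by
    have hz₄ : μ.hom.base (subPt (i₀.hom.base x) hy) ∈ D₃ j := by
      rw [hb]
      exact hz₃ j
    obtain ⟨t', ht'⟩ := exists_stk_eq_of_chart e₁ e₂ e₃ (subPt (i₀.hom.base x) hy) (i₃ j) hz₄ _
      (c j) (hA j) (l j) (e₄ j) (t j)
      ((hg j).trans (gp_res μ _ i hD₂ _).symm) (hpA j)
    exact h₀.stkMap_of_decomposition x (hpA j) _ ht'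
  refine (stkMap_subIncl_bijective (subPt x hx)).1 ?_
  refine Eq.trans ?_ (h₃.trans (map_zero _).symm)
  refine (map_sum _ _ _).trans ?_
  rw [map_sum]
  refine Finset.sum_congr rfl fun j _ => ?_
  rw [gp_smul, h₄ j, gp_res]
  refine (map_mul _ _ _).trans (congrArg₂ (· * ·) (stkMap_cst _ _ _) ?_)
  exact (stkMap_gm _ _ _ _).trans (gp_ofSub (subPt x hx) _ _)

end ZeroSection

/-! ### The derivative along the zero section and the tangent embedding. -/

section Derivation

variable {n : ℕ} {X P : Space} {p : P ⟶ X} {q : P ⟶ Aff (Fin n → ℂ)} {i₀ : X ⟶ P}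

lemma IsZeroSection.mem_of_base (h₀ : IsZeroSection p q i₀) {x : X} {A : Opens X}
    (hA : p.hom.base (i₀.hom.base x) ∈ A) : x ∈ A := by
  rwa [h₀.base_p] at hA

lemma IsZeroSection.gp_eq_of_gm_eq (h₀ : IsZeroSection p q i₀) (x : X) {A B : Opens X}
    (hA : p.hom.base (i₀.hom.base x) ∈ A) (hB : p.hom.base (i₀.hom.base x) ∈ B) (hA' : x ∈ A)
    (hB' : x ∈ B) {c : Sec X A} {d : Sec X B} (h : gm x hA' c = gm x hB' d) :
    gp p _ hA c = gp p _ hB d := by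
  refine gm_pull_congr p (i₀.hom.base x) hA hB ?_
  obtain ⟨W, k, k', hW, e⟩ := (gm_eq_iff x hA' hB' c d).1 h
  exact (gm_eq_iff _ hA hB c d).2 ⟨W, k, k', by rwa [h₀.base_p], e⟩

/-- The derivative along the zero section, in the direction `v`, of a germ. -/
def derStk (hP : IsProduct p q) (h₀ : IsZeroSection p q i₀) (v : Fin n → ℂ) (x : X)
    (a : Stk P (i₀.hom.base x)) : Stk X x :=
  ∑ j, cst x (v j) *
    stkMap i₀ x ((exists_stk_decomposition hP h₀ x a).choose_spec.choose_spec.choose_spec.choose j)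

variable (hP : IsProduct p q) (h₀ : IsZeroSection p q i₀) (v : Fin n → ℂ)

/-- The germ of `c` is forced, being the restriction of `a` to the zero section. So two
decompositions differ by a relation between the coordinates, to which `sum_smul_eq_zero` applies. -/
lemma derStk_eq (x : X) {a : Stk P (i₀.hom.base x)} {A : Opens X}
    (hA : p.hom.base (i₀.hom.base x) ∈ A) {c : Sec X A} {t : Fin n → Stk P (i₀.hom.base x)}
    (h : a = gp p _ hA c + ∑ j, cg q _ j * t j) :
    derStk hP h₀ v x a = ∑ j, cst x (v j) * stkMap i₀ x (t j) := by
  have hd := exists_stk_decomposition hP h₀ x a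
  have hB := hd.choose_spec.choose
  have h' := hd.choose_spec.choose_spec.choose_spec.choose_spec
  set t' := hd.choose_spec.choose_spec.choose_spec.choose with ht'
  have hA' : x ∈ A := by rwa [h₀.base_p] at hA
  have hB' : x ∈ hd.choose := h₀.mem_of_base hB
  have e := h₀.gp_eq_of_gm_eq x hA hB hA' hB' ((h₀.stkMap_of_decomposition x hA hA' h).symm.trans
    (h₀.stkMap_of_decomposition x hB hB' h'))
  have hs : ∑ j, cg q (i₀.hom.base x) j * (t' j - t j) = 0 := by
    simp only [mul_sub, Finset.sum_sub_distrib]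
    have h₁ := h.symm.trans h'
    rw [e] at h₁
    rw [← add_left_cancel h₁, sub_self]
  have h₂ := sum_smul_eq_zero hP h₀ v x _ hs
  simp only [map_sub, mul_sub, Finset.sum_sub_distrib] at h₂
  exact sub_eq_zero.1 h₂

lemma derStk_gp (x : X) {A : Opens X} (hA : p.hom.base (i₀.hom.base x) ∈ A) (c : Sec X A) :
    derStk hP h₀ v x (gp p _ hA c) = 0 := by
  rw [derStk_eq hP h₀ v x hA (c := c) (t := 0) (by simp)]
  simp

lemma derStk_cg (x : X) (j : Fin n) : derStk hP h₀ v x (cg q _ j) = cst x (v j) := by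
  rw [derStk_eq hP h₀ v x (A := ⊤) (Opens.mem_top _) (c := 0) (t := Pi.single j 1)]
  · rw [Finset.sum_eq_single j]
    · simp
    · intro l _ hl
      simp [Pi.single_eq_of_ne hl]
    · simp
  · rw [Finset.sum_eq_single j]
    · simp
    · intro l _ hl
      simp [Pi.single_eq_of_ne hl]
    · simp

lemma derStk_add (x : X) (a b : Stk P (i₀.hom.base x)) :
    derStk hP h₀ v x (a + b) = derStk hP h₀ v x a + derStk hP h₀ v x b := by
  obtain ⟨A, hA, c, t, ha⟩ := exists_stk_decomposition hP h₀ x a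
  obtain ⟨B, hB, d, u, hb⟩ := exists_stk_decomposition hP h₀ x b
  have hAB : p.hom.base (i₀.hom.base x) ∈ A ⊓ B := ⟨hA, hB⟩
  rw [derStk_eq hP h₀ v x hA ha, derStk_eq hP h₀ v x hB hb,
    derStk_eq hP h₀ v x (A := A ⊓ B) hAB (c := res inf_le_left c + res inf_le_right d)
      (t := fun j => t j + u j)]
  · rw [← Finset.sum_add_distrib]
    exact Finset.sum_congr rfl fun j _ => by rw [map_add, mul_add]
  · rw [map_add, gp_res, gp_res, ha, hb]
    simp only [mul_add, Finset.sum_add_distrib]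
    ring

lemma derStk_mul (x : X) (a b : Stk P (i₀.hom.base x)) :
    derStk hP h₀ v x (a * b) =
      stkMap i₀ x a * derStk hP h₀ v x b + stkMap i₀ x b * derStk hP h₀ v x a := by
  obtain ⟨A, hA, c, t, ha⟩ := exists_stk_decomposition hP h₀ x a
  obtain ⟨B, hB, d, u, hb⟩ := exists_stk_decomposition hP h₀ x b
  have hA' : x ∈ A := by rwa [h₀.base_p] at hA
  have hac : stkMap i₀ x a = stkMap i₀ x (gp p _ hA c) := by
    rw [h₀.stkMap_of_decomposition x hA hA' ha, gp_p_stkMap h₀ x hA hA']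
  have hAB : p.hom.base (i₀.hom.base x) ∈ A ⊓ B := ⟨hA, hB⟩
  -- If `a = c + ∑ x_j t_j` and `b = d + ∑ x_j u_j`, then `ab = cd + ∑ x_j (c u_j + b t_j)`.
  rw [derStk_eq hP h₀ v x hA ha, derStk_eq hP h₀ v x hB hb,
    derStk_eq hP h₀ v x (A := A ⊓ B) hAB (c := res inf_le_left c * res inf_le_right d)
      (t := fun j => gp p _ hA c * u j + b * t j)]
  · rw [Finset.mul_sum, Finset.mul_sum, ← Finset.sum_add_distrib]
    refine Finset.sum_congr rfl fun j _ => ?_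
    rw [map_add, map_mul, map_mul, hac]
    ring
  · rw [map_mul, gp_res, gp_res]
    have h₁ : ∑ j, cg q (i₀.hom.base x) j * (gp p _ hA c * u j + b * t j) =
        gp p _ hA c * ∑ j, cg q (i₀.hom.base x) j * u j +
          (∑ j, cg q (i₀.hom.base x) j * t j) * b := by
      rw [Finset.mul_sum, Finset.sum_mul, ← Finset.sum_add_distrib]
      exact Finset.sum_congr rfl fun j _ => by ring
    rw [h₁]
    linear_combination b * ha + gp p _ hA c * hb

lemma derStk_cst (x : X) (z : ℂ) : derStk hP h₀ v x (cst _ z) = 0 := by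
  have : cst (i₀.hom.base x) z = gp p _ (Opens.mem_top _) (algebraMap ℂ (Sec X ⊤) z) := by
    rw [gp_apply, AlgHom.commutes]
    rfl
  rw [this, derStk_gp]

/-- A section is determined by a locally representable family of germs. -/
lemma exists_sec_of_germs {U : Opens X} (φ : ∀ x ∈ U, Stk X x)
    (h : ∀ x ∈ U, ∃ (V : Opens X) (hV : V ≤ U) (d : Sec X V), x ∈ V ∧
      ∀ y (hy : y ∈ V), gm y hy d = φ y (hV hy)) :
    ∃ d : Sec X U, ∀ x (hx : x ∈ U), gm x hx d = φ x hx := by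
  choose V hV d hx hd using fun x : U => h x.1 x.2
  obtain ⟨s, hs, -⟩ := existsUnique_glue V hV (fun x hxU => ⟨⟨x, hxU⟩, hx _⟩) d fun i j =>
    sec_ext_gm fun y hy => by rw [gm_res, gm_res, hd, hd]
  exact ⟨s, fun x hxU => by rw [← gm_res (hV ⟨x, hxU⟩) x (hx ⟨x, hxU⟩), hs, hd]⟩

/-- A decomposition of the germ at one point spreads to a neighbourhood, where the single section `∑
v_j i₀^* u_j` represents the derivative at every point. These local sections glue because their
germs are prescribed. -/
lemma exists_der {W : Opens P} (s : Sec P W) : ∃ d : Sec X (preim i₀ W),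
    ∀ x (hx : i₀.hom.base x ∈ W), gm x (U := preim i₀ W) hx d =
      derStk hP h₀ v x (gm (i₀.hom.base x) (U := W) hx s) := by
  refine exists_sec_of_germs _ fun x hx => ?_
  obtain ⟨A, hA, c, t, ht⟩ := exists_stk_decomposition hP h₀ x (gm (i₀.hom.base x) (U := W) hx s)
  choose B hB u hu using fun j => exists_gm_eq _ (t j)
  obtain ⟨W₀, hW₀, hWB⟩ := exists_nhd_le B _ hB
  let W₁ : Opens P := W₀ ⊓ (preim p A)
  have hx₁ : i₀.hom.base x ∈ W₁ := ⟨hW₀, hA⟩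
  have hWB' : ∀ j, W₁ ≤ B j := fun j => inf_le_left.trans (hWB j)
  have e : gm (i₀.hom.base x) (U := W) hx s = gm _ hx₁ (res (inf_le_right : W₁ ≤ preim p A) (pull p A c) +
      ∑ j, glob W₁ (coord q j) * res (hWB' j) (u j)) := by
    rw [ht, map_add, map_sum, gm_res]
    refine congrArg₂ (· + ·) rfl (Finset.sum_congr rfl fun j _ => ?_)
    rw [map_mul, gm_res, hu, glob, gm_res]
    rfl
  obtain ⟨W', k, k', hW', e'⟩ := (gm_eq_iff _ _ _ _ _).1 e
  refine ⟨preim i₀ W', fun y hy => k hy, ∑ j, v j • pull i₀ W' (res (k'.trans (hWB' j)) (u j)),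
    hW', fun y hy => ?_⟩
  have hyA : p.hom.base (i₀.hom.base y) ∈ A := (k' hy).2
  refine Eq.trans ?_ (derStk_eq hP h₀ v y hyA (c := c)
    (t := fun j => gm (i₀.hom.base y) (hWB' j (k' hy)) (u j)) ?_).symm
  · rw [map_sum]
    refine Finset.sum_congr rfl fun j _ => ?_
    rw [gm_smul, stkMap_gm, ← gp_res i₀ y (k'.trans (hWB' j)) hy]
    rfl
  · have hy' : i₀.hom.base y ∈ W' := hy
    rw [← gm_res k _ hy', e', gm_res, map_add, map_sum, gm_res]
    refine congrArg₂ (· + ·) rfl (Finset.sum_congr rfl fun j _ => ?_)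
    rw [map_mul, gm_res, glob, gm_res]
    rfl

/-- The derivative of a section along the zero section, in the direction `v`. -/
def derSec {W : Opens P} (s : Sec P W) : Sec X (preim i₀ W) := (exists_der hP h₀ v s).choose

lemma gm_derSec {W : Opens P} (s : Sec P W) (x : X) (hx : i₀.hom.base x ∈ W) :
    gm x (U := preim i₀ W) hx (derSec hP h₀ v s) = derStk hP h₀ v x (gm (i₀.hom.base x) (U := W) hx s) :=
  (exists_der hP h₀ v s).choose_spec x hx

/-- The ring homomorphism `s ↦ i₀^* s + t ∂s`. -/
def tangentHom (W : Opens P) : Sec P W →ₐ[ℂ] DualNumber (Sec X (preim i₀ W)) where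
  toFun s := (pull i₀ W s, derSec hP h₀ v s)
  map_one' := by
    refine TrivSqZeroExt.ext (map_one _) (sec_ext_gm fun x (hx : i₀.hom.base x ∈ W) => ?_)
    have := derStk_cst hP h₀ v x 1
    refine (gm_derSec hP h₀ v (1 : Sec P W) x hx).trans ?_
    rw [← gm_algebraMap (i₀.hom.base x) (U := W) hx, map_one, map_one] at this
    rw [map_one]
    exact this.trans (map_zero _).symm
  map_mul' s t := by
    refine TrivSqZeroExt.ext (map_mul _ _ _) (sec_ext_gm fun x (hx : i₀.hom.base x ∈ W) => ?_)
    refine (gm_derSec hP h₀ v (s * t) x hx).trans ?_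
    change _ = gm x hx (pull i₀ W s • derSec hP h₀ v t +
      MulOpposite.op (pull i₀ W t) • derSec hP h₀ v s)
    rw [map_mul, derStk_mul, op_smul_eq_smul, smul_eq_mul, smul_eq_mul, map_add, map_mul, map_mul]
    exact congrArg₂ (· + ·)
      (congrArg₂ (· * ·) (stkMap_gm i₀ x hx s) (gm_derSec hP h₀ v t x hx).symm)
      (congrArg₂ (· * ·) (stkMap_gm i₀ x hx t) (gm_derSec hP h₀ v s x hx).symm)
  map_zero' := by
    refine TrivSqZeroExt.ext (map_zero _) (sec_ext_gm fun x (hx : i₀.hom.base x ∈ W) => ?_)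
    have := derStk_cst hP h₀ v x 0
    refine (gm_derSec hP h₀ v (0 : Sec P W) x hx).trans ?_
    rw [← gm_algebraMap (i₀.hom.base x) (U := W) hx, map_zero, map_zero] at this
    rw [map_zero]
    exact this.trans (map_zero _).symm
  map_add' s t := by
    refine TrivSqZeroExt.ext (map_add _ _ _) (sec_ext_gm fun x (hx : i₀.hom.base x ∈ W) => ?_)
    refine (gm_derSec hP h₀ v (s + t) x hx).trans ?_
    change _ = gm x hx (derSec hP h₀ v s + derSec hP h₀ v t)
    rw [map_add, derStk_add, map_add]
    exact congrArg₂ (· + ·) (gm_derSec hP h₀ v s x hx).symm (gm_derSec hP h₀ v t x hx).symm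
  commutes' z := by
    refine TrivSqZeroExt.ext (AlgHom.commutes _ _) (sec_ext_gm fun x (hx : i₀.hom.base x ∈ W) => ?_)
    refine (gm_derSec hP h₀ v (algebraMap ℂ (Sec P W) z) x hx).trans ?_
    rw [gm_algebraMap, derStk_cst]
    exact (map_zero _).symm

lemma pull_of_eq {X Y : Space} {f g : X ⟶ Y} (e : f = g) (V : Opens Y) (s : Sec Y V) :
    pull f V s = res (le_of_eq (by rw [e])) (pull g V s) := by
  subst e
  exact (res_self _ _).symm

lemma space_hom_ext {X Y : Space} {f g : X ⟶ Y} (w : f.hom.base = g.hom.base)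
    (h : ∀ (V : Opens Y) (s : Sec Y V), pull f V s =
      res (le_of_eq (congrArg (fun b => (Opens.map b).obj V) w) : preim f V ≤ preim g V) (pull g V s)) : f = g := by
  obtain ⟨⟨b, c⟩⟩ := f
  obtain ⟨⟨b', c'⟩⟩ := g
  dsimp only at w
  subst w
  have : c = c' := by
    ext V s
    exact (h V s).trans (res_self _ _)
  subst this
  rfl

/-- The embedding of `double X` in the direction `v`. -/
def tangentEmbedding : double X ⟶ P :=
  InducedCategory.homMk (X := double X) (Y := P)
    { base := i₀.hom.base
      c :=
        { app := fun W => CommAlgCat.ofHom (X := Sec P W.unop)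
            (Y := DualNumber (Sec X (preim i₀ W.unop))) (tangentHom hP h₀ v W.unop)
          naturality := fun W W' i => by
            ext s
            refine TrivSqZeroExt.ext ?_ ?_
            · exact congrArg (fun t => t.hom s) (i₀.hom.c.naturality i)
            · refine sec_ext_gm (X := X) (U := preim i₀ W'.unop) fun x hx => ?_
              replace hx : i₀.hom.base x ∈ W'.unop := hx
              have hx' : x ∈ preim i₀ W.unop := leOfHom i.unop hx
              refine (gm_derSec hP h₀ v (res (leOfHom i.unop) s) x hx).trans ?_
              refine Eq.trans ?_ (gm_res (X := X) (U := preim i₀ W.unop) (V := preim i₀ W'.unop)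
                (fun y hy => leOfHom i.unop hy) x hx (derSec hP h₀ v s)).symm
              rw [gm_res]
              exact (gm_derSec hP h₀ v s x hx').symm } }

/-- Setting `t = 0` leaves `i₀`; the derivative kills functions coming from `X` and takes `x_j` to
`v_j`. -/
lemma isTangentEmbedding_tangentEmbedding :
    IsTangentEmbedding p q i₀ v (tangentEmbedding hP h₀ v) where
  incl := space_hom_ext rfl fun W s => (res_self (X := X) (U := preim i₀ W) le_rfl _).symm
  proj := by
    have w : (tangentEmbedding hP h₀ v ≫ p).hom.base = (dualProj X).hom.base := by
      have := congrArg (fun f : X ⟶ X => f.hom.base) h₀.comp_p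
      exact this
    refine space_hom_ext w fun W s => ?_
    refine TrivSqZeroExt.ext ?_ ?_
    · exact pull_of_eq h₀.comp_p W s
    · refine sec_ext_gm (X := X) (U := preim i₀ (preim p W)) fun x hx => ?_
      refine (gm_derSec hP h₀ v (pull p W s) x hx).trans ?_
      refine (derStk_gp hP h₀ v x (A := W) hx s).trans ?_
      refine (map_zero (gm x (U := preim i₀ (preim p W)) hx)).symm.trans (congrArg _ ?_)
      exact (map_zero (res (X := X) (U := W) (V := preim i₀ (preim p W))
        (le_of_eq (congrArg (fun b => (Opens.map b).obj W) w)))).symm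
  coord_eq j := by
    refine TrivSqZeroExt.ext ?_ ?_
    · refine (h₀.coord_eq j).trans ?_
      exact (smul_zero (v j)).symm
    · refine sec_ext_gm (X := X) (U := ⊤) fun x hx => ?_
      refine (gm_derSec hP h₀ v (coord q j) x hx).trans ?_
      refine (derStk_cg hP h₀ v x j).trans ?_
      refine Eq.trans ?_ (gm_smul x hx (v j) (1 : Sec X ⊤)).symm
      rw [map_one, mul_one]

end Derivation

lemma exists_isTangentEmbedding {X P : Space} {n : ℕ} {p : P ⟶ X} {q : P ⟶ Aff (Fin n → ℂ)}
    (hP : IsProduct p q) {i₀ : X ⟶ P} (h₀ : IsZeroSection p q i₀) (v : Fin n → ℂ) :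
    ∃ h : double X ⟶ P, IsTangentEmbedding p q i₀ v h :=
  ⟨_, isTangentEmbedding_tangentEmbedding hP h₀ v⟩

/-! ### The inclusion of extension groups. -/

section TangentMap

open Abelian

universe w v u

variable {C : Type u} [Category.{v} C] [Abelian C] [HasExt.{w} C] [Linear ℂ C]

/-- The inclusion `Ext¹(E₂, E₁) ⟶ Ext¹(E₁ ⊞ E₂, E₁ ⊞ E₂)`. -/
def extIncl (E₁ E₂ : C) : Ext.{w} E₂ E₁ 1 →ₗ[ℂ] Ext.{w} (E₁ ⊞ E₂) (E₁ ⊞ E₂) 1 where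
  toFun x := (Ext.mk₀ biprod.snd).comp (x.comp (Ext.mk₀ biprod.inl) (add_zero 1)) (zero_add 1)
  map_add' x y := by rw [Ext.add_comp, Ext.comp_add]
  map_smul' r x := by rw [Ext.smul_comp, Ext.comp_smul]; rfl

lemma extIncl_apply {E₁ E₂ : C} (x : Ext.{w} E₂ E₁ 1) : extIncl E₁ E₂ x =
    (Ext.mk₀ biprod.snd).comp (x.comp (Ext.mk₀ biprod.inl) (add_zero 1)) (zero_add 1) := rfl

/-- Restriction along `inr` followed by projection along `fst` is a left inverse. -/
lemma extIncl_injective (E₁ E₂ : C) : Function.Injective (extIncl.{w} E₁ E₂) := by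
  intro x y h
  have h' : ∀ z : Ext.{w} E₂ E₁ 1, (Ext.mk₀ biprod.inr).comp
      ((extIncl E₁ E₂ z).comp (Ext.mk₀ biprod.fst) (add_zero 1)) (zero_add 1) = z := fun z => by
    rw [extIncl_apply, Ext.comp_assoc_of_third_deg_zero, Ext.comp_assoc_of_third_deg_zero,
      Ext.mk₀_comp_mk₀, biprod.inl_fst, Ext.comp_mk₀_id, Ext.mk₀_comp_mk₀_assoc, biprod.inr_snd,
      Ext.mk₀_id_comp]
  rw [← h' x, ← h' y, h]

/-- `inl` and `snd` are natural and see only `g₁` and `g₂`, so `g₁'` and `g₂'` are arbitrary.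
Equivariance is the case where they come from the inverse of `g₁` and from the automorphism inverse
to `g₂`. -/
lemma extIncl_comp {E₁ E₂ E₁' E₂' : C} (g₁ : E₁ ⟶ E₁') (g₂ : E₂' ⟶ E₂) (g₁' : E₁' ⟶ E₁)
    (g₂' : E₂ ⟶ E₂') (x : Ext.{w} E₂ E₁ 1) :
    extIncl E₁' E₂' ((Ext.mk₀ g₂).comp (x.comp (Ext.mk₀ g₁) (add_zero 1)) (zero_add 1)) =
      (Ext.mk₀ (biprod.map g₁' g₂)).comp
        ((extIncl E₁ E₂ x).comp (Ext.mk₀ (biprod.map g₁ g₂')) (add_zero 1)) (zero_add 1) := by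
  simp only [extIncl_apply, Ext.comp_assoc_of_third_deg_zero, Ext.mk₀_comp_mk₀,
    Ext.mk₀_comp_mk₀_assoc, biprod.inl_map, biprod.map_snd]

end TangentMap

end Cpx

end

theorem mainTheorem12 {X P : Cpx.Space} (hX : Cpx.IsComplexSpace X)
    (E₁ E₂ : Cpx.Mod X) (hE₁ : Cpx.IsCoherent E₁) (hE₂ : Cpx.IsCoherent E₂)
    {n : ℕ} (b : Module.Basis (Fin n) ℂ (Cpx.ExtCls E₂ E₁))
    (p : P ⟶ X) (q : P ⟶ Cpx.Aff (Fin n → ℂ)) (hP : Cpx.IsProduct p q)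
    (i₀ : X ⟶ P) (h₀ : Cpx.IsZeroSection p q i₀)
    (U : Cpx.UniversalExtension b p q) :
    (∃ s : E₂ ⟶ U.fibre h₀, s ≫ U.β h₀ = 𝟙 E₂) ∧
    ∀ s : E₂ ⟶ U.fibre h₀, s ≫ U.β h₀ = 𝟙 E₂ →
      ∃ φ : U.fibre h₀ ≅ E₁ ⊞ E₂, φ.inv = biprod.desc (U.α h₀) s ∧
        ∃ τ : Cpx.ExtCls E₂ E₁ →ₗ[ℂ] Cpx.ExtCls (E₁ ⊞ E₂) (E₁ ⊞ E₂),
          (∀ (ξ : Cpx.ExtCls E₂ E₁) (c : Cpx.ExtCls (E₁ ⊞ E₂) (E₁ ⊞ E₂)),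
            Cpx.IsTangentValue p q i₀ U.sheaf φ (b.repr ξ) c ↔ c = τ ξ) ∧
          (∀ ξ : Cpx.ExtCls E₂ E₁, τ ξ =
            (Abelian.Ext.mk₀ (φ.inv ≫ U.β h₀)).comp
              (ξ.comp (Abelian.Ext.mk₀ (U.α h₀ ≫ φ.hom)) (add_zero 1)) (zero_add 1)) ∧
          (∀ ξ : Cpx.ExtCls E₂ E₁, τ ξ =
            ((Abelian.Ext.mk₀ (φ.inv ≫ U.β h₀)).comp ξ (zero_add 1)).comp
              (Abelian.Ext.mk₀ (U.α h₀ ≫ φ.hom)) (add_zero 1)) ∧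
          Function.Injective τ ∧
          ∀ (g : Aut E₁ × Aut E₂) (ξ : Cpx.ExtCls E₂ E₁),
            τ (Cpx.act g ξ) =
              Cpx.act (Cpx.autSum E₁ E₂ g, Cpx.autSum E₁ E₂ g) (τ ξ) := by
  refine ⟨U.exists_section h₀, fun s hs => ?_⟩
  obtain ⟨w, hU⟩ := U.shortExact_fibre h₀
  obtain ⟨φ, hφ, hα, hsφ, hβ⟩ := Cpx.exists_iso_biprod hU s hs
  refine ⟨φ, hφ, Cpx.extIncl E₁ E₂, fun x z => ?_, fun x => ?_, fun x => ?_,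
    Cpx.extIncl_injective E₁ E₂, fun g x => Cpx.extIncl_comp _ _ _ _ x⟩
  · exact U.isTangentValue_iff h₀ hE₁ hE₂ hs φ hα hsφ x (Cpx.exists_isTangentEmbedding hP h₀ _) z
  -- Under `φ` the maps `α` and `β` are `inl` and `snd`, so both formulas reduce to `extIncl`.
  · rw [hβ, hα]
    rfl
  · rw [hβ, hα, Abelian.Ext.comp_assoc_of_third_deg_zero]
    rfl
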